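/- Let $n>1$, let $K$ be a nonzero commutative $\mathbb C$-algebra and $\eta\in K$ (for $K=\mathbb C[\eta]$ one gets the Yangian over $\mathbb C[\eta]$). In $sl(n+1)=sl(n+1,\mathbb C)$ let $e_{ij}$ ($i\neq j$) be the matrix units and $e_{ii}=E_{ii}-\frac1{n+1}\mathbf 1$; put $h_{\alpha_i}=e_{ii}-e_{i+1\,i+1}$, $e_{\alpha_i}=e_{i\,i+1}$, $e_{-\alpha_i}=e_{i+1\,i}$. The Drinfeldian $D'_{q\eta}(sl(n+1))$, with $\hbar=\log q$, is the $\hbar$-adically complete algebra over $K[[\hbar]]$ generated by $h_{\alpha_i},e_{\pm\alpha_i}$ $(1\le i\le n)$, $\xi_{\delta-\theta}$ and $h_\delta$, with the relations of $U_q(sl(n+1))$ (in particular $[e_{\alpha_i},e_{-\alpha_j}]=\delta_{ij}[h_{\alpha_i}]_q$ and the $q$-Serre relations) and the following ones, in which $[a,b]_q=ab-q^{(\mathrm{wt}\,a,\mathrm{wt}\,b)}ba$, $[x]_q=\frac{q^x-q^{-x}}{q-q^{-1}}$, the $e_{ii}$ are the corresponding combinations of the $h_{\alpha_k}$, and $e_{ji}=[e_{j\,j-1},e_{j-1\,i}]_q$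 for $j>i+1$: $h_\delta$ is central; $[e_{11},\xi_{\delta-\theta}]=-\xi_{\delta-\theta}$; $[e_{ii},\xi_{\delta-\theta}]=0$ for $2\le i\le n$; $[e_{n+1\,n+1},\xi_{\delta-\theta}]=\xi_{\delta-\theta}$; $[\xi_{\delta-\theta},e_{i+1\,i}]=0$ for $1\le i\le n$; $[e_{i\,i+1},\xi_{\delta-\theta}]=0$ for $2\le i\le n-1$; $[e_{12},[e_{12},\xi_{\delta-\theta}]_q]_q=0$; $[[\xi_{\delta-\theta},e_{n\,n+1}]_q,e_{n\,n+1}]_q=0$; $$[[e_{12},\xi_{\delta-\theta}]_q,\xi_{\delta-\theta}]_q=\eta\, q^{e_{11}+e_{n+1\,n+1}}\bigl(q^{-2}[e_{12},e_{n+1\,1}]\xi_{\delta-\theta}-e_{n+1\,1}[e_{12},\xi_{\delta-\theta}]_q\bigr),$$ $$[\xi_{\delta-\theta},[\xi_{\delta-\theta},e_{n\,n+1}]_q]_q=\eta\, q^{e_{11}+e_{n+1\,n+1}+1}\bigl(q[e_{n+1\,1},e_{n\,n+1}]\xi_{\delta-\theta}-e_{n+1\,1}[\xi_{\delta-\theta},e_{n\,n+1}]_q\bigr).$$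 The Yangian $Y'_\eta(sl(n+1))$ is the $K$-algebra $D'_{q\eta}(sl(n+1))/(\hbar)$, that is, the Drinfeldian at $q=1$. Then there is a homomorphism of $\mathbb C$-algebras $U(sl(n+1))\to Y'_\eta(sl(n+1))$ that matches the Chevalley generators, and it induces an inclusion $U(sl(n+1))\oplus\mathbb C h_\delta\subset Y'_\eta(sl(n+1))$. As a unital associative $K$-algebra, $Y'_\eta(sl(n+1))$ is generated by $U(sl(n+1))$, $\xi_{\delta-\theta}$ and $h_\delta$ with the defining relations $$[h_\delta,\text{everything}]=0,\quad [e_{11},\xi_{\delta-\theta}]=-\xi_{\delta-\theta},\quad [e_{n+1\,n+1},\xi_{\delta-\theta}]=\xi_{\delta-\theta},\quad [e_{ii},\xi_{\delta-\theta}]=0\ (2\le i\le n),$$ $$[\xi_{\delta-\theta},e_{i+1\,i}]=0\ (1\le i\le n),\qquad [e_{i\,i+1},\xi_{\delta-\theta}]=0\ (2\le i\le n-1),$$ $$[e_{12},[e_{12},\xi_{\delta-\theta}]]=0,\qquad [[\xi_{\delta-\theta},e_{n\,n+1}],e_{n\,n+1}]=0,$$ $$[[e_{12},\xi_{\delta-\theta}],\xi_{\delta-\theta}]=\eta\bigl([e_{12},e_{n+1\,1}]\xi_{\delta-\theta}-e_{n+1\,1}[e_{12},\xi_{\delta-\theta}]\bigr),$$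 $$[\xi_{\delta-\theta},[\xi_{\delta-\theta},e_{n\,n+1}]]=\eta\bigl([e_{n+1\,1},e_{n\,n+1}]\xi_{\delta-\theta}-e_{n+1\,1}[\xi_{\delta-\theta},e_{n\,n+1}]\bigr).$$ Moreover $Y'_\eta(sl(n+1))$ has exactly one Hopf algebra structure over $K$ such that $\Delta_\eta(x)=x\otimes1+1\otimes x$ and $S_\eta(x)=-x$ for $x\in sl(n+1)\oplus\mathbb C h_\delta$, and $$\Delta_\eta(\xi_{\delta-\theta})=\xi_{\delta-\theta}\otimes1+1\otimes\xi_{\delta-\theta}+\eta\Bigl(\tfrac12h_\delta\otimes e_{n+1\,1}+\sum_{i=1}^{n+1}e_{n+1\,i}\otimes e_{i1}\Bigr),$$ $$S_\eta(\xi_{\delta-\theta})=-\xi_{\delta-\theta}+\eta\Bigl(\tfrac12h_\delta e_{n+1\,1}+\sum_{i=1}^{n+1}e_{n+1\,i}e_{i1}\Bigr).$$ On the generators $h_{\alpha_i}$, $e_{\pm\alpha_i}$, $h_\delta$, $\xi_{\delta-\theta}$ its comultiplication and antipode are the values at $q=1$ of the formulas for the Drinfeldian: $h_{\alpha_i}$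 and $h_\delta$ are primitive with $S(h)=-h$; $\Delta(e_{\alpha_i})=e_{\alpha_i}\otimes1+q^{-h_{\alpha_i}}\otimes e_{\alpha_i}$, $\Delta(e_{-\alpha_i})=e_{-\alpha_i}\otimes q^{h_{\alpha_i}}+1\otimes e_{-\alpha_i}$, $S(e_{\alpha_i})=-q^{h_{\alpha_i}}e_{\alpha_i}$, $S(e_{-\alpha_i})=-e_{-\alpha_i}q^{-h_{\alpha_i}}$; $$\Delta(\xi_{\delta-\theta})=\xi_{\delta-\theta}\otimes1+q^{e_{11}-e_{n+1\,n+1}-h_\delta}\otimes\xi_{\delta-\theta}+\eta\Bigl(e_{n+1\,1}q^{e_{n+1\,n+1}}\otimes[e_{11}]_q+\bigl[\tfrac{h_\delta}2+e_{n+1\,n+1}\bigr]_q q^{-h_\delta/2}\otimes e_{n+1\,1}q^{e_{n+1\,n+1}}+\sum_{i=2}^{n}e_{n+1\,i}q^{e_{n+1\,n+1}}\otimes e_{i1}q^{e_{ii}}\Bigr)\bigl(q^{e_{11}}\otimes q^{e_{11}}\bigr);$$ $$S(\xi_{\delta-\theta})=-q^{h_\delta-e_{11}+e_{n+1\,n+1}}\xi_{\delta-\theta}+\eta\bigl[\tfrac{h_\delta}2+e_{11}+e_{n+1\,n+1}+1\bigr]_q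 q^{h_\delta/2-e_{11}+e_{n+1\,n+1}-1}e_{n+1\,1}+\eta\sum_{k=1}^{n}q^{-k}(q-q^{-1})^{k-1}\sum_{n\ge i_k>\dots>i_1\ge2}e_{n+1\,i_k}e_{i_ki_{k-1}}\cdots e_{i_11}q^{-2e_{11}}.$$ -/

import Mathlib

open scoped TensorProduct PowerSeries

noncomputable section

namespace DrinfeldYangian

universe u v

/-! ### Power series in `ħ = log q` -/

section PowerSeriesCalculus

variable {R : Type u} [Ring R] [Algebra ℂ R]

/-- `q ^ x = exp (ħ x)`, where `ħ = log q` is the (central) variable of the power series ring. -/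
def qpow (x : R) : R⟦X⟧ :=
  PowerSeries.mk fun k => ((k.factorial : ℂ)⁻¹) • x ^ k

/-- Division by `ħ` of a power series whose constant term is zero. -/
def divHbar (f : R⟦X⟧) : R⟦X⟧ :=
  PowerSeries.mk fun k => PowerSeries.coeff (k + 1) f

/-- The `q`-number `[x]_q = (q ^ x - q ^ (-x)) / (q - q⁻¹)`: numerator and denominator are both
divided by `ħ`, after which the denominator is an invertible element of `ℂ⟦ħ⟧`. -/
def qnum (x : R) : R⟦X⟧ :=
  divHbar (qpow x - qpow (-x)) *
    PowerSeries.map (algebraMap ℂ R) (divHbar (qpow (1 : ℂ) - qpow (-1 : ℂ)))⁻¹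

/-- The `q`-commutator `[a, b]_q = a b - q ^ k b a` of two vectors whose weights have
scalar product `k`. -/
def qcomm (k : ℤ) (a b : R⟦X⟧) : R⟦X⟧ :=
  a * b - qpow (k : R) * (b * a)

/-- The elementary tensor `a ⊗ b` of two power series, as a power series with coefficients in the
tensor product: its `m`-th coefficient is `∑ aᵢ ⊗ bⱼ` over `i + j = m`. -/
def tmulSeries (K : Type v) [CommRing K] [Algebra K R] (a b : R⟦X⟧) : (R ⊗[K] R)⟦X⟧ :=
  PowerSeries.map
      (Algebra.TensorProduct.includeLeft : R →ₐ[K] R ⊗[K] R).toRingHom a *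
    PowerSeries.map
      (Algebra.TensorProduct.includeRight : R →ₐ[K] R ⊗[K] R).toRingHom b

end PowerSeriesCalculus

/-! ### Generators -/

/-- The generators `h_{αᵢ}`, `e_{αᵢ}`, `e_{-αᵢ}` (`i = 0, …, n - 1` stands for `α_{i+1}`),
`ξ_{δ-θ}` and `h_δ`. -/
inductive Gen (n : ℕ) : Type
  | h (i : Fin n) : Gen n
  | e (i : Fin n) : Gen n
  | f (i : Fin n) : Gen n
  | xi : Gen n
  | hdelta : Gen n

section Drinfeldian

variable (K : Type u) [CommRing K] [Algebra ℂ K]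

/-- The free unital associative `K`-algebra on the generators. -/
abbrev Free (n : ℕ) : Type u := FreeAlgebra K (Gen n)

variable {n : ℕ}

/-- A generator, as an element of the free algebra. -/
abbrev gen (g : Gen n) : Free K n := FreeAlgebra.ι K g

/-- A generator, as a constant power series in `ħ`. -/
abbrev genS (g : Gen n) : (Free K n)⟦X⟧ := PowerSeries.C (gen K g)

/-- The scalar product `(αᵢ, αⱼ)` of simple roots of type `A`. -/
def cartan (i j : Fin n) : ℤ :=
  if i = j then 2 else if i.val + 1 = j.val ∨ j.val + 1 = i.val then -1 else 0

variable (n) in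
/-- The Cartan element `e_{i+1,i+1}` (so `i = 0, …, n`):
`(n h_{α₁} + (n-1) h_{α₂} + ⋯ + h_{αₙ}) / (n + 1) - h_{α₁} - ⋯ - h_{αᵢ}`. -/
def diagElt (i : ℕ) : Free K n :=
  ((n : ℂ) + 1)⁻¹ • (∑ j : Fin n, ((n : ℂ) - (j.val : ℂ)) • gen K (Gen.h j)) -
    ∑ j : Fin n, if j.val < i then gen K (Gen.h j) else 0

variable (n) in
/-- `lowRoot i j` is the root vector `e_{j+1,i+1}` for `0 ≤ i < j ≤ n` (and `0` otherwise):
`e_{i+1,i}` is a Chevalley generator, and `e_{j+1,i} = [e_{j+1,j}, e_{j,i}]_q` for `i < j`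
(the weights `ε_{j+1} - ε_j` and `ε_j - ε_i` have scalar product `-1`). -/
def lowRoot (i : ℕ) : ℕ → (Free K n)⟦X⟧
  | 0 => 0
  | j + 1 =>
    if hj : j < n then
      if j = i then genS K (Gen.f ⟨j, hj⟩)
      else if i < j then qcomm (-1) (genS K (Gen.f ⟨j, hj⟩)) (lowRoot i j)
      else 0
    else 0

/-- The defining relations of the Drinfeldian `D'_{qη}(sl(n+1))`; the relations
`q ^ h x = q ^ c x q ^ h` are written in the logarithmic form `[h, x] = c x`. -/
inductive DrinfeldianRel (η : K) : (Free K n)⟦X⟧ → (Free K n)⟦X⟧ → Prop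
  -- the relations of `U_q(sl(n+1))`
  | hh (i j : Fin n) :
      DrinfeldianRel η ⁅genS K (Gen.h i), genS K (Gen.h j)⁆ 0
  | he (i j : Fin n) :
      DrinfeldianRel η ⁅genS K (Gen.h i), genS K (Gen.e j)⁆ (cartan i j • genS K (Gen.e j))
  | hf (i j : Fin n) :
      DrinfeldianRel η ⁅genS K (Gen.h i), genS K (Gen.f j)⁆ (-(cartan i j • genS K (Gen.f j)))
  | ef_same (i : Fin n) :
      DrinfeldianRel η ⁅genS K (Gen.e i), genS K (Gen.f i)⁆ (qnum (gen K (Gen.h i)))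
  | ef_ne (i j : Fin n) (hij : i ≠ j) :
      DrinfeldianRel η ⁅genS K (Gen.e i), genS K (Gen.f j)⁆ 0
  | ee (i j : Fin n) (hij : i.val + 2 ≤ j.val ∨ j.val + 2 ≤ i.val) :
      DrinfeldianRel η ⁅genS K (Gen.e i), genS K (Gen.e j)⁆ 0
  | ff (i j : Fin n) (hij : i.val + 2 ≤ j.val ∨ j.val + 2 ≤ i.val) :
      DrinfeldianRel η ⁅genS K (Gen.f i), genS K (Gen.f j)⁆ 0
  | serre_e (i j : Fin n) (hij : i.val + 1 = j.val ∨ j.val + 1 = i.val) :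
      DrinfeldianRel η
        (qcomm 1 (qcomm (-1) (genS K (Gen.e i)) (genS K (Gen.e j))) (genS K (Gen.e j))) 0
  | serre_f (i j : Fin n) (hij : i.val + 1 = j.val ∨ j.val + 1 = i.val) :
      DrinfeldianRel η
        (qcomm 1 (qcomm (-1) (genS K (Gen.f i)) (genS K (Gen.f j))) (genS K (Gen.f j))) 0
  -- `h_δ` is central
  | hdelta (g : Gen n) :
      DrinfeldianRel η ⁅genS K (Gen.hdelta : Gen n), genS K g⁆ 0
  -- the weight of `ξ_{δ-θ}`
  | xi_first :
      DrinfeldianRel η ⁅PowerSeries.C (diagElt K n 0), genS K (Gen.xi : Gen n)⁆ (-genS K (Gen.xi : Gen n))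
  | xi_mid (i : ℕ) (h0 : 0 < i) (hn : i < n) :
      DrinfeldianRel η ⁅PowerSeries.C (diagElt K n i), genS K (Gen.xi : Gen n)⁆ 0
  | xi_last :
      DrinfeldianRel η ⁅PowerSeries.C (diagElt K n n), genS K (Gen.xi : Gen n)⁆ (genS K (Gen.xi : Gen n))
  -- `ξ_{δ-θ}` and the Chevalley generators
  | xi_f (i : Fin n) :
      DrinfeldianRel η ⁅genS K (Gen.xi : Gen n), genS K (Gen.f i)⁆ 0
  | e_xi (i : Fin n) (h0 : 0 < i.val) (hn : i.val + 1 < n) :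
      DrinfeldianRel η ⁅genS K (Gen.e i), genS K (Gen.xi : Gen n)⁆ 0
  | e_e_xi (i : Fin n) (h0 : i.val = 0) :
      DrinfeldianRel η
        (qcomm 1 (genS K (Gen.e i)) (qcomm (-1) (genS K (Gen.e i)) (genS K (Gen.xi : Gen n)))) 0
  | xi_e_e (i : Fin n) (hn : i.val + 1 = n) :
      DrinfeldianRel η
        (qcomm 1 (qcomm (-1) (genS K (Gen.xi : Gen n)) (genS K (Gen.e i))) (genS K (Gen.e i))) 0
  | e_xi_xi (i : Fin n) (h0 : i.val = 0) :
      DrinfeldianRel η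
        (qcomm 1 (qcomm (-1) (genS K (Gen.e i)) (genS K (Gen.xi : Gen n))) (genS K (Gen.xi : Gen n)))
        (η • (qpow (diagElt K n 0 + diagElt K n n) *
          (qpow (-2 : Free K n) * ⁅genS K (Gen.e i), lowRoot K n 0 n⁆ * genS K (Gen.xi : Gen n) -
            lowRoot K n 0 n * qcomm (-1) (genS K (Gen.e i)) (genS K (Gen.xi : Gen n)))))
  | xi_xi_e (i : Fin n) (hn : i.val + 1 = n) :
      DrinfeldianRel η
        (qcomm 1 (genS K (Gen.xi : Gen n)) (qcomm (-1) (genS K (Gen.xi : Gen n)) (genS K (Gen.e i))))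
        (η • (qpow (diagElt K n 0 + diagElt K n n + 1) *
          (qpow (1 : Free K n) * ⁅lowRoot K n 0 n, genS K (Gen.e i)⁆ * genS K (Gen.xi : Gen n) -
            lowRoot K n 0 n * qcomm (-1) (genS K (Gen.xi : Gen n)) (genS K (Gen.e i)))))

variable (n)

/-- The closure, for the `ħ`-adic topology, of the two-sided ideal generated by the relations:
the elements that lie in the ideal modulo every power of `ħ`. -/
def drinfeldianIdeal (η : K) : TwoSidedIdeal (Free K n)⟦X⟧ :=
  ⨅ m : ℕ, TwoSidedIdeal.span {x | ∃ a b, DrinfeldianRel K η a b ∧ x = a - b} ⊔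
    TwoSidedIdeal.span {(PowerSeries.X : (Free K n)⟦X⟧) ^ m}

/-- The Drinfeldian `D'_{qη}(sl(n+1))`, the `ħ`-adically complete algebra generated by the
generators subject to the relations. -/
abbrev Drinfeldian (η : K) : Type u :=
  RingQuot fun a b : (Free K n)⟦X⟧ => a - b ∈ drinfeldianIdeal K n η

/-- The quotient map from power series in the generators to the Drinfeldian. -/
def toDrinfeldian (η : K) : (Free K n)⟦X⟧ →ₐ[K] Drinfeldian K n η :=
  RingQuot.mkAlgHom K _

/-- The Yangian `Y'_η(sl(n+1))`: the Drinfeldian at `q = 1`, that is, modulo `ħ = log q`. -/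
abbrev Yangian (η : K) : Type u :=
  RingQuot fun a b : Drinfeldian K n η => a = toDrinfeldian K n η PowerSeries.X ∧ b = 0

/-- The map from polynomials in the generators to the Yangian. -/
def toYangian (η : K) : Free K n →ₐ[K] Yangian K n η :=
  FreeAlgebra.lift K fun g => RingQuot.mkAlgHom K
    (fun a b : Drinfeldian K n η => a = toDrinfeldian K n η PowerSeries.X ∧ b = 0)
    (toDrinfeldian K n η (genS K g))

/-- The element `ξ_{δ-θ}` of the Yangian. -/
abbrev yangianXi (η : K) : Yangian K n η := toYangian K n η (gen K Gen.xi)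

/-- The element `h_δ` of the Yangian. -/
abbrev yangianHdelta (η : K) : Yangian K n η := toYangian K n η (gen K Gen.hdelta)

/-! ### The Hopf structure of the Drinfeldian on generators -/

/-- The comultiplication of the Drinfeldian on the generators
(`Δ(h) = h ⊗ 1 + 1 ⊗ h` says that `q ^ h` is group-like). -/
def drinfeldianComul (η : K) : Gen n → (Free K n ⊗[K] Free K n)⟦X⟧
  | Gen.h i => tmulSeries K (genS K (Gen.h i)) 1 + tmulSeries K 1 (genS K (Gen.h i))
  | Gen.e i => tmulSeries K (genS K (Gen.e i)) 1 +
      tmulSeries K (qpow (-gen K (Gen.h i))) (genS K (Gen.e i))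
  | Gen.f i => tmulSeries K (genS K (Gen.f i)) (qpow (gen K (Gen.h i))) +
      tmulSeries K 1 (genS K (Gen.f i))
  | Gen.hdelta => tmulSeries K (genS K Gen.hdelta) 1 + tmulSeries K 1 (genS K Gen.hdelta)
  | Gen.xi =>
      let hd : Free K n := (2 : ℂ)⁻¹ • gen K Gen.hdelta
      let e1 : Free K n := diagElt K n 0
      let eN : Free K n := diagElt K n n
      tmulSeries K (genS K Gen.xi) 1 +
        tmulSeries K (qpow (e1 - eN - gen K Gen.hdelta)) (genS K Gen.xi) +
        η • ((tmulSeries K (lowRoot K n 0 n * qpow eN) (qnum e1) +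
              tmulSeries K (qnum (hd + eN) * qpow (-hd)) (lowRoot K n 0 n * qpow eN) +
              ∑ i ∈ Finset.Ioo 0 n,
                tmulSeries K (lowRoot K n i n * qpow eN)
                  (lowRoot K n 0 i * qpow (diagElt K n i))) *
            tmulSeries K (qpow e1) (qpow e1))

/-- `e_{a,b₁} e_{b₁,b₂} ⋯ e_{b_k,1}` for the list `b₁, …, b_k` (with indices shifted by one). -/
def chainProd : ℕ → List ℕ → (Free K n)⟦X⟧
  | a, [] => lowRoot K n 0 a
  | a, b :: l => lowRoot K n b a * chainProd b l

/-- The antipode of the Drinfeldian on the generators. -/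
def drinfeldianAntipode (η : K) : Gen n → (Free K n)⟦X⟧
  | Gen.h i => -genS K (Gen.h i)
  | Gen.e i => -(qpow (gen K (Gen.h i)) * genS K (Gen.e i))
  | Gen.f i => -(genS K (Gen.f i) * qpow (-gen K (Gen.h i)))
  | Gen.hdelta => -genS K Gen.hdelta
  | Gen.xi =>
      let hd : Free K n := (2 : ℂ)⁻¹ • gen K Gen.hdelta
      let e1 : Free K n := diagElt K n 0
      let eN : Free K n := diagElt K n n;
      -(qpow (gen K Gen.hdelta - e1 + eN) * genS K Gen.xi) +
        η • (qnum (hd + e1 + eN + 1) * qpow (hd - e1 + eN - 1) * lowRoot K n 0 n) +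
        η • ∑ k ∈ Finset.Icc 1 n,
          qpow (-(k : Free K n)) * (qpow (1 : Free K n) - qpow (-1 : Free K n)) ^ (k - 1) *
            ∑ s ∈ (Finset.Ioo 0 n).powersetCard k,
              chainProd K n n (s.sort (· ≥ ·)) * qpow (-(2 * e1))

end Drinfeldian

/-! ### The presentation over `U(sl(n+1))` -/

/-- The element `e_{ij}` of `sl(n+1, ℂ)`: the matrix unit for `i ≠ j`, and the traceless part
`E_{ii} - 1 / (n + 1)` of the matrix unit for `i = j`. -/
def slUnit (n : ℕ) (i j : Fin (n + 1)) : LieAlgebra.SpecialLinear.sl (Fin (n + 1)) ℂ :=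
  ⟨Matrix.single i j 1 - (if i = j then ((n : ℂ) + 1)⁻¹ else 0) • 1, by
    change Matrix.trace (_ : Matrix (Fin (n + 1)) (Fin (n + 1)) ℂ) = 0
    have h : (n : ℂ) + 1 ≠ 0 := by exact_mod_cast Nat.succ_ne_zero n
    by_cases hij : i = j
    · subst hij
      simp [Matrix.trace_sub, Matrix.trace_smul, h]
    · simp [hij, Matrix.trace_single_eq_of_ne]⟩

/-- The universal enveloping algebra `U(sl(n+1, ℂ))`. -/
abbrev Usl (n : ℕ) : Type :=
  UniversalEnvelopingAlgebra ℂ (LieAlgebra.SpecialLinear.sl (Fin (n + 1)) ℂ)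

section Relations

variable {K : Type u} [CommRing K] {n : ℕ} {A : Type v} [Ring A] [Algebra ℂ A] [Algebra K A]

/-- The image of `e_{ij}` under a homomorphism from `U(sl(n+1))`. -/
def unitImage (φ : Usl n →ₐ[ℂ] A) (i j : Fin (n + 1)) : A :=
  φ (UniversalEnvelopingAlgebra.ι ℂ (slUnit n i j))

/-- The defining relations of `Y'_η(sl(n+1))` for a homomorphism `φ` from `U(sl(n+1))` to a
`K`-algebra and two elements `ξ = ξ_{δ-θ}`, `hδ` of it. The indices `0` and `Fin.last n` stand for
`1` and `n + 1`, and `e_{i,i+1}` is the image of `e i.castSucc i.succ` for `i : Fin n`. -/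
structure YangianRelations (η : K) (φ : Usl n →ₐ[ℂ] A) (ξ hδ : A) : Prop where
  hdelta_U : ∀ u : Usl n, ⁅hδ, φ u⁆ = 0
  hdelta_xi : ⁅hδ, ξ⁆ = 0
  first_xi : ⁅unitImage φ 0 0, ξ⁆ = -ξ
  last_xi : ⁅unitImage φ (Fin.last n) (Fin.last n), ξ⁆ = ξ
  mid_xi : ∀ i : Fin (n + 1), i ≠ 0 → i ≠ Fin.last n → ⁅unitImage φ i i, ξ⁆ = 0
  xi_f : ∀ i : Fin n, ⁅ξ, unitImage φ i.succ i.castSucc⁆ = 0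
  e_xi : ∀ i : Fin n, 0 < i.val → i.val + 1 < n → ⁅unitImage φ i.castSucc i.succ, ξ⁆ = 0
  e_e_xi : ∀ i : Fin n, i.val = 0 →
    ⁅unitImage φ i.castSucc i.succ, ⁅unitImage φ i.castSucc i.succ, ξ⁆⁆ = 0
  xi_e_e : ∀ i : Fin n, i.val + 1 = n →
    ⁅⁅ξ, unitImage φ i.castSucc i.succ⁆, unitImage φ i.castSucc i.succ⁆ = 0
  e_xi_xi : ∀ i : Fin n, i.val = 0 →
    ⁅⁅unitImage φ i.castSucc i.succ, ξ⁆, ξ⁆ =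
      η • (⁅unitImage φ i.castSucc i.succ, unitImage φ (Fin.last n) 0⁆ * ξ -
        unitImage φ (Fin.last n) 0 * ⁅unitImage φ i.castSucc i.succ, ξ⁆)
  xi_xi_e : ∀ i : Fin n, i.val + 1 = n →
    ⁅ξ, ⁅ξ, unitImage φ i.castSucc i.succ⁆⁆ =
      η • (⁅unitImage φ (Fin.last n) 0, unitImage φ i.castSucc i.succ⁆ * ξ -
        unitImage φ (Fin.last n) 0 * ⁅ξ, unitImage φ i.castSucc i.succ⁆)

end Relations

/-! ### Hopf structures -/

/-- A Hopf algebra structure on a given `K`-algebra. -/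
structure HopfStructure (K : Type u) (A : Type v) [CommRing K] [Ring A] [Algebra K A] where
  /-- The comultiplication. -/
  comul : A →ₐ[K] A ⊗[K] A
  /-- The counit. -/
  counit : A →ₐ[K] K
  /-- The antipode. -/
  antipode : A →ₗ[K] A
  coassoc : (Algebra.TensorProduct.assoc K K K A A A).toAlgHom.comp
      ((Algebra.TensorProduct.map comul (.id K A)).comp comul) =
    (Algebra.TensorProduct.map (.id K A) comul).comp comul
  counit_comul : (Algebra.TensorProduct.map counit (.id K A)).comp comul =
    (Algebra.TensorProduct.lid K A).symm
  comul_counit : (Algebra.TensorProduct.map (.id K A) counit).comp comul =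
    (Algebra.TensorProduct.rid K K A).symm
  antipode_left : LinearMap.mul' K A ∘ₗ antipode.rTensor A ∘ₗ comul.toLinearMap =
    Algebra.linearMap K A ∘ₗ counit.toLinearMap
  antipode_right : LinearMap.mul' K A ∘ₗ antipode.lTensor A ∘ₗ comul.toLinearMap =
    Algebra.linearMap K A ∘ₗ counit.toLinearMap

/-- A Hopf structure makes the algebra a Hopf algebra. -/
abbrev HopfStructure.toHopfAlgebra {K : Type u} {A : Type v} [CommRing K] [Ring A] [Algebra K A]
    (H : HopfStructure K A) : HopfAlgebra K A :=
  letI : Bialgebra K A :=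
    Bialgebra.ofAlgHom H.comul H.counit H.coassoc H.counit_comul H.comul_counit
  { antipode := H.antipode
    mul_antipode_rTensor_comul := H.antipode_left
    mul_antipode_lTensor_comul := H.antipode_right }

section YangianHopf

variable {K : Type u} [CommRing K] {n : ℕ} {A : Type v} [Ring A] [Algebra ℂ A] [Algebra K A]

/-- The formulas for the comultiplication and the antipode of the Yangian: `sl(n+1) ⊕ ℂ h_δ` is
primitive, and `ξ_{δ-θ}` has the corrections that are linear in `η`. -/
structure IsYangianHopf (η : K) (φ : Usl n →ₐ[ℂ] A) (ξ hδ : A) (H : HopfStructure K A) :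
    Prop where
  comul_prim : ∀ (x : LieAlgebra.SpecialLinear.sl (Fin (n + 1)) ℂ) (c : ℂ),
    H.comul (φ (UniversalEnvelopingAlgebra.ι ℂ x) + c • hδ) =
      (φ (UniversalEnvelopingAlgebra.ι ℂ x) + c • hδ) ⊗ₜ[K] 1 +
        1 ⊗ₜ[K] (φ (UniversalEnvelopingAlgebra.ι ℂ x) + c • hδ)
  antipode_prim : ∀ (x : LieAlgebra.SpecialLinear.sl (Fin (n + 1)) ℂ) (c : ℂ),
    H.antipode (φ (UniversalEnvelopingAlgebra.ι ℂ x) + c • hδ) =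
      -(φ (UniversalEnvelopingAlgebra.ι ℂ x) + c • hδ)
  comul_xi : H.comul ξ = ξ ⊗ₜ[K] 1 + 1 ⊗ₜ[K] ξ +
    η • (((2 : ℂ)⁻¹ • hδ) ⊗ₜ[K] unitImage φ (Fin.last n) 0 +
      ∑ i : Fin (n + 1), unitImage φ (Fin.last n) i ⊗ₜ[K] unitImage φ i 0)
  antipode_xi : H.antipode ξ = -ξ +
    η • (((2 : ℂ)⁻¹ • hδ) * unitImage φ (Fin.last n) 0 +
      ∑ i : Fin (n + 1), unitImage φ (Fin.last n) i * unitImage φ i 0)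

/-- The comultiplication and the antipode of the Yangian take on every generator the value that is
obtained from the formulas of the Drinfeldian by setting `q = 1` (that is, `ħ = 0`). -/
def IsSpecialization [Algebra ℂ K] (η : K) (H : HopfStructure K (Yangian K n η)) : Prop :=
  ∀ g : Gen n,
    H.comul (toYangian K n η (gen K g)) =
        Algebra.TensorProduct.map (toYangian K n η) (toYangian K n η)
          (PowerSeries.constantCoeff (drinfeldianComul K n η g)) ∧
      H.antipode (toYangian K n η (gen K g)) =
        toYangian K n η (PowerSeries.constantCoeff (drinfeldianAntipode K n η g))

end YangianHopf

end DrinfeldYangian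

end

/-!
Modulo `ħ` the Drinfeldian is presented by the constant terms of its relations
(`toYangian_eq_of_rel`, `exists_yangian_lift`). At `q = 1` these are the relations of Chevalley
generators of `sl(n+1)` together with the relations of `ξ_{δ-θ}` and `h_δ`. Serre's theorem in type
`A` is proved directly: root vectors are defined as iterated brackets, and the bracket of each
Chevalley generator with each of them is computed (`ChevalleyGenerators.lie_e_rootVec`,
`ChevalleyGenerators.lie_f_rootVec`), so that sending matrix units to root vectors is compatible
with bracketing by a generating set, hence a homomorphism (`ChevalleyGenerators.exists_lieHom`).
This gives the homomorphism from `U(sl(n+1))` and the presentation over `U(sl(n+1))`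
(`exists_lift_of_relations`). The sum `U(sl(n+1)) + ℂ h_δ` is direct since `ξ_{δ-θ} ↦ 0` and any
central value of `h_δ` solve the relations, in particular in `K ⊗ U(sl(n+1))` and in `K`.

By the presentation, the comultiplication and the antipode exist as soon as the prescribed values
solve the defining relations in `Y ⊗ Y` and in the opposite algebra of `Y`. Write
`Q a b = ½ h_δ ⊗ e_{ab} + ∑ i, e_{ai} ⊗ e_{ib}`. The matrix units act on the `Q a b` as they act on
matrix units (`lie_matMul`), so `Q_{n+1,1}` satisfies all relations of `ξ_{δ-θ}` that are linear in
it (`isLowest_of_equivariant`). For the first quadratic relation one compares the coefficients of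
`η` and of `η²`; the latter is the identity `lie_matMul_matMul` for products of commuting families
of matrix units (`QuadRel.comul`). The term with `h_δ` is absorbed in a central shift of the
diagonal entries, and the second quadratic relation follows from the first one through the diagram
automorphism (`revFamily`). The antipode is treated in the same way (`QuadRel.antipode`).
Coassociativity and the counit laws are checked on generators; so are the antipode laws, because the
elements that satisfy both of them form a subalgebra (`antipodeSubalgebra`). A Hopf structure is
determined by its comultiplication, which gives the uniqueness.
-/

namespace DrinfeldYangian

universe u

/-! ### Matrix units of `sl(n+1)` -/

/-- The commutation relations of the matrix units of `gl(N)`, for a family of elements of a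
Lie ring. -/
def GlRel {L : Type*} [LieRing L] {N : ℕ} (E : Fin N → Fin N → L) : Prop :=
  ∀ i j k l, ⁅E i j, E k l⁆ = (if j = k then E i l else 0) - (if i = l then E k j else 0)

theorem coe_slUnit (n : ℕ) (i j : Fin (n + 1)) :
    (slUnit n i j : Matrix (Fin (n + 1)) (Fin (n + 1)) ℂ) =
      Matrix.single i j 1 - (if i = j then ((n : ℂ) + 1)⁻¹ else 0) • 1 := rfl

/-- The traceless matrix units satisfy the relations of `gl(n+1)`: they are the images of the
matrix units under the projection along the scalar matrices. -/
theorem glRel_slUnit (n : ℕ) : GlRel (slUnit n) := by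
  intro i j k l
  apply Subtype.ext
  change (slUnit n i j).1 * (slUnit n k l).1 - (slUnit n k l).1 * (slUnit n i j).1 = _
  simp only [coe_slUnit]
  have key : ∀ (a b : ℂ) (M M' : Matrix (Fin (n + 1)) (Fin (n + 1)) ℂ),
      (M - a • 1) * (M' - b • 1) - (M' - b • 1) * (M - a • 1) = M * M' - M' * M := by
    intro a b M M'
    simp only [sub_mul, mul_sub, smul_mul_assoc, mul_smul_comm, one_mul, mul_one]
    rw [smul_sub, smul_sub, smul_comm a b]
    abel
  rw [key]
  by_cases h1 : j = k <;> by_cases h2 : i = l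
  · subst h1 h2
    by_cases h3 : i = j
    · subst h3; simp
    · simp [coe_slUnit]
  · subst h1
    simp [h2, coe_slUnit, Matrix.single_mul_single_of_ne _ _ _ _ (Ne.symm h2)]
  · subst h2
    simp [h1, coe_slUnit, Matrix.single_mul_single_of_ne _ _ _ _ h1, Ne.symm h1]
  · simp [h1, h2, Matrix.single_mul_single_of_ne _ _ _ _ h1,
      Matrix.single_mul_single_of_ne _ _ _ _ (Ne.symm h2)]

theorem sum_slUnit_diag (n : ℕ) : ∑ i, slUnit n i i = 0 := by
  apply Subtype.ext
  have h : (n : ℂ) + 1 ≠ 0 := by exact_mod_cast Nat.succ_ne_zero n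
  rw [AddSubmonoidClass.coe_finsetSum]
  simp only [coe_slUnit, if_true, Finset.sum_sub_distrib, Finset.sum_const, Finset.card_univ,
    Fintype.card_fin, ← Matrix.sum_single_one]
  rw [← Nat.cast_smul_eq_nsmul ℂ, smul_smul]
  simp [h]

theorem sl_eq_sum (n : ℕ) (M : LieAlgebra.SpecialLinear.sl (Fin (n + 1)) ℂ) :
    M = ∑ i, ∑ j, M.1 i j • slUnit n i j := by
  apply Subtype.ext
  have h0 : ∑ i, M.1 i i = 0 := M.2
  simp only [AddSubmonoidClass.coe_finsetSum, SetLike.val_smul, coe_slUnit, smul_sub,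
    Finset.sum_sub_distrib, smul_smul, ← Finset.sum_smul]
  have h1 : ∑ i, ∑ j, M.1 i j * (if i = j then ((n : ℂ) + 1)⁻¹ else 0) = 0 := by
    simp [← Finset.sum_mul, h0]
  rw [h1, zero_smul, sub_zero]
  simp only [Matrix.smul_single, smul_eq_mul, mul_one]
  exact Matrix.matrix_eq_sum_single _

/-- The Lie algebra `sl(n+1)` is generated by its Chevalley generators. -/
theorem lieSpan_chevalley (n : ℕ)
    (S : LieSubalgebra ℂ (LieAlgebra.SpecialLinear.sl (Fin (n + 1)) ℂ))
    (he : ∀ i : Fin n, slUnit n i.castSucc i.succ ∈ S)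
    (hf : ∀ i : Fin n, slUnit n i.succ i.castSucc ∈ S) : S = ⊤ := by
  have up : ∀ (j i : Fin (n + 1)), i < j → slUnit n i j ∈ S ∧ slUnit n j i ∈ S := by
    intro j
    induction j using Fin.induction with
    | zero => intro i hi; exact absurd hi (Fin.not_lt_zero i)
    | succ j ih =>
      intro i hi
      rcases (Fin.le_castSucc_iff.2 hi).eq_or_lt with h | h
      · subst h; exact ⟨he j, hf j⟩
      · have h1 : i ≠ j.succ := hi.ne
        constructor
        · have := S.lie_mem (ih i h).1 (he j)
          rw [glRel_slUnit] at this
          simpa [h1] using this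
        · have := S.lie_mem (hf j) (ih i h).2
          rw [glRel_slUnit] at this
          simpa [h1, h1.symm] using this
  have dg : ∀ i j, slUnit n i i - slUnit n j j ∈ S := by
    intro i j
    rcases lt_trichotomy i j with h | h | h
    · have := S.lie_mem (up j i h).1 (up j i h).2
      rw [glRel_slUnit] at this
      simpa using this
    · simp [h]
    · have := S.lie_mem (up i j h).2 (up i j h).1
      rw [glRel_slUnit] at this
      simpa using this
  have dg0 : ∀ i, slUnit n i i ∈ S := by
    intro i
    have h : (n : ℂ) + 1 ≠ 0 := by exact_mod_cast Nat.succ_ne_zero n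
    have : slUnit n i i = ((n : ℂ) + 1)⁻¹ • ∑ j, (slUnit n i i - slUnit n j j) := by
      rw [Finset.sum_sub_distrib, sum_slUnit_diag, sub_zero, Finset.sum_const, Finset.card_univ,
        Fintype.card_fin, ← Nat.cast_smul_eq_nsmul ℂ, smul_smul]
      simp [h]
    rw [this]
    exact S.smul_mem _ (sum_mem fun j _ => dg i j)
  rw [eq_top_iff]
  intro M _
  rw [sl_eq_sum n M]
  refine sum_mem fun i _ => sum_mem fun j _ => S.smul_mem _ ?_
  rcases lt_trichotomy i j with h | h | h
  · exact (up j i h).1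
  · exact h ▸ dg0 i
  · exact (up i j h).2

/-! ### Serre's theorem for `sl(n+1)` -/

section Serre

variable {L : Type*} [LieRing L]

/-- Chevalley generators of type `A_n` in a Lie ring. The Cartan part is spanned by the `d a`
(`0 ≤ a ≤ n`), which play the role of the diagonal matrix units; the simple coroots are
`d k - d (k + 1)`. Values of the families outside the ranges `a ≤ n`, `k < n` play no role. -/
structure ChevalleyGenerators (n : ℕ) (d e f : ℕ → L) : Prop where
  dd : ∀ a b, a ≤ n → b ≤ n → ⁅d a, d b⁆ = 0
  de : ∀ a k, a ≤ n → k < n →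
    ⁅d a, e k⁆ = (if a = k then e k else 0) - (if a = k + 1 then e k else 0)
  df : ∀ a k, a ≤ n → k < n →
    ⁅d a, f k⁆ = (if a = k + 1 then f k else 0) - (if a = k then f k else 0)
  ef : ∀ k, k < n → ⁅e k, f k⁆ = d k - d (k + 1)
  ef_ne : ∀ i j, i < n → j < n → i ≠ j → ⁅e i, f j⁆ = 0
  ee : ∀ i j, i + 2 ≤ j → j < n → ⁅e i, e j⁆ = 0
  ff : ∀ i j, i + 2 ≤ j → j < n → ⁅f i, f j⁆ = 0
  serre_e_left : ∀ k, k + 1 < n → ⁅e k, ⁅e k, e (k + 1)⁆⁆ = 0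
  serre_e_right : ∀ k, k + 1 < n → ⁅e (k + 1), ⁅e k, e (k + 1)⁆⁆ = 0
  serre_f_left : ∀ k, k + 1 < n → ⁅f k, ⁅f k, f (k + 1)⁆⁆ = 0
  serre_f_right : ∀ k, k + 1 < n → ⁅f (k + 1), ⁅f k, f (k + 1)⁆⁆ = 0

/-- The Chevalley involution `e ↦ -f`, `f ↦ -e`, `d ↦ -d`. -/
theorem ChevalleyGenerators.swap {n : ℕ} {d e f : ℕ → L} (H : ChevalleyGenerators n d e f) :
    ChevalleyGenerators n (-d) (-f) (-e) where
  dd a b ha hb := by simp [H.dd a b ha hb]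
  de a k ha hk := by
    simp only [Pi.neg_apply, lie_neg, neg_lie, neg_neg, H.df a k ha hk]
    split_ifs <;> simp
  df a k ha hk := by
    simp only [Pi.neg_apply, lie_neg, neg_lie, neg_neg, H.de a k ha hk]
    split_ifs <;> simp
  ef k hk := by
    simp only [Pi.neg_apply, lie_neg, neg_lie, neg_neg]
    rw [← lie_skew, H.ef k hk]; abel
  ef_ne i j hi hj h := by
    simp only [Pi.neg_apply, lie_neg, neg_lie, neg_neg]
    rw [← lie_skew, H.ef_ne j i hj hi h.symm, neg_zero]
  ee i j h hj := by simp [H.ff i j h hj]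
  ff i j h hj := by simp [H.ee i j h hj]
  serre_e_left k hk := by simp [H.serre_f_left k hk]
  serre_e_right k hk := by simp [H.serre_f_right k hk]
  serre_f_left k hk := by simp [H.serre_e_left k hk]
  serre_f_right k hk := by simp [H.serre_e_right k hk]

/-- The positive root vector `[…[[e a, e (a+1)], e (a+2)], …, e (b-1)]` for `a < b`. -/
def upperRoot (e : ℕ → L) (a : ℕ) : ℕ → L
  | 0 => 0
  | b + 1 => if b = a then e a else if a < b then ⁅upperRoot e a b, e b⁆ else 0

theorem upperRoot_self (e : ℕ → L) (a : ℕ) : upperRoot e a (a + 1) = e a := by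
  simp [upperRoot]

theorem upperRoot_succ (e : ℕ → L) {a b : ℕ} (h : a < b) :
    upperRoot e a (b + 1) = ⁅upperRoot e a b, e b⁆ := by
  simp [upperRoot, h, h.ne']

/-- The elements that correspond to the matrix units, built from Chevalley generators. -/
def rootVec (d e f : ℕ → L) (a b : ℕ) : L :=
  if a < b then upperRoot e a b else if b < a then -upperRoot (-f) b a else d a

theorem rootVec_of_lt (d e f : ℕ → L) {a b : ℕ} (h : a < b) :
    rootVec d e f a b = upperRoot e a b := if_pos h

theorem rootVec_self (d e f : ℕ → L) (a : ℕ) : rootVec d e f a a = d a := by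
  simp [rootVec]

theorem rootVec_swap (d e f : ℕ → L) (a b : ℕ) :
    rootVec (-d) (-f) (-e) a b = -rootVec d e f b a := by
  unfold rootVec
  rcases lt_trichotomy a b with h | h | h
  · simp [h, h.not_gt]
  · simp [h]
  · simp [h, h.not_gt]

theorem rootVec_lower_one (d e f : ℕ → L) (a : ℕ) : rootVec d e f (a + 1) a = f a := by
  unfold rootVec
  rw [if_neg (by omega), if_pos (by omega), upperRoot_self, Pi.neg_apply, neg_neg]

section

variable {n : ℕ} {d e f : ℕ → L}

theorem ChevalleyGenerators.lie_d_upper (H : ChevalleyGenerators n d e f) (c : ℕ) (hc : c ≤ n)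
    {a b : ℕ} (hab : a < b) (hb : b ≤ n) :
    ⁅d c, upperRoot e a b⁆ =
      (if c = a then upperRoot e a b else 0) - (if c = b then upperRoot e a b else 0) := by
  induction b, hab using Nat.le_induction with
  | base => rw [upperRoot_self, H.de c a hc (by omega)]
  | succ b hab ih =>
    rw [upperRoot_succ _ hab, leibniz_lie, ih (by omega), H.de c b hc (by omega)]
    by_cases h1 : c = a
    · subst h1
      have h2 : c ≠ b := by omega
      have h3 : c ≠ b + 1 := by omega
      simp [h2, h3]
    · by_cases h2 : c = b
      · subst h2
        simp only [h1, if_true, if_false, zero_sub, sub_zero, neg_lie, sub_self,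
          show ¬c = c + 1 by omega, neg_add_cancel]
      · simp only [h1, h2, if_false]
        split_ifs <;> simp

/-- Simple root vectors that are not adjacent to the interval `[a, b)` commute with the root
vector of the interval. -/
theorem ChevalleyGenerators.lie_e_upper_gt (H : ChevalleyGenerators n d e f) {a b k : ℕ}
    (hab : a < b) (hbk : b < k) (hk : k < n) : ⁅e k, upperRoot e a b⁆ = 0 := by
  induction b, hab using Nat.le_induction with
  | base => rw [upperRoot_self, ← lie_skew, H.ee a k (by omega) hk, neg_zero]
  | succ b hab ih =>
    rw [upperRoot_succ _ hab, leibniz_lie, ih (by omega), ← lie_skew (e k) (e b),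
      H.ee b k (by omega) hk]
    simp

theorem ChevalleyGenerators.lie_e_upper_lt (H : ChevalleyGenerators n d e f) {a b k : ℕ}
    (hab : a < b) (hka : k + 1 < a) (hb : b ≤ n) : ⁅e k, upperRoot e a b⁆ = 0 := by
  induction b, hab using Nat.le_induction with
  | base => rw [upperRoot_self, H.ee k a (by omega) (by omega)]
  | succ b hab ih =>
    rw [upperRoot_succ _ hab, leibniz_lie, ih (by omega), H.ee k b (by omega) (by omega)]
    simp

theorem ChevalleyGenerators.lie_e_upper_prev (H : ChevalleyGenerators n d e f) {a b : ℕ}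
    (hab : a + 1 < b) (hb : b ≤ n) : ⁅e a, upperRoot e (a + 1) b⁆ = upperRoot e a b := by
  induction b, hab using Nat.le_induction with
  | base => rw [upperRoot_self, upperRoot_succ _ (by omega), upperRoot_self]
  | succ b hab ih =>
    rw [upperRoot_succ _ hab, leibniz_lie, ih (by omega), H.ee a b (by omega) (by omega),
      upperRoot_succ _ (by omega)]
    simp

/-- The bracket of `e k` with the root vector of an interval that contains `k` vanishes. -/
theorem ChevalleyGenerators.lie_e_upper_mid [IsAddTorsionFree L]
    (H : ChevalleyGenerators n d e f) {a b : ℕ} (hab : a < b) (hb : b ≤ n) : ∀ k, a ≤ k → k < b → ⁅e k, upperRoot e a b⁆ = 0 := by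
  induction b, hab using Nat.le_induction with
  | base =>
    intro k h1 h2
    obtain rfl : k = a := by omega
    rw [upperRoot_self, lie_self]
  | succ b hab ih =>
    intro k h1 h2
    have hab' : a < b := hab
    obtain rfl | ⟨c, rfl⟩ : b = a + 1 ∨ ∃ c, b = c + 1 := by
      right; exact ⟨b - 1, by omega⟩
    · rw [upperRoot_succ _ (by omega), upperRoot_self]
      obtain rfl | rfl : k = a ∨ k = a + 1 := by omega
      · exact H.serre_e_left k (by omega)
      · exact H.serre_e_right a (by omega)
    by_cases hca : c = a
    · subst hca
      rw [upperRoot_succ _ (by omega), upperRoot_self]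
      obtain rfl | rfl : k = c ∨ k = c + 1 := by omega
      · exact H.serre_e_left k (by omega)
      · exact H.serre_e_right c (by omega)
    have hac : a < c := by omega
    have h3 : upperRoot e a (c + 1 + 1) = ⁅upperRoot e a c, ⁅e c, e (c + 1)⁆⁆ := by
      rw [upperRoot_succ _ hab', upperRoot_succ _ hac, lie_lie,
        ← lie_skew (upperRoot e a c) (e (c + 1)),
        H.lie_e_upper_gt hac (Nat.lt_succ_self c) (by omega)]
      simp
    rcases Nat.lt_or_ge k c with hk | hk
    · rw [upperRoot_succ _ hab', leibniz_lie, ih (by omega) k h1 (by omega),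
        H.ee k (c + 1) (by omega) (by omega)]
      simp
    obtain rfl | rfl : k = c ∨ k = c + 1 := by omega
    · -- the element in question equals its own negative
      have h4 := ih (by omega) k h1 (by omega)
      have h5 : ⁅e k, upperRoot e a (k + 1 + 1)⁆ = -⁅e k, upperRoot e a (k + 1 + 1)⁆ := by
        conv_lhs => rw [h3, leibniz_lie, H.serre_e_left k (by omega), lie_zero, add_zero,
          ← lie_skew (e k) (upperRoot e a k), ← upperRoot_succ _ hac, neg_lie, leibniz_lie,
          ← lie_skew (upperRoot e a (k + 1)) (e k), h4, neg_zero, zero_lie, zero_add,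
          ← upperRoot_succ _ hab']
      exact self_eq_neg.1 h5
    · rw [h3, leibniz_lie, H.lie_e_upper_gt hac (Nat.lt_succ_self c) (by omega),
        H.serre_e_right c (by omega)]
      simp

theorem ChevalleyGenerators.lie_e_upper [IsAddTorsionFree L] (H : ChevalleyGenerators n d e f)
    {a b k : ℕ} (hab : a < b) (hb : b ≤ n) (hk : k < n) :
    ⁅e k, rootVec d e f a b⁆ = (if k + 1 = a then rootVec d e f k b else 0) -
      (if k = b then rootVec d e f a (k + 1) else 0) := by
  rw [rootVec_of_lt _ _ _ hab]
  rcases lt_trichotomy (k + 1) a with h | h | h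
  · rw [H.lie_e_upper_lt hab h hb, if_neg h.ne, if_neg (by omega), sub_zero]
  · subst h
    rw [H.lie_e_upper_prev hab hb, if_pos rfl, if_neg (by omega), sub_zero,
      rootVec_of_lt _ _ _ (by omega)]
  · rw [if_neg h.ne', zero_sub]
    rcases lt_trichotomy k b with h' | h' | h'
    · rw [H.lie_e_upper_mid hab hb k (by omega) h', if_neg h'.ne, neg_zero]
    · subst h'
      rw [if_pos rfl, rootVec_of_lt _ _ _ (by omega), upperRoot_succ _ hab, lie_skew]
    · rw [H.lie_e_upper_gt hab h' hk, if_neg h'.ne', neg_zero]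

theorem ChevalleyGenerators.lie_f_upper (H : ChevalleyGenerators n d e f)
    {a b k : ℕ} (hab : a < b) (hb : b ≤ n) (hk : k < n) :
    ⁅f k, rootVec d e f a b⁆ = (if k = a then rootVec d e f (k + 1) b else 0) -
      (if k + 1 = b then rootVec d e f a k else 0) := by
  induction b, hab using Nat.le_induction with
  | base =>
    rw [rootVec_of_lt _ _ _ (by omega), upperRoot_self, ← lie_skew]
    by_cases h : k = a
    · subst h
      simp [H.ef k hk, rootVec_self]
    · simp [H.ef_ne a k (by omega) hk (Ne.symm h), h]
  | succ b hab ih =>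
    have hab' : a < b := hab
    have h1 : rootVec d e f a (b + 1) = ⁅rootVec d e f a b, e b⁆ := by
      rw [rootVec_of_lt _ _ _ (by omega), rootVec_of_lt _ _ _ (by omega), upperRoot_succ _ hab']
    rw [h1, leibniz_lie, ih (by omega)]
    by_cases hkb : k = b
    · subst hkb
      have h2 : k ≠ a := by omega
      rw [← lie_skew (f k) (e k), H.ef k hk, rootVec_of_lt _ _ _ hab', lie_neg, lie_sub,
        ← lie_skew _ (d k), ← lie_skew _ (d (k + 1)), H.lie_d_upper k (by omega) hab' (by omega),
        H.lie_d_upper (k + 1) (by omega) hab' (by omega)]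
      have h3 : k + 1 ≠ a := by omega
      simp [h2, h3]
    · rw [← lie_skew (f k) (e b), H.ef_ne b k (by omega) hk (Ne.symm hkb), neg_zero, lie_zero,
        add_zero, if_neg (show ¬ k + 1 = b + 1 by omega), sub_zero]
      by_cases hka : k = a
      · subst hka
        rw [if_pos rfl, if_pos rfl]
        by_cases h4 : k + 1 = b
        · subst h4
          rw [if_pos rfl, rootVec_self, rootVec_self, sub_lie,
            H.de k (k + 1) (by omega) (by omega), H.de (k + 1) (k + 1) (by omega) (by omega),
            rootVec_of_lt _ _ _ (by omega), upperRoot_self]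
          simp [show k ≠ k + 1 + 1 by omega]
        · rw [if_neg h4, sub_zero, rootVec_of_lt _ _ _ (by omega), rootVec_of_lt _ _ _ (by omega),
            upperRoot_succ _ (by omega)]
      · rw [if_neg hka, if_neg hka, zero_sub]
        by_cases h4 : k + 1 = b
        · subst h4
          rw [if_pos rfl, neg_lie, rootVec_of_lt _ _ _ (by omega), lie_skew,
            H.lie_e_upper_gt (by omega) (by omega) (by omega)]
        · rw [if_neg h4, neg_zero, zero_lie]

/-- The adjoint action of the positive Chevalley generators on all root vectors. The lower
triangular case follows from the action of the negative generators on the upper triangular root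
vectors through the Chevalley involution. -/
theorem ChevalleyGenerators.lie_e_rootVec [IsAddTorsionFree L] (H : ChevalleyGenerators n d e f)
    {a b k : ℕ} (ha : a ≤ n) (hb : b ≤ n) (hk : k < n) :
    ⁅e k, rootVec d e f a b⁆ = (if k + 1 = a then rootVec d e f k b else 0) -
      (if k = b then rootVec d e f a (k + 1) else 0) := by
  rcases lt_trichotomy a b with h | h | h
  · exact H.lie_e_upper h hb hk
  · subst h
    have h1 : rootVec d e f k (k + 1) = e k := by
      rw [rootVec_of_lt _ _ _ (by omega), upperRoot_self]
    rw [rootVec_self, ← lie_skew, H.de a k ha hk, neg_sub]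
    by_cases h2 : k + 1 = a
    · subst h2; simp [h1]
    · by_cases h3 : k = a
      · subst h3; simp [h1]
      · simp [h2, h3, Ne.symm h2, Ne.symm h3]
  · have h1 := H.swap.lie_f_upper h ha hk
    simp only [rootVec_swap, Pi.neg_apply, lie_neg, neg_lie, neg_neg] at h1
    rw [h1]
    split_ifs <;> simp [neg_add_eq_sub]

theorem ChevalleyGenerators.lie_f_rootVec [IsAddTorsionFree L] (H : ChevalleyGenerators n d e f)
    {a b k : ℕ} (ha : a ≤ n) (hb : b ≤ n) (hk : k < n) :
    ⁅f k, rootVec d e f a b⁆ = (if k = a then rootVec d e f (k + 1) b else 0) -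
      (if k + 1 = b then rootVec d e f a k else 0) := by
  have h1 := H.swap.lie_e_rootVec hb ha hk
  simp only [rootVec_swap, Pi.neg_apply, lie_neg, neg_lie, neg_neg] at h1
  rw [h1]
  split_ifs <;> simp [neg_add_eq_sub]

end

variable [LieAlgebra ℂ L] {n : ℕ} {d e f : ℕ → L}

/-- The linear map from `sl(n+1)` that sends matrix units to the root vectors. -/
def serreMap (n : ℕ) (d e f : ℕ → L) : LieAlgebra.SpecialLinear.sl (Fin (n + 1)) ℂ →ₗ[ℂ] L where
  toFun M := ∑ i : Fin (n + 1), ∑ j : Fin (n + 1), M.1 i j • rootVec d e f i j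
  map_add' M M' := by
    simp [add_smul, Finset.sum_add_distrib]
  map_smul' c M := by
    simp [Finset.smul_sum, smul_smul]

theorem serreMap_slUnit (hd : ∑ i : Fin (n + 1), d i = 0) (i j : Fin (n + 1)) :
    serreMap n d e f (slUnit n i j) = rootVec d e f i j := by
  simp only [serreMap, LinearMap.coe_mk, AddHom.coe_mk, coe_slUnit, Matrix.sub_apply, sub_smul,
    Finset.sum_sub_distrib]
  have h1 : ∑ x : Fin (n + 1), ∑ y : Fin (n + 1),
      (((if i = j then ((n : ℂ) + 1)⁻¹ else 0) • (1 : Matrix (Fin (n + 1)) (Fin (n + 1)) ℂ)) x y) •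
        rootVec d e f x y = 0 := by
    simp only [Matrix.smul_apply, Matrix.one_apply, smul_eq_mul, mul_ite, mul_one, mul_zero,
      ite_smul, zero_smul, Finset.sum_ite_eq, Finset.mem_univ, if_true, rootVec_self]
    split_ifs
    · rw [← Finset.smul_sum, hd, smul_zero]
    · simp
  rw [h1, sub_zero, Finset.sum_eq_single i, Finset.sum_eq_single j]
  · simp
  · intro b _ hb; simp [Ne.symm hb]
  · simp
  · intro b _ hb
    exact Finset.sum_eq_zero fun c _ => by simp [Ne.symm hb]
  · simp

/-- For a linear map between Lie algebras, the elements with which bracketing is compatible with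
the map form a Lie subalgebra, by the Jacobi identity. -/
theorem exists_lieSubalgebra_map_lie {𝔤 : Type*} [LieRing 𝔤] [LieAlgebra ℂ 𝔤] (ψ : 𝔤 →ₗ[ℂ] L) :
    ∃ S : LieSubalgebra ℂ 𝔤, ∀ x, x ∈ S ↔ ∀ y, ψ ⁅x, y⁆ = ⁅ψ x, ψ y⁆ := by
  refine ⟨{ carrier := {x | ∀ y, ψ ⁅x, y⁆ = ⁅ψ x, ψ y⁆}
            add_mem' := ?_, zero_mem' := ?_, smul_mem' := ?_, lie_mem' := ?_ }, fun x => Iff.rfl⟩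
  · intro a b ha hb y
    rw [add_lie, map_add, ha, hb, map_add, add_lie]
  · intro y; simp
  · intro c x hx y
    rw [smul_lie, map_smul, hx, map_smul, smul_lie]
  · intro a b ha hb y
    rw [lie_lie, map_sub, ha, ha, hb, hb, ha, lie_lie]

/-- **Serre's theorem** for `sl(n+1)`: Chevalley generators in a Lie algebra define a homomorphism
from `sl(n+1)`. -/
theorem ChevalleyGenerators.exists_lieHom [IsAddTorsionFree L] (H : ChevalleyGenerators n d e f)
    (hd : ∑ i : Fin (n + 1), d i = 0) :
    ∃ ψ : LieAlgebra.SpecialLinear.sl (Fin (n + 1)) ℂ →ₗ⁅ℂ⁆ L,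
      ∀ i j, ψ (slUnit n i j) = rootVec d e f i j := by
  obtain ⟨S, hS⟩ := exists_lieSubalgebra_map_lie (serreMap n d e f)
  have key : ∀ x, (∀ i j, serreMap n d e f ⁅x, slUnit n i j⁆ =
      ⁅serreMap n d e f x, serreMap n d e f (slUnit n i j)⁆) → x ∈ S := by
    intro x hx
    rw [hS]
    intro y
    rw [sl_eq_sum n y]
    simp only [lie_sum, map_sum, lie_smul, map_smul, hx]
  have hu : ∀ i : Fin n, rootVec d e f i (i + 1) = e i := fun i => by
    rw [rootVec_of_lt _ _ _ (by omega), upperRoot_self]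
  have top : S = ⊤ := by
    refine lieSpan_chevalley n S (fun k => key _ fun i j => ?_) (fun k => key _ fun i j => ?_)
    · rw [glRel_slUnit, map_sub, apply_ite (serreMap n d e f), apply_ite (serreMap n d e f),
        map_zero]
      simp only [serreMap_slUnit hd, Fin.val_succ, Fin.val_castSucc]
      rw [hu, H.lie_e_rootVec (by omega) (by omega) k.2]
      simp only [Fin.ext_iff, Fin.val_succ, Fin.val_castSucc]
    · rw [glRel_slUnit, map_sub, apply_ite (serreMap n d e f), apply_ite (serreMap n d e f),
        map_zero]
      simp only [serreMap_slUnit hd, Fin.val_succ, Fin.val_castSucc]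
      rw [rootVec_lower_one, H.lie_f_rootVec (by omega) (by omega) k.2]
      simp only [Fin.ext_iff, Fin.val_succ, Fin.val_castSucc]
  refine ⟨{ serreMap n d e f with map_lie' := fun {x y} => ?_ }, fun i j => serreMap_slUnit hd i j⟩
  exact (hS x).1 (top ▸ LieSubalgebra.mem_top x) y

end Serre

/-! ### Specialization at `q = 1` -/

section ConstantCoeff

open PowerSeries (constantCoeff)

variable {R : Type*} [Ring R]

section

variable [Algebra ℂ R]

@[simp] theorem constantCoeff_qpow (x : R) : constantCoeff (qpow x) = 1 := by
  simp [qpow, ← PowerSeries.coeff_zero_eq_constantCoeff_apply]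

@[simp] theorem constantCoeff_divHbar_sub (x : R) :
    constantCoeff (divHbar (qpow x - qpow (-x))) = (2 : ℂ) • x := by
  simp [divHbar, qpow, ← PowerSeries.coeff_zero_eq_constantCoeff_apply, two_smul]

@[simp] theorem constantCoeff_qnum (x : R) : constantCoeff (qnum x) = x := by
  have h : constantCoeff (PowerSeries.map (algebraMap ℂ R)
      (divHbar (qpow (1 : ℂ) - qpow (-1 : ℂ)))⁻¹) = algebraMap ℂ R 2⁻¹ := by
    rw [← PowerSeries.coeff_zero_eq_constantCoeff_apply, PowerSeries.coeff_map,
      PowerSeries.coeff_zero_eq_constantCoeff_apply, PowerSeries.constantCoeff_inv,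
      constantCoeff_divHbar_sub]
    simp
  rw [qnum, map_mul, h, constantCoeff_divHbar_sub, ← Algebra.commutes, ← Algebra.smul_def,
    smul_smul]
  norm_num

@[simp] theorem constantCoeff_qcomm (k : ℤ) (a b : R⟦X⟧) :
    constantCoeff (qcomm k a b) = ⁅constantCoeff a, constantCoeff b⁆ := by
  simp [qcomm, Ring.lie_def]

end

@[simp] theorem constantCoeff_lie (a b : R⟦X⟧) :
    constantCoeff ⁅a, b⁆ = ⁅constantCoeff a, constantCoeff b⁆ := by
  simp [Ring.lie_def]

theorem constantCoeff_smul' {K : Type*} [CommRing K] [Algebra K R] (c : K) (a : R⟦X⟧) :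
    constantCoeff (c • a) = c • constantCoeff a :=
  rfl

@[simp] theorem constantCoeff_tmulSeries {K : Type*} [CommRing K] [Algebra K R] (a b : R⟦X⟧) :
    constantCoeff (tmulSeries K a b) = constantCoeff a ⊗ₜ[K] constantCoeff b := by
  rw [tmulSeries, map_mul, ← PowerSeries.coeff_zero_eq_constantCoeff_apply,
    ← PowerSeries.coeff_zero_eq_constantCoeff_apply, PowerSeries.coeff_map, PowerSeries.coeff_map]
  simp

end ConstantCoeff

section Presentation

open PowerSeries (constantCoeff)

variable {K : Type*} [CommRing K] [Algebra ℂ K] {n : ℕ} (η : K)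

/-- The quotient map from power series in the generators to the Yangian. -/
noncomputable def yangianMk : (Free K n)⟦X⟧ →ₐ[K] Yangian K n η :=
  (RingQuot.mkAlgHom K
    (fun a b : Drinfeldian K n η => a = toDrinfeldian K n η PowerSeries.X ∧ b = 0)).comp
    (toDrinfeldian K n η)

theorem yangianMk_X : yangianMk (n := n) η PowerSeries.X = 0 := by
  have := RingQuot.mkAlgHom_rel K
    (s := fun a b : Drinfeldian K n η => a = toDrinfeldian K n η PowerSeries.X ∧ b = 0)
    (x := toDrinfeldian K n η PowerSeries.X) (y := 0) ⟨rfl, rfl⟩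
  rw [map_zero] at this
  exact this

theorem yangianMk_C (x : Free K n) : yangianMk η (PowerSeries.C x) = toYangian K n η x := by
  let c : Free K n →ₐ[K] (Free K n)⟦X⟧ :=
    { (PowerSeries.C : Free K n →+* (Free K n)⟦X⟧) with
      commutes' := fun r => by simp [PowerSeries.algebraMap_apply] }
  have h : (yangianMk η).comp c = toYangian K n η := by
    apply FreeAlgebra.hom_ext
    funext g
    simp only [Function.comp_apply, toYangian, FreeAlgebra.lift_ι_apply]
    rfl
  exact DFunLike.congr_fun h x

theorem yangianMk_apply (f : (Free K n)⟦X⟧) :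
    yangianMk η f = toYangian K n η (constantCoeff f) := by
  obtain ⟨g, hg⟩ : PowerSeries.X ∣ f - PowerSeries.C (constantCoeff f) := by
    rw [PowerSeries.X_dvd_iff]; simp
  have h := map_mul (yangianMk η) PowerSeries.X g
  rw [← hg, map_sub, yangianMk_X, zero_mul, yangianMk_C] at h
  exact sub_eq_zero.1 h

/-- The defining relations of the Drinfeldian hold at `q = 1` in the Yangian. -/
theorem toYangian_eq_of_rel {a b : (Free K n)⟦X⟧} (h : DrinfeldianRel K η a b) :
    toYangian K n η (constantCoeff a) = toYangian K n η (constantCoeff b) := by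
  rw [← yangianMk_apply, ← yangianMk_apply]
  have h1 : toDrinfeldian K n η a = toDrinfeldian K n η b := by
    apply RingQuot.mkAlgHom_rel K
    rw [drinfeldianIdeal, TwoSidedIdeal.mem_iInf]
    intro m
    exact (le_sup_left : TwoSidedIdeal.span _ ≤ _) (TwoSidedIdeal.subset_span ⟨a, b, h, rfl⟩)
  rw [yangianMk, AlgHom.comp_apply, h1, AlgHom.comp_apply]

theorem toYangian_surjective : Function.Surjective (toYangian K n η) := by
  intro y
  obtain ⟨z, rfl⟩ := RingQuot.mkAlgHom_surjective K _ y
  obtain ⟨f, rfl⟩ := RingQuot.mkAlgHom_surjective K _ z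
  exact ⟨constantCoeff f, (yangianMk_apply η f).symm⟩

/-- The Yangian is presented by the values at `q = 1` of the relations of the Drinfeldian. -/
theorem exists_yangian_lift {A : Type*} [Ring A] [Algebra K A] (g : Free K n →ₐ[K] A)
    (hg : ∀ a b, DrinfeldianRel K η a b → g (constantCoeff a) = g (constantCoeff b)) :
    ∃ p : Yangian K n η →ₐ[K] A, ∀ x, p (toYangian K n η x) = g x := by
  let G : (Free K n)⟦X⟧ →ₐ[K] A :=
    { g.toRingHom.comp (constantCoeff : (Free K n)⟦X⟧ →+* Free K n) with
      commutes' := fun r => by simp [PowerSeries.algebraMap_apply] }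
  have hG : ∀ f, G f = g (constantCoeff f) := fun f => rfl
  have hker : drinfeldianIdeal K n η ≤ TwoSidedIdeal.ker G := by
    refine (iInf_le _ 1).trans (sup_le ?_ ?_) <;> rw [TwoSidedIdeal.span_le]
    · rintro x ⟨a, b, h, rfl⟩
      rw [SetLike.mem_coe, TwoSidedIdeal.mem_ker, map_sub, hG, hG, hg a b h, sub_self]
    · rintro x rfl
      rw [SetLike.mem_coe, TwoSidedIdeal.mem_ker, hG]
      simp
  let G₁ : Drinfeldian K n η →ₐ[K] A := RingQuot.liftAlgHom K ⟨G, fun a b h => by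
    have := hker h
    rw [TwoSidedIdeal.mem_ker, map_sub, sub_eq_zero] at this
    exact this⟩
  have hG₁ : ∀ f, G₁ (toDrinfeldian K n η f) = G f := fun f => by
    simp only [G₁, toDrinfeldian, RingQuot.liftAlgHom_mkAlgHom_apply]
  let G₂ : Yangian K n η →ₐ[K] A := RingQuot.liftAlgHom K ⟨G₁, fun a b h => by
    rw [h.1, h.2, map_zero, hG₁, hG]; simp⟩
  refine ⟨G₂, fun x => ?_⟩
  rw [← yangianMk_C, yangianMk, AlgHom.comp_apply, RingQuot.liftAlgHom_mkAlgHom_apply, hG₁, hG]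
  simp

end Presentation

/-! ### Images of the matrix units -/

section UnitImage

attribute [local instance] LieRing.ofAssociativeRing

variable {n : ℕ} {A : Type*} [Ring A] [Algebra ℂ A] (φ : Usl n →ₐ[ℂ] A)

theorem glRel_unitImage : GlRel (unitImage φ) := by
  intro i j k l
  have h : ∀ x y, ⁅φ (UniversalEnvelopingAlgebra.ι ℂ x), φ (UniversalEnvelopingAlgebra.ι ℂ y)⁆ =
      φ (UniversalEnvelopingAlgebra.ι ℂ ⁅x, y⁆) := by
    intro x y
    rw [LieHom.map_lie, Ring.lie_def, Ring.lie_def, map_sub, map_mul, map_mul]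
  unfold unitImage
  rw [h, glRel_slUnit, map_sub, map_sub]
  split_ifs <;> simp

theorem sum_unitImage_diag : ∑ i, unitImage φ i i = 0 := by
  simp only [unitImage, ← map_sum, sum_slUnit_diag, map_zero]

/-- A homomorphism from `U(sl(n+1))` is determined by the images of the Chevalley generators. -/
theorem usl_hom_ext {φ ψ : Usl n →ₐ[ℂ] A}
    (he : ∀ i : Fin n, unitImage φ i.castSucc i.succ = unitImage ψ i.castSucc i.succ)
    (hf : ∀ i : Fin n, unitImage φ i.succ i.castSucc = unitImage ψ i.succ i.castSucc) : φ = ψ := by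
  apply UniversalEnvelopingAlgebra.hom_ext
  ext x
  let f := (φ : Usl n →ₗ⁅ℂ⁆ A).comp (UniversalEnvelopingAlgebra.ι ℂ)
  let g := (ψ : Usl n →ₗ⁅ℂ⁆ A).comp (UniversalEnvelopingAlgebra.ι ℂ)
  let S : LieSubalgebra ℂ (LieAlgebra.SpecialLinear.sl (Fin (n + 1)) ℂ) :=
    { carrier := {x | f x = g x}
      add_mem' := fun {x y} (hx : f x = g x) (hy : f y = g y) =>
        show f (x + y) = g (x + y) by rw [map_add, map_add, hx, hy]
      zero_mem' := show f 0 = g 0 by rw [map_zero, map_zero]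
      smul_mem' := fun c x (hx : f x = g x) =>
        show f (c • x) = g (c • x) by rw [map_smul, map_smul, hx]
      lie_mem' := fun {x y} (hx : f x = g x) (hy : f y = g y) =>
        show f ⁅x, y⁆ = g ⁅x, y⁆ by rw [LieHom.map_lie, LieHom.map_lie, hx, hy] }
  have h : S = ⊤ := lieSpan_chevalley n S he hf
  have : x ∈ S := h ▸ LieSubalgebra.mem_top x
  exact this

end UnitImage

/-! ### Chevalley generators of the Yangian -/

section Diagonal

variable {K : Type*} [CommRing K] [Algebra ℂ K] {n : ℕ}

theorem diagElt_sub_diagElt_succ (i : Fin n) :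
    diagElt K n i - diagElt K n (i + 1) = gen K (Gen.h i) := by
  have h : ∀ j : Fin n, (if j.val < i.val + 1 then gen K (Gen.h j) else 0) =
      (if j.val < i.val then gen K (Gen.h j) else 0) + if j = i then gen K (Gen.h j) else 0 := by
    intro j
    rcases lt_trichotomy j i with h | h | h
    · have : j.val < i.val := h
      simp [this, h.ne, Nat.lt_succ_of_lt this]
    · subst h; simp
    · have : i.val < j.val := h
      simp [h.ne', show ¬ j.val < i.val by omega, show ¬ j.val < i.val + 1 by omega]
  unfold diagElt
  simp only [h, Finset.sum_add_distrib, Finset.sum_ite_eq', Finset.mem_univ, if_true]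
  abel

theorem sum_diagElt : ∑ i : Fin (n + 1), diagElt K n i = 0 := by
  have hn : (n : ℂ) + 1 ≠ 0 := by exact_mod_cast Nat.succ_ne_zero n
  have h : ∀ j : Fin n, ∑ i : Fin (n + 1), (if j.val < i.val then gen K (Gen.h j) else 0) =
      ((n : ℂ) - j.val) • gen K (Gen.h j) := by
    intro j
    rw [← Finset.sum_filter, Finset.sum_const]
    have h1 : (Finset.univ.filter fun i : Fin (n + 1) => j.val < i.val).card = n - j.val := by
      have h2 : (Finset.univ.filter fun i : Fin (n + 1) => j.val < i.val) =
          Finset.Ioi j.castSucc := by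
        ext i; simp [Fin.lt_def]
      rw [h2, Fin.card_Ioi]; simp
    rw [h1, ← Nat.cast_smul_eq_nsmul ℂ, Nat.cast_sub j.2.le]
  simp only [diagElt, Finset.sum_sub_distrib]
  rw [Finset.sum_comm]
  simp only [h, Finset.sum_const, Finset.card_univ, Fintype.card_fin]
  rw [← Nat.cast_smul_eq_nsmul ℂ, smul_smul]
  simp [hn]

/-- A family that is constant and has zero sum vanishes. -/
theorem eq_zero_of_sum_eq_zero {M : Type*} [AddCommGroup M] [Module ℂ M] (x : ℕ → M)
    (h : ∀ a < n, x a = x (a + 1)) (hs : ∑ i : Fin (n + 1), x i = 0) {a : ℕ} (ha : a ≤ n) :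
    x a = 0 := by
  have h0 : ∀ a ≤ n, x a = x 0 := by
    intro a
    induction a with
    | zero => simp
    | succ a ih => intro ha; rw [← h a (by omega), ih (by omega)]
  have hn : (n : ℂ) + 1 ≠ 0 := by exact_mod_cast Nat.succ_ne_zero n
  rw [Finset.sum_congr rfl fun i _ => h0 i.val (by omega), Finset.sum_const, Finset.card_univ,
    Fintype.card_fin, ← Nat.cast_smul_eq_nsmul ℂ, Nat.cast_succ, smul_eq_zero] at hs
  rw [h0 a ha]
  exact hs.resolve_left hn

end Diagonal

@[simp] theorem map_ring_lie {R A B : Type*} [CommRing R] [Ring A] [Ring B] [Algebra R A]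
    [Algebra R B] (f : A →ₐ[R] B) (x y : A) : f ⁅x, y⁆ = ⁅f x, f y⁆ := by
  simp [Ring.lie_def]

section Chevalley

attribute [local instance] LieRing.ofAssociativeRing

open PowerSeries (constantCoeff)

variable {K : Type*} [CommRing K] [Algebra ℂ K] {n : ℕ} {η : K} {A : Type*} [Ring A]
  [Algebra K A] {g : Free K n →ₐ[K] A}

/-- A family indexed by `Fin n`, extended by zero to all natural numbers. -/
def extendFin {A : Type*} [Zero A] (x : Fin n → A) (k : ℕ) : A :=
  if hk : k < n then x ⟨k, hk⟩ else 0

theorem extendFin_of_lt {A : Type*} [Zero A] (x : Fin n → A) {k : ℕ} (hk : k < n) :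
    extendFin x k = x ⟨k, hk⟩ := dif_pos hk

theorem map_diagElt_sub (g : Free K n →ₐ[K] A) {a : ℕ} (ha : a < n) :
    g (diagElt K n a) - g (diagElt K n (a + 1)) =
      g (gen K (Gen.h ⟨a, ha⟩)) := by
  rw [← diagElt_sub_diagElt_succ, map_sub]

theorem sum_map_diagElt (g : Free K n →ₐ[K] A) : ∑ i : Fin (n + 1), g (diagElt K n i) = 0 := by
  rw [← map_sum, sum_diagElt, map_zero]

/-- The values at `q = 1` of the relations of the Drinfeldian hold for the images of the generators
under `g`. -/
def SpecializedRel (η : K) (g : Free K n →ₐ[K] A) : Prop :=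
  ∀ a b, DrinfeldianRel K η a b → g (constantCoeff a) = g (constantCoeff b)

variable [Algebra ℂ A]

/-- An element that commutes with the coroots `h_{αᵢ}` commutes with the diagonal elements. -/
theorem lie_diagElt_eq_zero (g : Free K n →ₐ[K] A) (y : A)
    (hy : ∀ i : Fin n, ⁅g (gen K (Gen.h i)), y⁆ = 0) {a : ℕ} (ha : a ≤ n) :
    ⁅g (diagElt K n a), y⁆ = 0 := by
  refine eq_zero_of_sum_eq_zero (n := n) (fun a => ⁅g (diagElt K n a), y⁆) ?_ ?_ ha
  · intro a ha
    rw [← sub_eq_zero, ← sub_lie, map_diagElt_sub g ha, hy]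
  · rw [← sum_lie, sum_map_diagElt, zero_lie]

theorem lie_diagElt_of_cartan (g : Free K n →ₐ[K] A) (c : ℤ) (y : A) (k : Fin n)
    (hy : ∀ i : Fin n, ⁅g (gen K (Gen.h i)), y⁆ = (c * cartan i k) • y) {a : ℕ}
    (ha : a ≤ n) : ⁅g (diagElt K n a), y⁆ =
      c • ((if a = k then y else 0) - (if a = k + 1 then y else 0)) := by
  rw [← sub_eq_zero]
  refine eq_zero_of_sum_eq_zero (n := n) (fun a => ⁅g (diagElt K n a), y⁆ -
      c • ((if a = k then y else 0) - (if a = k + 1 then y else 0))) ?_ ?_ ha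
  · intro a ha
    rw [sub_eq_sub_iff_sub_eq_sub, ← sub_lie, map_diagElt_sub g ha, hy, mul_smul, ← smul_sub]
    congr 1
    obtain ⟨k, hk⟩ := k
    simp only [cartan, Fin.mk.injEq]
    by_cases h1 : a = k
    · subst h1; simp [two_smul]
    by_cases h2 : a = k + 1
    · subst h2; simp [show ¬ k + 1 + 1 = k by omega]
    by_cases h3 : a + 1 = k
    · subst h3; simp [show ¬ a = a + 1 + 1 by omega]
    simp [h1, h2, h3, Ne.symm h2]
  · rw [Finset.sum_sub_distrib, ← sum_lie, sum_map_diagElt, zero_lie, ← Finset.smul_sum,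
      Finset.sum_sub_distrib,
      Finset.sum_eq_single k.castSucc, Finset.sum_eq_single k.succ]
    · simp
    · intro i _ hi
      rw [if_neg]; simpa [Fin.ext_iff] using hi
    · simp
    · intro i _ hi
      rw [if_neg]; simpa [Fin.ext_iff] using hi
    · simp

theorem chevalleyGenerators_of_rel (hg : SpecializedRel η g) : ChevalleyGenerators n
    (fun a => g (diagElt K n a))
    (extendFin fun i => g (gen K (Gen.e i)))
    (extendFin fun i => g (gen K (Gen.f i))) where
  dd a b ha hb := by
    refine lie_diagElt_eq_zero g _ (fun i => ?_) ha
    rw [← lie_skew, lie_diagElt_eq_zero g _ (fun j => ?_) hb, neg_zero]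
    simpa using hg _ _ (.hh j i)
  de a k ha hk := by
    rw [extendFin_of_lt _ hk]
    rw [← one_smul ℤ (_ - _)]
    refine lie_diagElt_of_cartan g 1 _ ⟨k, hk⟩ (fun i => ?_) ha
    simpa using hg _ _ (.he i ⟨k, hk⟩)
  df a k ha hk := by
    rw [extendFin_of_lt _ hk, ← neg_sub, ← one_smul ℤ (_ - _), ← neg_smul]
    refine lie_diagElt_of_cartan g (-1) _ ⟨k, hk⟩ (fun i => ?_) ha
    simpa using hg _ _ (.hf i ⟨k, hk⟩)
  ef k hk := by
    rw [extendFin_of_lt _ hk, extendFin_of_lt _ hk, map_diagElt_sub g hk]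
    simpa using hg _ _ (.ef_same ⟨k, hk⟩)
  ef_ne i j hi hj h := by
    rw [extendFin_of_lt _ hi, extendFin_of_lt _ hj]
    simpa using hg _ _ (.ef_ne ⟨i, hi⟩ ⟨j, hj⟩ (by simpa using h))
  ee i j h hj := by
    rw [extendFin_of_lt _ hj, extendFin_of_lt _ (by omega : i < n)]
    simpa using hg _ _ (.ee ⟨i, by omega⟩ ⟨j, hj⟩ (Or.inl h))
  ff i j h hj := by
    rw [extendFin_of_lt _ hj, extendFin_of_lt _ (by omega : i < n)]
    simpa using hg _ _ (.ff ⟨i, by omega⟩ ⟨j, hj⟩ (Or.inl h))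
  serre_e_left k hk := by
    rw [extendFin_of_lt _ hk, extendFin_of_lt _ (by omega : k < n)]
    have := hg _ _ (.serre_e ⟨k + 1, hk⟩ ⟨k, by omega⟩ (Or.inr rfl))
    simp only [constantCoeff_qcomm, PowerSeries.constantCoeff_C, map_ring_lie, map_zero] at this
    rw [← lie_skew, ← lie_skew _ (g (gen K (Gen.e ⟨k + 1, hk⟩))), neg_lie, neg_neg]
    exact this
  serre_e_right k hk := by
    rw [extendFin_of_lt _ hk, extendFin_of_lt _ (by omega : k < n)]
    have := hg _ _ (.serre_e ⟨k, by omega⟩ ⟨k + 1, hk⟩ (Or.inl rfl))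
    simp only [constantCoeff_qcomm, PowerSeries.constantCoeff_C, map_ring_lie, map_zero] at this
    rw [← lie_skew, neg_eq_zero]
    exact this
  serre_f_left k hk := by
    rw [extendFin_of_lt _ hk, extendFin_of_lt _ (by omega : k < n)]
    have := hg _ _ (.serre_f ⟨k + 1, hk⟩ ⟨k, by omega⟩ (Or.inr rfl))
    simp only [constantCoeff_qcomm, PowerSeries.constantCoeff_C, map_ring_lie, map_zero] at this
    rw [← lie_skew, ← lie_skew _ (g (gen K (Gen.f ⟨k + 1, hk⟩))), neg_lie, neg_neg]
    exact this
  serre_f_right k hk := by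
    rw [extendFin_of_lt _ hk, extendFin_of_lt _ (by omega : k < n)]
    have := hg _ _ (.serre_f ⟨k, by omega⟩ ⟨k + 1, hk⟩ (Or.inl rfl))
    simp only [constantCoeff_qcomm, PowerSeries.constantCoeff_C, map_ring_lie, map_zero] at this
    rw [← lie_skew, neg_eq_zero]
    exact this

/-- `ι` matches the Chevalley generators of `U(sl(n+1))` with the images of the generators
under `g`. -/
def MatchesChevalley (g : Free K n →ₐ[K] A) (ι : Usl n →ₐ[ℂ] A) : Prop :=
  ∀ i : Fin n,
    unitImage ι i.castSucc i.castSucc - unitImage ι i.succ i.succ =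
        g (gen K (Gen.h i)) ∧
      unitImage ι i.castSucc i.succ = g (gen K (Gen.e i)) ∧
      unitImage ι i.succ i.castSucc = g (gen K (Gen.f i))

theorem exists_matchesChevalley (hg : SpecializedRel η g) :
    ∃ ι : Usl n →ₐ[ℂ] A, MatchesChevalley g ι := by
  have : IsAddTorsionFree A := .of_isTorsionFree ℂ A
  obtain ⟨ψ, hψ⟩ := (chevalleyGenerators_of_rel hg).exists_lieHom
    (sum_map_diagElt g)
  refine ⟨UniversalEnvelopingAlgebra.lift ℂ ψ, fun i => ?_⟩
  have h : ∀ i j, unitImage (UniversalEnvelopingAlgebra.lift ℂ ψ) i j = ψ (slUnit n i j) :=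
    fun i j => UniversalEnvelopingAlgebra.lift_ι_apply ℂ ψ _
  simp only [h, hψ, Fin.val_succ, Fin.val_castSucc, rootVec_self, rootVec_lower_one]
  refine ⟨map_diagElt_sub g i.2, ?_, extendFin_of_lt _ i.2⟩
  rw [rootVec_of_lt _ _ _ (Nat.lt_succ_self _), upperRoot_self]
  exact extendFin_of_lt _ i.2

end Chevalley

/-! ### Homomorphisms that match the generators -/

section Match

attribute [local instance] LieRing.ofAssociativeRing

open PowerSeries (constantCoeff)

variable {K : Type*} [CommRing K] [Algebra ℂ K] {n : ℕ} {A : Type*} [Ring A] [Algebra ℂ A]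
  [Algebra K A] {φ : Usl n →ₐ[ℂ] A} {g : Free K n →ₐ[K] A}

theorem map_diagElt
    (hh : ∀ i : Fin n, g (gen K (Gen.h i)) =
      unitImage φ i.castSucc i.castSucc - unitImage φ i.succ i.succ) (i : Fin (n + 1)) :
    g (diagElt K n i) = unitImage φ i i := by
  let E : ℕ → A := fun a => if h : a ≤ n then unitImage φ ⟨a, by omega⟩ ⟨a, by omega⟩ else 0
  have h := eq_zero_of_sum_eq_zero (n := n) (fun a => g (diagElt K n a) - E a) ?_ ?_
    (Nat.lt_succ_iff.1 i.2)
  · simpa [E, sub_eq_zero, Fin.is_le] using h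
  · intro a ha
    have h1 := hh ⟨a, ha⟩
    rw [← diagElt_sub_diagElt_succ, map_sub] at h1
    rw [sub_eq_sub_iff_sub_eq_sub]
    simpa [E, ha.le, Nat.succ_le_of_lt ha] using h1
  · simp only [Finset.sum_sub_distrib, ← map_sum, sum_diagElt, E, Fin.is_le, dif_pos]
    simpa using sum_unitImage_diag φ

theorem map_lowRoot
    (hf : ∀ i : Fin n, g (gen K (Gen.f i)) = unitImage φ i.succ i.castSucc)
    (i j : Fin (n + 1)) (hij : i < j) :
    g (constantCoeff (lowRoot K n i j)) = unitImage φ j i := by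
  induction j using Fin.induction with
  | zero => exact absurd hij (Fin.not_lt_zero i)
  | succ j ih =>
    rw [Fin.val_succ, lowRoot, dif_pos j.2]
    rcases (Fin.le_castSucc_iff.2 hij).eq_or_lt with h | h
    · subst h
      simp [hf]
    · have h1 : j.val ≠ i.val := by
        have : i.val < j.val := h
        omega
      rw [if_neg h1, if_pos (show i.val < j.val from h), constantCoeff_qcomm,
        map_ring_lie, PowerSeries.constantCoeff_C, hf]
      rw [Fin.val_castSucc] at ih
      rw [ih h, glRel_unitImage]
      simp [hij.ne']

end Match

/-! ### The relations over `U(sl(n+1))` and the relations of the Drinfeldian at `q = 1` -/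

section Relations

attribute [local instance] LieRing.ofAssociativeRing

open PowerSeries (constantCoeff)

variable {K : Type*} [CommRing K] {n : ℕ} {η : K} {A : Type*} [Ring A] [Algebra K A]

/-- If `h_δ` commutes with the generators then it is central in the algebra they generate. -/
theorem lie_hdelta_eq_zero [Algebra ℂ K] {g : Free K n →ₐ[K] A} (hg : SpecializedRel η g)
    (hsurj : Function.Surjective g) (y : A) : ⁅g (gen K Gen.hdelta), y⁆ = 0 := by
  obtain ⟨x, rfl⟩ := hsurj y
  induction x using FreeAlgebra.induction with
  | grade0 r =>
    rw [AlgHom.commutes, Ring.lie_def, Algebra.commutes, sub_self]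
  | grade1 x => simpa using hg _ _ (.hdelta x)
  | mul a b ha hb =>
    rw [Ring.lie_def, sub_eq_zero] at ha hb ⊢
    rw [map_mul, ← mul_assoc, ha, mul_assoc, hb, mul_assoc]
  | add a b ha hb => rw [map_add, lie_add, ha, hb, add_zero]

variable [Algebra ℂ A]

/-- Evaluation of noncommutative polynomials in the generators, where the Chevalley generators are
taken from a homomorphism on `U(sl(n+1))`. -/
noncomputable def freeEval (K : Type*) [CommRing K] [Algebra K A] (φ : Usl n →ₐ[ℂ] A) (ξ hδ : A) :
    Free K n →ₐ[K] A :=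
  FreeAlgebra.lift K fun
    | Gen.h i => unitImage φ i.castSucc i.castSucc - unitImage φ i.succ i.succ
    | Gen.e i => unitImage φ i.castSucc i.succ
    | Gen.f i => unitImage φ i.succ i.castSucc
    | Gen.xi => ξ
    | Gen.hdelta => hδ

section

variable (φ : Usl n →ₐ[ℂ] A) (ξ hδ : A)

@[simp] theorem freeEval_h (i : Fin n) : freeEval K φ ξ hδ (gen K (Gen.h i)) =
    unitImage φ i.castSucc i.castSucc - unitImage φ i.succ i.succ := by
  simp [freeEval]

@[simp] theorem freeEval_e (i : Fin n) : freeEval K φ ξ hδ (gen K (Gen.e i)) =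
    unitImage φ i.castSucc i.succ := by
  simp [freeEval]

@[simp] theorem freeEval_f (i : Fin n) : freeEval K φ ξ hδ (gen K (Gen.f i)) =
    unitImage φ i.succ i.castSucc := by
  simp [freeEval]

@[simp] theorem freeEval_xi : freeEval K φ ξ hδ (gen K Gen.xi) = ξ := by
  simp [freeEval]

@[simp] theorem freeEval_hdelta : freeEval K φ ξ hδ (gen K Gen.hdelta) = hδ := by
  simp [freeEval]

variable [Algebra ℂ K]

theorem freeEval_diagElt (i : Fin (n + 1)) :
    freeEval K φ ξ hδ (diagElt K n i) = unitImage φ i i :=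
  map_diagElt (fun i => freeEval_h φ ξ hδ i) i

theorem freeEval_lowRoot (i j : Fin (n + 1)) (hij : i < j) :
    freeEval K φ ξ hδ (constantCoeff (lowRoot K n i j)) = unitImage φ j i :=
  map_lowRoot (fun i => freeEval_f φ ξ hδ i) i j hij

end

variable [Algebra ℂ K]

theorem specializedRel_freeEval (hn : 0 < n) {φ : Usl n →ₐ[ℂ] A} {ξ hδ : A}
    (H : YangianRelations η φ ξ hδ) : SpecializedRel η (freeEval K φ ξ hδ) := by
  have hE := glRel_unitImage φ
  have hlast : (0 : Fin (n + 1)) < Fin.last n := Fin.lt_def.2 (by simpa using hn)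
  have hd0 : freeEval K φ ξ hδ (diagElt K n 0) = unitImage φ 0 0 := by
    simpa using freeEval_diagElt φ ξ hδ 0
  have hdn : freeEval K φ ξ hδ (diagElt K n n) = unitImage φ (Fin.last n) (Fin.last n) := by
    simpa using freeEval_diagElt φ ξ hδ (Fin.last n)
  have hlr : freeEval K φ ξ hδ (constantCoeff (lowRoot K n 0 n)) =
      unitImage φ (Fin.last n) 0 := by
    simpa using freeEval_lowRoot φ ξ hδ 0 (Fin.last n) hlast
  intro a b h
  have hw : ∀ i k l, ⁅unitImage φ i i, unitImage φ k l⁆ =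
      (if i = k then unitImage φ k l else 0) - (if i = l then unitImage φ k l else 0) := by
    intro i k l
    rw [hE]
    congr 1
    · split_ifs with h <;> simp [h]
    · split_ifs with h <;> simp [h]
  cases h with
  | hh i j =>
    simp only [constantCoeff_lie, PowerSeries.constantCoeff_C, map_ring_lie, map_zero, freeEval_h,
      sub_lie, lie_sub, hw, sub_self]
  | he i j =>
    simp only [constantCoeff_lie, PowerSeries.constantCoeff_C, map_ring_lie, map_zsmul, freeEval_h,
      freeEval_e, sub_lie, hw, cartan, Fin.ext_iff, Fin.val_succ, Fin.val_castSucc]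
    split_ifs <;> first | omega | simp [two_smul, sub_eq_add_neg]
  | hf i j =>
    simp only [constantCoeff_lie, PowerSeries.constantCoeff_C, map_ring_lie, map_zsmul, map_neg,
      freeEval_h, freeEval_f, sub_lie, hw, cartan, Fin.ext_iff, Fin.val_succ, Fin.val_castSucc]
    split_ifs <;> first | omega | simp [two_smul, sub_eq_add_neg]
  | ef_same i =>
    simp only [constantCoeff_lie, PowerSeries.constantCoeff_C, map_ring_lie, constantCoeff_qnum,
      freeEval_h, freeEval_e, freeEval_f, hE _ _ _ _, if_true]
  | ef_ne i j hij =>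
    simp only [constantCoeff_lie, PowerSeries.constantCoeff_C, map_ring_lie, map_zero,
      freeEval_e, freeEval_f, hE _ _ _ _]
    simp [hij]
  | ee i j hij =>
    simp only [constantCoeff_lie, PowerSeries.constantCoeff_C, map_ring_lie, map_zero,
      freeEval_e, hE _ _ _ _, Fin.ext_iff, Fin.val_succ, Fin.val_castSucc]
    rw [if_neg (by omega), if_neg (by omega), sub_zero]
  | ff i j hij =>
    simp only [constantCoeff_lie, PowerSeries.constantCoeff_C, map_ring_lie, map_zero,
      freeEval_f, hE _ _ _ _, Fin.ext_iff, Fin.val_succ, Fin.val_castSucc]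
    rw [if_neg (by omega), if_neg (by omega), sub_zero]
  | serre_e i j hij =>
    simp only [constantCoeff_qcomm, PowerSeries.constantCoeff_C, map_ring_lie, map_zero,
      freeEval_e]
    rw [hE, sub_lie]
    simp only [Fin.ext_iff, Fin.val_succ, Fin.val_castSucc]
    split_ifs <;> first | omega | skip
    all_goals
      simp only [hE _ _ _ _, zero_lie, Fin.ext_iff, Fin.val_succ, Fin.val_castSucc]
      split_ifs <;> first | omega | simp
  | serre_f i j hij =>
    simp only [constantCoeff_qcomm, PowerSeries.constantCoeff_C, map_ring_lie, map_zero,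
      freeEval_f]
    rw [hE, sub_lie]
    simp only [Fin.ext_iff, Fin.val_succ, Fin.val_castSucc]
    split_ifs <;> first | omega | skip
    all_goals
      simp only [hE _ _ _ _, zero_lie, Fin.ext_iff, Fin.val_succ, Fin.val_castSucc]
      split_ifs <;> first | omega | simp
  | hdelta g =>
    cases g with
    | h i => simp [unitImage, H.hdelta_U, lie_sub]
    | e i => simp [unitImage, H.hdelta_U]
    | f i => simp [unitImage, H.hdelta_U]
    | xi => simp [H.hdelta_xi]
    | hdelta => simp
  | xi_first => simp [hd0, H.first_xi]
  | xi_mid i h0 hi =>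
    have := freeEval_diagElt (K := K) φ ξ hδ ⟨i, by omega⟩
    simp only [constantCoeff_lie, PowerSeries.constantCoeff_C, map_ring_lie, freeEval_xi,
      map_zero, this]
    exact H.mid_xi _ (by simp [Fin.ext_iff]; omega) (by simp [Fin.ext_iff]; omega)
  | xi_last => simp [hdn, H.last_xi]
  | xi_f i => simp [H.xi_f]
  | e_xi i h0 hi => simp [H.e_xi i h0 hi]
  | e_e_xi i h0 =>
    simp only [constantCoeff_qcomm, PowerSeries.constantCoeff_C, map_ring_lie, map_zero,
      freeEval_e, freeEval_xi, H.e_e_xi i h0]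
  | xi_e_e i hi =>
    simp only [constantCoeff_qcomm, PowerSeries.constantCoeff_C, map_ring_lie, map_zero,
      freeEval_e, freeEval_xi, H.xi_e_e i hi]
  | e_xi_xi i h0 =>
    simp only [constantCoeff_smul', constantCoeff_qcomm, constantCoeff_lie, constantCoeff_qpow,
      PowerSeries.constantCoeff_C, map_ring_lie, map_sub, map_mul, map_smul, one_mul, hlr,
      freeEval_e, freeEval_xi, H.e_xi_xi i h0]
  | xi_xi_e i hi =>
    simp only [constantCoeff_smul', constantCoeff_qcomm, constantCoeff_lie, constantCoeff_qpow,
      PowerSeries.constantCoeff_C, map_ring_lie, map_sub, map_mul, map_smul, one_mul, hlr,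
      freeEval_e, freeEval_xi, H.xi_xi_e i hi]

theorem yangianRelations_of_specializedRel (hn : 0 < n) {g : Free K n →ₐ[K] A}
    (hg : SpecializedRel η g) (hsurj : Function.Surjective g) {ι : Usl n →ₐ[ℂ] A}
    (hι : MatchesChevalley g ι) :
    YangianRelations η ι (g (gen K Gen.xi)) (g (gen K Gen.hdelta)) := by
  have hlast : (0 : Fin (n + 1)) < Fin.last n := Fin.lt_def.2 (by simpa using hn)
  have hd := map_diagElt (fun i => (hι i).1.symm)
  have hd0 : g (diagElt K n 0) = unitImage ι 0 0 := by simpa using hd 0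
  have hdn : g (diagElt K n n) = unitImage ι (Fin.last n) (Fin.last n) := by
    simpa using hd (Fin.last n)
  have hlr : g (constantCoeff (lowRoot K n 0 n)) = unitImage ι (Fin.last n) 0 := by
    simpa using map_lowRoot (fun i => (hι i).2.2.symm) 0 (Fin.last n) hlast
  constructor
  · exact fun u => lie_hdelta_eq_zero hg hsurj _
  · exact lie_hdelta_eq_zero hg hsurj _
  · simpa [hd0] using hg _ _ .xi_first
  · simpa [hdn] using hg _ _ .xi_last
  · intro i h0 h1
    have h0' : 0 < i.val := by
      rcases Nat.eq_zero_or_pos i.val with h | h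
      · exact absurd (Fin.ext h) h0
      · exact h
    have h1' : i.val < n := by
      rcases (Fin.is_le i).lt_or_eq with h | h
      · exact h
      · exact absurd (Fin.ext h) h1
    simpa [hd] using hg _ _ (.xi_mid i.val h0' h1')
  · intro i; rw [(hι i).2.2]; simpa using hg _ _ (.xi_f i)
  · intro i h0 h1; rw [(hι i).2.1]; simpa using hg _ _ (.e_xi i h0 h1)
  · intro i h0; rw [(hι i).2.1]
    simpa only [constantCoeff_qcomm, PowerSeries.constantCoeff_C, map_ring_lie, map_zero] using
      hg _ _ (.e_e_xi i h0)
  · intro i h0; rw [(hι i).2.1]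
    simpa only [constantCoeff_qcomm, PowerSeries.constantCoeff_C, map_ring_lie, map_zero] using
      hg _ _ (.xi_e_e i h0)
  · intro i h0; rw [(hι i).2.1]
    simpa only [constantCoeff_smul', constantCoeff_qcomm, constantCoeff_lie, constantCoeff_qpow,
      PowerSeries.constantCoeff_C, map_ring_lie, map_sub, map_mul, map_smul, one_mul, hlr] using
      hg _ _ (.e_xi_xi i h0)
  · intro i h0; rw [(hι i).2.1]
    simpa only [constantCoeff_smul', constantCoeff_qcomm, constantCoeff_lie, constantCoeff_qpow,
      PowerSeries.constantCoeff_C, map_ring_lie, map_sub, map_mul, map_smul, one_mul, hlr] using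
      hg _ _ (.xi_xi_e i h0)

end Relations

/-! ### Products of matrices with noncommuting entries -/

section MatMul

attribute [local instance] LieRing.ofAssociativeRing

variable {A : Type*} [Ring A] {n : ℕ}

theorem lie_mul_leibniz (a b c : A) : ⁅a, b * c⁆ = ⁅a, b⁆ * c + b * ⁅a, c⁆ := by
  simp only [Ring.lie_def]; noncomm_ring

theorem mul_lie_leibniz (a b c : A) : ⁅a * b, c⁆ = a * ⁅b, c⁆ + ⁅a, c⁆ * b := by
  simp only [Ring.lie_def]; noncomm_ring

theorem ring_lie_smul {K : Type*} [CommRing K] [Algebra K A] (c : K) (a b : A) :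
    ⁅a, c • b⁆ = c • ⁅a, b⁆ := by
  simp [Ring.lie_def, smul_sub]

theorem ring_smul_lie {K : Type*} [CommRing K] [Algebra K A] (c : K) (a b : A) :
    ⁅c • a, b⁆ = c • ⁅a, b⁆ := by
  simp [Ring.lie_def, smul_sub]

theorem lie_eq_zero_symm {a b : A} (h : ⁅a, b⁆ = 0) : ⁅b, a⁆ = 0 := by
  rw [← lie_skew, h, neg_zero]

theorem mul_comm_of_lie {a b : A} (h : ⁅a, b⁆ = 0) : a * b = b * a := by
  rwa [Ring.lie_def, sub_eq_zero] at h

/-- The product of two families, regarded as matrices with entries in `A`. -/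
def matMul (E F : Fin n → Fin n → A) (a b : Fin n) : A := ∑ i, E a i * F i b

/-- An element that acts on two families by bracketing like the matrix unit `E_{kl}` acts on matrix
units also acts like this on their matrix product. -/
theorem lie_matMul {E F : Fin n → Fin n → A} (x : A) (k l : Fin n)
    (hE : ∀ a i, ⁅x, E a i⁆ = (if l = a then E k i else 0) - (if k = i then E a l else 0))
    (hF : ∀ i b, ⁅x, F i b⁆ = (if l = i then F k b else 0) - (if k = b then F i l else 0))
    (a b : Fin n) :
    ⁅x, matMul E F a b⁆ =
      (if l = a then matMul E F k b else 0) - (if k = b then matMul E F a l else 0) := by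
  unfold matMul
  rw [lie_sum]
  simp only [lie_mul_leibniz, hE, hF, sub_mul, mul_sub, Finset.sum_add_distrib,
    Finset.sum_sub_distrib, ite_mul, mul_ite, zero_mul, mul_zero, Finset.sum_ite_eq,
    Finset.mem_univ, if_true]
  have h : ∀ (p : Prop) [Decidable p] (f : Fin n → A),
      ∑ i, (if p then f i else 0) = if p then ∑ i, f i else 0 := by
    intro p _ f; split_ifs <;> simp
  rw [h, h]
  abel

end MatMul

/-! ### Elements of the weight of `ξ_{δ-θ}` -/

section Lowest

attribute [local instance] LieRing.ofAssociativeRing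

variable {A : Type*} [Ring A] {n : ℕ}

/-- The relations of `ξ_{δ-θ}` that are linear in it, for an element `x` and a family `E` of matrix
units: `x` is like the lowest weight vector of the adjoint representation. -/
structure IsLowest (E : Fin (n + 1) → Fin (n + 1) → A) (x : A) : Prop where
  first : ⁅E 0 0, x⁆ = -x
  last : ⁅E (Fin.last n) (Fin.last n), x⁆ = x
  mid : ∀ i : Fin (n + 1), i ≠ 0 → i ≠ Fin.last n → ⁅E i i, x⁆ = 0
  x_f : ∀ i : Fin n, ⁅x, E i.succ i.castSucc⁆ = 0
  e_x : ∀ i : Fin n, 0 < i.val → i.val + 1 < n → ⁅E i.castSucc i.succ, x⁆ = 0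
  e_e_x : ∀ i : Fin n, i.val = 0 → ⁅E i.castSucc i.succ, ⁅E i.castSucc i.succ, x⁆⁆ = 0
  x_e_e : ∀ i : Fin n, i.val + 1 = n → ⁅⁅x, E i.castSucc i.succ⁆, E i.castSucc i.succ⁆ = 0

theorem IsLowest.add {E : Fin (n + 1) → Fin (n + 1) → A} {x y : A} (hx : IsLowest E x)
    (hy : IsLowest E y) : IsLowest E (x + y) where
  first := by rw [lie_add, hx.first, hy.first, neg_add]
  last := by rw [lie_add, hx.last, hy.last]
  mid i h0 h1 := by rw [lie_add, hx.mid i h0 h1, hy.mid i h0 h1, add_zero]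
  x_f i := by rw [add_lie, hx.x_f, hy.x_f, add_zero]
  e_x i h0 h1 := by rw [lie_add, hx.e_x i h0 h1, hy.e_x i h0 h1, add_zero]
  e_e_x i h0 := by rw [lie_add, lie_add, hx.e_e_x i h0, hy.e_e_x i h0, add_zero]
  x_e_e i h0 := by rw [add_lie, add_lie, hx.x_e_e i h0, hy.x_e_e i h0, add_zero]

theorem IsLowest.smul {K : Type*} [CommRing K] [Algebra K A] {E : Fin (n + 1) → Fin (n + 1) → A}
    {x : A} (hx : IsLowest E x) (c : K) : IsLowest E (c • x) where
  first := by rw [ring_lie_smul, hx.first, smul_neg]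
  last := by rw [ring_lie_smul, hx.last]
  mid i h0 h1 := by rw [ring_lie_smul, hx.mid i h0 h1, smul_zero]
  x_f i := by rw [ring_smul_lie, hx.x_f, smul_zero]
  e_x i h0 h1 := by rw [ring_lie_smul, hx.e_x i h0 h1, smul_zero]
  e_e_x i h0 := by rw [ring_lie_smul, ring_lie_smul, hx.e_e_x i h0, smul_zero]
  x_e_e i h0 := by rw [ring_smul_lie, ring_smul_lie, hx.x_e_e i h0, smul_zero]

/-- Matrix units that commute with `x` may be added. -/
theorem IsLowest.add_family {E F : Fin (n + 1) → Fin (n + 1) → A} {x : A} (hx : IsLowest E x)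
    (hF : ∀ i j, ⁅F i j, x⁆ = 0) (hEF : ∀ i j k l, ⁅E i j, F k l⁆ = 0) :
    IsLowest (fun i j => E i j + F i j) x where
  first := by rw [add_lie, hx.first, hF, add_zero]
  last := by rw [add_lie, hx.last, hF, add_zero]
  mid i h0 h1 := by rw [add_lie, hx.mid i h0 h1, hF, add_zero]
  x_f i := by rw [lie_add, hx.x_f, lie_eq_zero_symm (hF _ _), add_zero]
  e_x i h0 h1 := by rw [add_lie, hx.e_x i h0 h1, hF, add_zero]
  e_e_x i h0 := by
    rw [add_lie, add_lie, hF, add_zero, hx.e_e_x i h0, leibniz_lie, hF,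
      lie_eq_zero_symm (hEF _ _ _ _)]
    simp
  x_e_e i h0 := by
    rw [lie_add, lie_add, lie_eq_zero_symm (hF _ _), add_zero, hx.x_e_e i h0, lie_lie,
      lie_eq_zero_symm (hF _ _), hEF]
    simp

/-- The lowest component of a family on which the matrix units act as on matrix units. -/
theorem isLowest_of_equivariant (hn : 1 < n) {E Q : Fin (n + 1) → Fin (n + 1) → A}
    (hQ : ∀ k l a b, ⁅E k l, Q a b⁆ = (if l = a then Q k b else 0) - (if k = b then Q a l else 0)) :
    IsLowest E (Q (Fin.last n) 0) where
  first := by rw [hQ]; simp [Fin.ext_iff, (show 0 < n by omega).ne]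
  last := by rw [hQ]; simp [Fin.ext_iff, (show 0 < n by omega).ne']
  mid i h0 h1 := by rw [hQ]; simp [h0, h1]
  x_f i := by
    rw [← lie_skew, hQ, if_neg (by simp [Fin.ext_iff]; omega), if_neg (by simp [Fin.ext_iff])]
    simp
  e_x i h0 h1 := by
    rw [hQ, if_neg (by simp [Fin.ext_iff]; omega), if_neg (by simp [Fin.ext_iff]; omega)]
    simp
  e_e_x i h0 := by
    rw [hQ, if_neg (by simp [Fin.ext_iff]; omega), if_pos (by simp [Fin.ext_iff, h0]), zero_sub,
      lie_neg, hQ, if_neg (by simp [Fin.ext_iff]; omega), if_neg (by simp [Fin.ext_iff])]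
    simp
  x_e_e i h0 := by
    rw [← lie_skew (Q _ _), hQ, if_pos (by simp [Fin.ext_iff, h0]),
      if_neg (by simp [Fin.ext_iff]; omega), sub_zero, neg_lie, ← lie_skew, hQ,
      if_neg (by simp [Fin.ext_iff]), if_neg (by simp [Fin.ext_iff]; omega)]
    simp

/-- The action of the lower triangular and of the diagonal matrix units. -/
theorem IsLowest.lower {E : Fin (n + 1) → Fin (n + 1) → A} (hE : GlRel E) {x : A}
    (hx : IsLowest E x) (i j : Fin (n + 1)) (hij : i < j) : ⁅E j i, x⁆ = 0 := by
  induction j using Fin.induction with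
  | zero => exact absurd hij (Fin.not_lt_zero i)
  | succ j ih =>
    rcases (Fin.le_castSucc_iff.2 hij).eq_or_lt with h | h
    · subst h
      exact lie_eq_zero_symm (hx.x_f j)
    · have h1 := hE j.succ j.castSucc j.castSucc i
      rw [if_pos rfl, if_neg hij.ne', sub_zero] at h1
      rw [← h1, lie_lie, ih h, lie_eq_zero_symm (hx.x_f j)]
      simp

theorem IsLowest.diag (hn : 0 < n) {E : Fin (n + 1) → Fin (n + 1) → A} {x : A} (hx : IsLowest E x)
    (i : Fin (n + 1)) :
    ⁅E i i, x⁆ = (if i = Fin.last n then x else 0) - (if i = 0 then x else 0) := by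
  have h : Fin.last n ≠ 0 := by simp [Fin.ext_iff, hn.ne']
  by_cases h0 : i = 0
  · subst h0; simp [hx.first, h.symm]
  by_cases h1 : i = Fin.last n
  · subst h1; simp [hx.last, h]
  simp [hx.mid i h0 h1, h0, h1]

end Lowest

/-! ### The quadratic relations -/

section Quadratic

attribute [local instance] LieRing.ofAssociativeRing

variable {A : Type*} [Ring A] {n : ℕ}

/-- The action on `x` of the lower triangular matrix units (it is zero) and of the diagonal ones
(the weight of `x` is that of the matrix unit `E_{n+1,1}`). -/
structure IsLowerDiag (E : Fin (n + 1) → Fin (n + 1) → A) (x : A) : Prop where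
  lower : ∀ i j, i < j → ⁅E j i, x⁆ = 0
  diag : ∀ i, ⁅E i i, x⁆ = (if i = Fin.last n then x else 0) - (if i = 0 then x else 0)

/-- The quadratic relation of `ξ_{δ-θ}` and `e_{12}`, where `k` stands for the second index and
`[e_{12}, e_{n+1,1}]` is replaced by `-e_{n+1,2}`. -/
def QuadRel {K : Type*} [CommRing K] [Algebra K A] (η : K) (E : Fin (n + 1) → Fin (n + 1) → A)
    (x : A) (k : Fin (n + 1)) : Prop :=
  ⁅⁅x, E 0 k⁆, x⁆ = η • (E (Fin.last n) k * x - E (Fin.last n) 0 * ⁅x, E 0 k⁆)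

/-- `k` is the second index, and it is not the last one. -/
structure IsSecond (k : Fin (n + 1)) : Prop where
  ne_zero : k ≠ 0
  ne_last : k ≠ Fin.last n
  le : ∀ i, i ≠ 0 → k ≤ i

section

variable {E : Fin (n + 1) → Fin (n + 1) → A} {x : A} {k : Fin (n + 1)}

theorem IsSecond.zero_ne_last (hk : IsSecond k) : (0 : Fin (n + 1)) ≠ Fin.last n := by
  intro h
  refine hk.ne_zero (Fin.ext ?_)
  have h1 := Fin.is_le k
  have h2 := congrArg Fin.val h
  simp only [Fin.val_zero, Fin.val_last] at h2 ⊢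
  omega

theorem IsLowerDiag.lie_last (hk : IsSecond k) (hx : IsLowerDiag E x) (i : Fin (n + 1)) :
    ⁅E (Fin.last n) i, x⁆ = if i = Fin.last n then x else 0 := by
  by_cases h : i = Fin.last n
  · subst h; rw [hx.diag, if_neg hk.zero_ne_last.symm]; simp
  · rw [if_neg h, hx.lower _ _ (lt_of_le_of_ne (Fin.le_last i) h)]

theorem IsLowerDiag.lie_second (hk : IsSecond k) (hx : IsLowerDiag E x) (i : Fin (n + 1)) :
    ⁅E i k, x⁆ = if i = 0 then -⁅x, E 0 k⁆ else 0 := by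
  by_cases h : i = 0
  · subst h; rw [if_pos rfl, lie_skew]
  rw [if_neg h]
  rcases (hk.le i h).eq_or_lt with h1 | h1
  · subst h1; rw [hx.diag, if_neg hk.ne_last, if_neg hk.ne_zero, sub_zero]
  · exact hx.lower _ _ h1

theorem IsLowerDiag.lie_last_next (hE : GlRel E) (hk : IsSecond k) (hx : IsLowerDiag E x)
    (i : Fin (n + 1)) :
    ⁅E (Fin.last n) i, ⁅x, E 0 k⁆⁆ = if i = Fin.last n then ⁅x, E 0 k⁆ else 0 := by
  have h1 : k < Fin.last n := lt_of_le_of_ne (Fin.le_last k) hk.ne_last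
  rw [leibniz_lie, hx.lie_last hk, hE, if_neg hk.ne_last.symm]
  by_cases h : i = Fin.last n
  · subst h; simp [hk.zero_ne_last.symm]
  · have := lie_eq_zero_symm (hx.lower _ _ h1)
    by_cases h0 : i = 0 <;>
      simp only [h, h0, hk.zero_ne_last, this, if_true, if_false, zero_lie, lie_zero, sub_zero,
        add_zero]

theorem IsLowerDiag.lie_first_next (hE : GlRel E) (hk : IsSecond k) (hx : IsLowerDiag E x)
    (i : Fin (n + 1)) :
    ⁅E i 0, ⁅x, E 0 k⁆⁆ = if i = k then -x else 0 := by
  rw [leibniz_lie, hE, if_pos rfl]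
  by_cases h : i = 0
  · subst h
    simp only [hx.diag, hk.zero_ne_last, hk.ne_zero.symm, if_true, if_false, zero_sub, neg_lie,
      sub_zero, neg_add_cancel]
  · rw [hx.lower _ _ (Fin.pos_iff_ne_zero.2 h), zero_lie, zero_add]
    have h2 : ⁅x, E i k⁆ = 0 := by
      have := hx.lie_second hk i
      rw [if_neg h] at this
      exact lie_eq_zero_symm this
    by_cases h3 : i = k
    · subst h3
      have h4 := hx.diag 0
      rw [if_neg hk.zero_ne_last, if_pos rfl, zero_sub] at h4
      rw [if_pos rfl, if_pos rfl, lie_sub, h2, zero_sub, lie_skew, h4]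
    · rw [if_neg h3, if_neg h3, sub_zero, h2]

end

variable {K : Type*} [CommRing K] [Algebra K A] {η : K}

theorem lie_matMul_eq_sum_left {E F : Fin n → Fin n → A} (y : A) (a b : Fin n)
    (hF : ∀ i, ⁅y, F i b⁆ = 0) : ⁅y, matMul E F a b⁆ = ∑ i, ⁅y, E a i⁆ * F i b := by
  unfold matMul
  rw [lie_sum]
  exact Finset.sum_congr rfl fun i _ => by rw [lie_mul_leibniz, hF, mul_zero, add_zero]

theorem lie_matMul_eq_sum_right {E F : Fin n → Fin n → A} (y : A) (a b : Fin n)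
    (hE : ∀ i, ⁅y, E a i⁆ = 0) : ⁅y, matMul E F a b⁆ = ∑ i, E a i * ⁅y, F i b⁆ := by
  unfold matMul
  rw [lie_sum]
  exact Finset.sum_congr rfl fun i _ => by rw [lie_mul_leibniz, hE, zero_mul, zero_add]

/-- The commutator of two entries in the last row of a product of commuting families of matrix
units; this is the part of the quadratic relation for `Δ(ξ_{δ-θ})` that is quadratic in `η`. -/
theorem lie_matMul_matMul {E F : Fin (n + 1) → Fin (n + 1) → A} (hE : GlRel E) (hF : GlRel F)
    (hEF : ∀ i j k l, ⁅E i j, F k l⁆ = 0) {k : Fin (n + 1)} (hk : IsSecond k) :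
    ⁅matMul E F (Fin.last n) k, matMul E F (Fin.last n) 0⁆ =
      (E (Fin.last n) k + F (Fin.last n) k) * matMul E F (Fin.last n) 0 -
        (E (Fin.last n) 0 + F (Fin.last n) 0) * matMul E F (Fin.last n) k := by
  set N := Fin.last n
  have h0N : (0 : Fin (n + 1)) ≠ N := hk.zero_ne_last
  have hkN : k ≠ N := hk.ne_last
  have hc : ∀ i j a b, F i j * E a b = E a b * F i j := fun i j a b =>
    (mul_comm_of_lie (hEF a b i j)).symm
  have h1 : ∀ j, ⁅matMul E F N k, E N j⁆ = E N j * F N k - if j = N then matMul E F N k else 0 := by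
    intro j
    rw [← lie_skew, lie_matMul_eq_sum_left _ _ _ fun i => hEF _ _ _ _]
    simp only [hE _ _ _ _, sub_mul, ite_mul, zero_mul, Finset.sum_sub_distrib, Finset.sum_ite_eq,
      Finset.mem_univ, if_true]
    by_cases h : j = N
    · subst h; simp [matMul]
    · simp [h]
  have h2 : ∀ j, ⁅matMul E F N k, F j 0⁆ =
      (if j = k then matMul E F N 0 else 0) - E N 0 * F j k := by
    intro j
    rw [← lie_skew, lie_matMul_eq_sum_right _ _ _ fun i => lie_eq_zero_symm (hEF _ _ _ _)]
    simp only [hF _ _ _ _, mul_sub, mul_ite, mul_zero, Finset.sum_sub_distrib, Finset.sum_ite_eq,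
      Finset.mem_univ, if_true]
    by_cases h : j = k
    · subst h; simp [matMul]
    · simp [h]
  have h3 : ∑ j, E N j * E N 0 * F j k = E N 0 * matMul E F N k + E N 0 * F N k := by
    have : ∀ j, E N j * E N 0 * F j k = E N 0 * (E N j * F j k) +
        if j = N then E N 0 * F N k else 0 := by
      intro j
      have h := hE N j N 0
      rw [if_neg h0N.symm, sub_zero, Ring.lie_def, sub_eq_iff_eq_add] at h
      rw [h, add_mul, mul_assoc, add_comm]
      congr 1
      by_cases h : j = N
      · subst h; simp
      · simp [h]
    simp only [this, Finset.sum_add_distrib, ← Finset.mul_sum, Finset.sum_ite_eq', Finset.mem_univ,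
      if_true, matMul]
  have h4 : matMul E F N k * F N 0 = F N 0 * matMul E F N k - E N 0 * F N k := by
    have h := h2 N
    rw [if_neg hkN.symm, Ring.lie_def, sub_eq_iff_eq_add] at h
    rw [h]; abel
  have h5 : ∑ j, E N j * F N k * F j 0 = F N k * matMul E F N 0 := by
    simp only [← hc, matMul, Finset.mul_sum, mul_assoc]
  have h6 : E N k * matMul E F N 0 = ∑ j, if j = k then E N j * matMul E F N 0 else 0 := by simp
  conv_lhs => rw [show matMul E F N 0 = ∑ j, E N j * F j 0 from rfl, lie_sum]
  simp only [lie_mul_leibniz, h1, h2, sub_mul, mul_sub, Finset.sum_add_distrib,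
    Finset.sum_sub_distrib, ite_mul, mul_ite, zero_mul, mul_zero, Finset.sum_ite_eq',
    Finset.mem_univ, if_true, ← mul_assoc, h3, h4, h5]
  noncomm_ring

/-- The quadratic relation for `Δ(ξ_{δ-θ})`, where `E` and `F` stand for the images of the matrix
units in the two tensor factors. -/
theorem QuadRel.comul {E F : Fin (n + 1) → Fin (n + 1) → A} (hE : GlRel E) (hF : GlRel F)
    (hEF : ∀ i j k l, ⁅E i j, F k l⁆ = 0) {x y : A} (hx : IsLowerDiag E x) (hy : IsLowerDiag F y)
    (hFx : ∀ i j, ⁅F i j, x⁆ = 0) (hEy : ∀ i j, ⁅E i j, y⁆ = 0) (hxy : ⁅x, y⁆ = 0)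
    {k : Fin (n + 1)} (hk : IsSecond k) (hqx : QuadRel η E x k) (hqy : QuadRel η F y k) :
    QuadRel η (fun i j => E i j + F i j) (x + y + η • matMul E F (Fin.last n) 0) k := by
  set N := Fin.last n
  have hQ : ∀ k l a b, ⁅E k l + F k l, matMul E F a b⁆ =
      (if l = a then matMul E F k b else 0) - (if k = b then matMul E F a l else 0) := by
    intro k l a b
    refine lie_matMul _ k l (fun a i => ?_) (fun i b => ?_) a b
    · rw [add_lie, lie_eq_zero_symm (hEF _ _ _ _), add_zero, hE]
    · rw [add_lie, hEF, zero_add, hF]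
  set ω₁ := ⁅x, E 0 k⁆ with hω₁
  set ω₂ := ⁅y, F 0 k⁆ with hω₂
  have hω₁F : ∀ i j, ⁅F i j, ω₁⁆ = 0 := fun i j => by
    rw [hω₁, leibniz_lie, hFx, lie_eq_zero_symm (hEF _ _ _ _)]; simp
  have hω₂E : ∀ i j, ⁅E i j, ω₂⁆ = 0 := fun i j => by
    rw [hω₂, leibniz_lie, hEy, hEF]; simp
  have hω₁y : ⁅ω₁, y⁆ = 0 := by
    rw [hω₁, lie_lie, hxy, hEy]; simp
  have hω₂x : ⁅ω₂, x⁆ = 0 := by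
    rw [hω₂, lie_lie, lie_eq_zero_symm hxy, hFx]; simp
  have hΩ : ⁅x + y + η • matMul E F N 0, E 0 k + F 0 k⁆ = ω₁ + ω₂ + η • matMul E F N k := by
    rw [add_lie, add_lie, lie_add, lie_add, lie_eq_zero_symm (hFx 0 k), lie_eq_zero_symm (hEy 0 k),
      ring_smul_lie, ← lie_skew (matMul E F N 0), hQ, if_neg hk.ne_last, if_pos rfl]
    simp [hω₁, hω₂]
  have h1 : ⁅ω₁, matMul E F N 0⁆ = -(F N 0 * ω₁) := by
    rw [lie_matMul_eq_sum_left _ _ _ fun i => lie_eq_zero_symm (hω₁F _ _)]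
    have : ∀ i, ⁅ω₁, E N i⁆ * F i 0 = if i = N then -(F N 0 * ω₁) else 0 := by
      intro i
      rw [← lie_skew, hx.lie_last_next hE hk]
      by_cases h : i = N
      · subst h
        rw [if_pos rfl, if_pos rfl, neg_mul, mul_comm_of_lie (hω₁F N 0)]
      · simp only [show ¬i = Fin.last n from h, if_neg h, if_false, neg_zero, zero_mul]
    simp [this]
  have h2 : ⁅ω₂, matMul E F N 0⁆ = E N k * y := by
    rw [lie_matMul_eq_sum_right _ _ _ fun i => lie_eq_zero_symm (hω₂E _ _)]
    have : ∀ i, E N i * ⁅ω₂, F i 0⁆ = if i = k then E N k * y else 0 := by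
      intro i
      rw [← lie_skew, hy.lie_first_next hF hk]
      by_cases h : i = k
      · subst h; simp
      · simp [h]
    simp [this]
  have h3 : ⁅matMul E F N k, x⁆ = F N k * x := by
    rw [← lie_skew, lie_matMul_eq_sum_left _ _ _ fun i => lie_eq_zero_symm (hFx _ _)]
    have : ∀ i, ⁅x, E N i⁆ * F i k = if i = N then -(F N k * x) else 0 := by
      intro i
      rw [← lie_skew, hx.lie_last hk]
      by_cases h : i = N
      · subst h; simp [N, mul_comm_of_lie (hFx _ _)]
      · simp only [N, if_neg h, neg_zero, zero_mul]
    simp [this]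
  have h4 : ⁅matMul E F N k, y⁆ = -(E N 0 * ω₂) := by
    rw [← lie_skew, lie_matMul_eq_sum_right _ _ _ fun i => lie_eq_zero_symm (hEy _ _)]
    have : ∀ i, E N i * ⁅y, F i k⁆ = if i = 0 then E N 0 * ω₂ else 0 := by
      intro i
      rw [← lie_skew, hy.lie_second hk]
      by_cases h : i = 0
      · subst h; simp [hω₂]
      · simp [h]
    simp [this]
  have h5 : ⁅matMul E F N k, matMul E F N 0⁆ = _ := lie_matMul_matMul hE hF hEF hk
  unfold QuadRel at hqx hqy ⊢
  simp only [hΩ]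
  rw [← hω₁] at hqx
  rw [← hω₂] at hqy
  simp only [add_lie, lie_add, ring_smul_lie, ring_lie_smul, hqx, hqy, hω₁y, hω₂x, h1, h2, h3, h4,
    h5]
  simp only [smul_add, smul_sub, mul_add, add_mul, mul_smul_comm, smul_neg, N]
  abel

/-- The relation for the antipode of `ξ_{δ-θ}` that corresponds to `QuadRel`. -/
theorem QuadRel.antipode {E : Fin (n + 1) → Fin (n + 1) → A} (hE : GlRel E) {c : A}
    (hcE : ∀ i j, ⁅c, E i j⁆ = 0) {x : A} (hcx : ⁅c, x⁆ = 0) (hx : IsLowerDiag E x)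
    {k : Fin (n + 1)} (hk : IsSecond k) (hqx : QuadRel η E x k)
    (Q : Fin (n + 1) → Fin (n + 1) → A) (hQ : ∀ a b, Q a b = c * E a b + matMul E E a b)
    (X : A) (hX : X = x - η • Q (Fin.last n) 0) :
    ⁅X, ⁅X, E 0 k⁆⁆ = η • (X * E (Fin.last n) k - ⁅X, E 0 k⁆ * E (Fin.last n) 0) := by
  set N := Fin.last n
  have h0N : (0 : Fin (n + 1)) ≠ N := hk.zero_ne_last
  have hkN : k ≠ N := hk.ne_last
  have hEQ : ∀ k l a b, ⁅E k l, Q a b⁆ =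
      (if l = a then Q k b else 0) - (if k = b then Q a l else 0) := by
    intro k l a b
    rw [hQ, lie_add, lie_mul_leibniz, lie_eq_zero_symm (hcE _ _), zero_mul, zero_add, hE,
      lie_matMul _ k l (fun a i => hE _ _ _ _) (fun i b => hE _ _ _ _)]
    simp only [hQ]
    split_ifs <;> noncomm_ring
  set ω := ⁅x, E 0 k⁆ with hω
  have hcω : ⁅c, ω⁆ = 0 := by rw [hω, leibniz_lie, hcE, hcx]; simp
  have hΩ : ⁅X, E 0 k⁆ = ω - η • Q N k := by
    rw [hX, sub_lie, ring_smul_lie, ← lie_skew (Q N 0), hEQ, if_neg hkN, if_pos rfl]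
    simp [hω]
  have hzω : ⁅E N 0, ω⁆ = 0 := by rw [hω, hx.lie_last_next hE hk, if_neg h0N]
  have hwx : ⁅E N k, x⁆ = 0 := by rw [hx.lie_last hk, if_neg hkN]
  have h1 : ⁅x, Q N k⁆ = -(x * E N k) + E N 0 * ω := by
    have : ∀ i, ⁅x, E N i * E i k⁆ = (if i = N then -(x * E N k) else 0) +
        if i = 0 then E N 0 * ω else 0 := by
      intro i
      rw [lie_mul_leibniz, ← lie_skew, ← lie_skew x (E i k), hx.lie_last hk, hx.lie_second hk]
      congr 1
      · by_cases h : i = N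
        · subst h; simp [N]
        · simp only [N, if_neg h, neg_zero, zero_mul]
      · by_cases h : i = 0
        · subst h; simp [hω]
        · simp [h]
    rw [hQ, lie_add, lie_mul_leibniz, lie_eq_zero_symm hcx, lie_eq_zero_symm hwx, matMul, lie_sum]
    simp [this, Finset.sum_add_distrib]
  have h2 : ⁅Q N 0, ω⁆ = ω * E N 0 - E N k * x := by
    have : ∀ i, ⁅ω, E N i * E i 0⁆ = (if i = N then -(ω * E N 0) else 0) +
        if i = k then E N k * x else 0 := by
      intro i
      rw [lie_mul_leibniz, ← lie_skew, ← lie_skew ω (E i 0), hx.lie_last_next hE hk,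
        hx.lie_first_next hE hk]
      congr 1
      · by_cases h : i = N
        · subst h; rw [if_pos rfl, if_pos rfl, neg_mul]
        · simp only [N, if_neg h, neg_zero, zero_mul]
      · by_cases h : i = k
        · subst h; simp
        · simp [h]
    rw [← lie_skew, hQ, lie_add, lie_mul_leibniz, lie_eq_zero_symm hcω, lie_eq_zero_symm hzω,
      matMul, lie_sum]
    simp [this, Finset.sum_add_distrib, sub_eq_add_neg, add_comm]
  have h3 : ⁅Q N 0, Q N k⁆ = -(Q N 0 * E N k) + Q N k * E N 0 := by
    have hQc : ⁅Q N k, c⁆ = 0 := by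
      rw [hQ, add_lie, mul_lie_leibniz, lie_eq_zero_symm (hcE _ _), lie_self, matMul, sum_lie]
      simp [mul_lie_leibniz, lie_eq_zero_symm (hcE _ _)]
    have : ∀ i, ⁅Q N k, E N i * E i 0⁆ = (if i = N then -(Q N k * E N 0) else 0) +
        if i = k then E N k * Q N 0 else 0 := by
      intro i
      rw [lie_mul_leibniz, ← lie_skew, ← lie_skew (Q N k) (E i 0), hEQ, hEQ, if_neg hkN.symm,
        if_neg h0N]
      congr 1
      · by_cases h : i = N
        · subst h; simp
        · simp only [if_neg h, sub_zero, neg_zero, zero_mul]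
      · by_cases h : i = k
        · subst h; simp
        · simp [h]
    have h4 : ⁅Q N k, E N 0⁆ = 0 := by
      rw [← lie_skew, hEQ, if_neg h0N, if_neg hkN.symm]; simp
    have h5 : E N k * Q N 0 = Q N 0 * E N k := mul_comm_of_lie (by
      rw [hEQ, if_neg hkN, if_neg h0N.symm, sub_zero])
    rw [← lie_skew, hQ N 0, lie_add, lie_mul_leibniz, hQc, h4, matMul, lie_sum]
    simp only [this, Finset.sum_add_distrib, Finset.sum_ite_eq', Finset.mem_univ, if_true, h5]
    rw [← matMul, ← hQ]
    simp
  have h0 : ⁅x, ω⁆ = -(η • (E N k * x - E N 0 * ω)) := by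
    rw [← lie_skew]; exact congrArg _ hqx
  rw [hΩ, hX]
  simp only [sub_lie, lie_sub, ring_smul_lie, ring_lie_smul, h0, h1, h2, h3]
  simp only [smul_add, smul_sub, sub_mul, smul_mul_assoc, smul_neg]
  abel

/-! The diagram automorphism of `sl(n+1)` carries the quadratic relation with `e_{12}` to the one
with `e_{n,n+1}`. -/

/-- The family `-E_{n+1-j,n+1-i}`, the image of the matrix units under the diagram automorphism. -/
def revFamily (E : Fin (n + 1) → Fin (n + 1) → A) (i j : Fin (n + 1)) : A := -E j.rev i.rev

theorem GlRel.revFamily {E : Fin (n + 1) → Fin (n + 1) → A} (hE : GlRel E) :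
    GlRel (revFamily E) := by
  intro i j k l
  simp only [DrinfeldYangian.revFamily, neg_lie, lie_neg, neg_neg, hE _ _ _ _, Fin.rev_inj]
  by_cases h1 : i = l <;> by_cases h2 : j = k <;> simp [h1, h2, sub_eq_add_neg, add_comm]

theorem IsLowerDiag.revFamily {E : Fin (n + 1) → Fin (n + 1) → A} {x : A}
    (hx : IsLowerDiag E x) : IsLowerDiag (revFamily E) x where
  lower i j h := by
    rw [DrinfeldYangian.revFamily, neg_lie, hx.lower _ _ (Fin.rev_lt_rev.2 h), neg_zero]
  diag i := by
    rw [DrinfeldYangian.revFamily, neg_lie, hx.diag, neg_sub]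
    have h1 : i.rev = Fin.last n ↔ i = 0 := by rw [← Fin.rev_zero, Fin.rev_inj]
    have h2 : i.rev = 0 ↔ i = Fin.last n := by rw [← Fin.rev_last, Fin.rev_inj]
    simp only [h1, h2]

end Quadratic

/-! ### The defining relations in `Y ⊗ Y` and in the opposite algebra -/

section ShiftDiag

attribute [local instance] LieRing.ofAssociativeRing

variable {K : Type*} [CommRing K] {n : ℕ} {η : K} {A : Type*} [Ring A] [Algebra K A]

/-- Adding a central element to the diagonal entries. -/
def shiftDiag (E : Fin n → Fin n → A) (c : A) (i j : Fin n) : A := E i j + if i = j then c else 0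

theorem lie_shiftDiag {E : Fin n → Fin n → A} {c x : A} (hc : ⁅x, c⁆ = 0) (i j : Fin n) :
    ⁅x, shiftDiag E c i j⁆ = ⁅x, E i j⁆ := by
  unfold shiftDiag
  split_ifs <;> simp [hc]

theorem shiftDiag_lie {E : Fin n → Fin n → A} {c x : A} (hc : ⁅c, x⁆ = 0) (i j : Fin n) :
    ⁅shiftDiag E c i j, x⁆ = ⁅E i j, x⁆ := by
  unfold shiftDiag
  split_ifs <;> simp [hc]

theorem GlRel.shiftDiag {E : Fin n → Fin n → A} (hE : GlRel E) {c : A}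
    (hc : ∀ i j, ⁅c, E i j⁆ = 0) : GlRel (shiftDiag E c) := by
  intro i j k l
  have h : ⁅c, DrinfeldYangian.shiftDiag E c k l⁆ = 0 := by
    rw [lie_shiftDiag (lie_self c), hc]
  rw [shiftDiag_lie h, lie_shiftDiag (lie_eq_zero_symm (hc i j)), hE]
  unfold DrinfeldYangian.shiftDiag
  by_cases h1 : j = k <;> by_cases h2 : i = l
  · subst h1 h2; simp
  · subst h1; simp [h2]
  · subst h2; simp [h1, Ne.symm h1]
  · simp [h1, h2]

theorem matMul_shiftDiag (E F : Fin n → Fin n → A) (c : A) (a b : Fin n) :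
    matMul (shiftDiag E c) F a b = c * F a b + matMul E F a b := by
  unfold matMul shiftDiag
  simp [add_mul, Finset.sum_add_distrib, add_comm]

theorem IsLowerDiag.shiftDiag {E : Fin (n + 1) → Fin (n + 1) → A} {x : A} (hx : IsLowerDiag E x)
    {c : A} (hc : ⁅c, x⁆ = 0) : IsLowerDiag (shiftDiag E c) x where
  lower i j h := by rw [shiftDiag_lie hc, hx.lower i j h]
  diag i := by rw [shiftDiag_lie hc, hx.diag i]

/-- The quadratic relation involves only off-diagonal matrix units. -/
theorem QuadRel.congr {E F : Fin (n + 1) → Fin (n + 1) → A} {x : A} {k : Fin (n + 1)}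
    (hk : IsSecond k) (h : ∀ i j, i ≠ j → E i j = F i j) (hq : QuadRel η E x k) :
    QuadRel η F x k := by
  unfold QuadRel at hq ⊢
  rwa [h _ _ hk.ne_zero.symm, h _ _ hk.ne_last.symm, h _ _ hk.zero_ne_last.symm] at hq

theorem shiftDiag_of_ne {E : Fin n → Fin n → A} {c : A} {i j : Fin n} (h : i ≠ j) :
    shiftDiag E c i j = E i j := by
  simp [shiftDiag, h]

end ShiftDiag

section RelationsOfQuadRel

attribute [local instance] LieRing.ofAssociativeRing

variable {K : Type*} [CommRing K] {n : ℕ} {η : K} {A : Type*} [Ring A] [Algebra K A] [Algebra ℂ A]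
  {φ : Usl n →ₐ[ℂ] A} {ξ hδ : A}

theorem YangianRelations.isLowest (H : YangianRelations η φ ξ hδ) : IsLowest (unitImage φ) ξ where
  first := H.first_xi
  last := H.last_xi
  mid := H.mid_xi
  x_f := H.xi_f
  e_x := H.e_xi
  e_e_x := H.e_e_xi
  x_e_e := H.xi_e_e

theorem YangianRelations.isLowerDiag (hn : 0 < n) (H : YangianRelations η φ ξ hδ) :
    IsLowerDiag (unitImage φ) ξ where
  lower i j h := H.isLowest.lower (glRel_unitImage φ) i j h
  diag := H.isLowest.diag hn

theorem isSecond_iff (hn : 1 < n) (k : Fin (n + 1)) : IsSecond k ↔ k.val = 1 := by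
  constructor
  · intro h
    have h1 := Fin.le_def.1 (h.le ⟨1, by omega⟩ (by simp [Fin.ext_iff]))
    have h2 : k.val ≠ 0 := fun h' => h.ne_zero (Fin.ext h')
    simp only at h1
    omega
  · intro h
    refine ⟨fun h' => ?_, fun h' => ?_, fun i hi => Fin.le_def.2 ?_⟩
    · rw [h'] at h; simp at h
    · rw [h'] at h; simp at h; omega
    · have : i.val ≠ 0 := fun h' => hi (Fin.ext h')
      omega

theorem quadRel_unitImage_iff (i : Fin n) (h0 : i.val = 0) (hn : 1 < n) :
    QuadRel η (unitImage φ) ξ i.succ ↔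
      ⁅⁅unitImage φ i.castSucc i.succ, ξ⁆, ξ⁆ =
        η • (⁅unitImage φ i.castSucc i.succ, unitImage φ (Fin.last n) 0⁆ * ξ -
          unitImage φ (Fin.last n) 0 * ⁅unitImage φ i.castSucc i.succ, ξ⁆) := by
  have h1 : i.castSucc = 0 := Fin.ext h0
  have h2 : i.succ ≠ Fin.last n := by simp [Fin.ext_iff]; omega
  rw [h1, QuadRel, glRel_unitImage φ 0 i.succ, if_neg h2, if_pos rfl,
    ← lie_skew (unitImage φ 0 i.succ) ξ, neg_lie, zero_sub, ← neg_inj, ← smul_neg]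
  simp only [neg_sub, neg_mul, mul_neg, sub_neg_eq_add, neg_add_eq_sub]

theorem quadRel_revFamily_iff (i : Fin n) (h0 : i.val + 1 = n) (hn : 1 < n) :
    QuadRel η (revFamily (unitImage φ)) ξ i.castSucc.rev ↔
      ⁅ξ, ⁅ξ, unitImage φ i.castSucc i.succ⁆⁆ =
        η • (⁅unitImage φ (Fin.last n) 0, unitImage φ i.castSucc i.succ⁆ * ξ -
          unitImage φ (Fin.last n) 0 * ⁅ξ, unitImage φ i.castSucc i.succ⁆) := by
  have h1 : i.succ = Fin.last n := Fin.ext h0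
  have h2 : i.castSucc ≠ 0 := by simp [Fin.ext_iff]; omega
  rw [h1, QuadRel, glRel_unitImage φ (Fin.last n) 0, if_neg h2.symm, if_pos rfl,
    ← lie_skew]
  simp only [revFamily, Fin.rev_rev, Fin.rev_last, Fin.rev_zero, lie_neg, neg_neg, neg_mul, mul_neg,
    zero_sub]

theorem YangianRelations.quadRel (hn : 1 < n) (H : YangianRelations η φ ξ hδ) (k : Fin (n + 1))
    (hk : IsSecond k) : QuadRel η (unitImage φ) ξ k := by
  rw [isSecond_iff hn] at hk
  obtain rfl : k = (⟨0, Nat.zero_lt_of_lt hn⟩ : Fin n).succ := Fin.ext hk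
  exact (quadRel_unitImage_iff _ rfl hn).2 (H.e_xi_xi _ rfl)

theorem YangianRelations.quadRel_rev (hn : 1 < n) (H : YangianRelations η φ ξ hδ)
    (k : Fin (n + 1)) (hk : IsSecond k) : QuadRel η (revFamily (unitImage φ)) ξ k := by
  rw [isSecond_iff hn] at hk
  obtain rfl : k = (⟨n - 1, Nat.sub_lt (Nat.zero_lt_of_lt hn) one_pos⟩ : Fin n).castSucc.rev :=
    Fin.ext (by rw [Fin.val_rev, hk]; simp; omega)
  have h : n - 1 + 1 = n := by omega
  exact (quadRel_revFamily_iff _ h hn).2 (H.xi_xi_e _ h)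

theorem yangianRelations_of_quadRel (hn : 1 < n) (hU : ∀ u, ⁅hδ, φ u⁆ = 0) (hξ : ⁅hδ, ξ⁆ = 0)
    (hl : IsLowest (unitImage φ) ξ) (hq : ∀ k, IsSecond k → QuadRel η (unitImage φ) ξ k)
    (hr : ∀ k, IsSecond k → QuadRel η (revFamily (unitImage φ)) ξ k) :
    YangianRelations η φ ξ hδ where
  hdelta_U := hU
  hdelta_xi := hξ
  first_xi := hl.first
  last_xi := hl.last
  mid_xi := hl.mid
  xi_f := hl.x_f
  e_xi := hl.e_x
  e_e_xi := hl.e_e_x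
  xi_e_e := hl.x_e_e
  e_xi_xi i h0 := (quadRel_unitImage_iff i h0 hn).1 (hq _ ((isSecond_iff hn _).2 (by simp [h0])))
  xi_xi_e i h0 := (quadRel_revFamily_iff i h0 hn).1 (hr _ ((isSecond_iff hn _).2 (by
    rw [Fin.val_rev]; simp; omega)))

/-- A homomorphism from `U(sl(n+1))` takes values in a subalgebra as soon as it does so on
`sl(n+1)`. -/
theorem usl_hom_mem (φ : Usl n →ₐ[ℂ] A) (S : Subalgebra ℂ A)
    (h : ∀ x, φ (UniversalEnvelopingAlgebra.ι ℂ x) ∈ S) (u : Usl n) : φ u ∈ S := by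
  let f : LieAlgebra.SpecialLinear.sl (Fin (n + 1)) ℂ →ₗ⁅ℂ⁆ S :=
    { toFun := fun x => ⟨φ (UniversalEnvelopingAlgebra.ι ℂ x), h x⟩
      map_add' := fun x y => Subtype.ext (by simp)
      map_smul' := fun c x => Subtype.ext (by simp)
      map_lie' := fun {x y} => Subtype.ext (by
        simp only [LieHom.map_lie, map_ring_lie]
        simp [Ring.lie_def]) }
  have h1 : S.val.comp (UniversalEnvelopingAlgebra.lift ℂ f) = φ := by
    apply UniversalEnvelopingAlgebra.hom_ext
    ext x
    change ((UniversalEnvelopingAlgebra.lift ℂ f (UniversalEnvelopingAlgebra.ι ℂ x) : S) : A) = _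
    rw [UniversalEnvelopingAlgebra.lift_ι_apply]
    rfl
  rw [← h1]
  exact Subtype.property _

theorem lie_usl_hom_eq_zero (φ : Usl n →ₐ[ℂ] A) {a : A}
    (h : ∀ x, ⁅a, φ (UniversalEnvelopingAlgebra.ι ℂ x)⁆ = 0) (u : Usl n) : ⁅a, φ u⁆ = 0 := by
  have h1 := usl_hom_mem φ (Subalgebra.centralizer ℂ {a}) (fun x => by
    rw [Subalgebra.mem_centralizer_iff]
    rintro b rfl
    exact mul_comm_of_lie (h x)) u
  rw [Subalgebra.mem_centralizer_iff] at h1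
  rw [Ring.lie_def, h1 a rfl, sub_self]

end RelationsOfQuadRel

section Comul

attribute [local instance] LieRing.ofAssociativeRing

variable {K : Type*} [CommRing K] {n : ℕ} {η : K} {A : Type*} [Ring A] [Algebra K A] [Algebra ℂ A]

/-- The sum of two commuting representations of `sl(n+1)` is a representation. -/
theorem exists_usl_hom_add (φ₁ φ₂ : Usl n →ₐ[ℂ] A)
    (h : ∀ x y,
      ⁅φ₁ (UniversalEnvelopingAlgebra.ι ℂ x), φ₂ (UniversalEnvelopingAlgebra.ι ℂ y)⁆ = 0) :
    ∃ φ : Usl n →ₐ[ℂ] A, ∀ x, φ (UniversalEnvelopingAlgebra.ι ℂ x) =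
      φ₁ (UniversalEnvelopingAlgebra.ι ℂ x) + φ₂ (UniversalEnvelopingAlgebra.ι ℂ x) := by
  let f : LieAlgebra.SpecialLinear.sl (Fin (n + 1)) ℂ →ₗ⁅ℂ⁆ A :=
    { toFun := fun x =>
        φ₁ (UniversalEnvelopingAlgebra.ι ℂ x) + φ₂ (UniversalEnvelopingAlgebra.ι ℂ x)
      map_add' := fun x y => by simp only [map_add]; abel
      map_smul' := fun c x => by simp
      map_lie' := fun {x y} => by
        simp only [LieHom.map_lie, map_ring_lie, add_lie, lie_add, h, lie_eq_zero_symm (h _ _),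
          add_zero, zero_add] }
  exact ⟨UniversalEnvelopingAlgebra.lift ℂ f,
    fun x => UniversalEnvelopingAlgebra.lift_ι_apply ℂ f x⟩

/-- The defining relations hold for the elements that define the comultiplication: the two commuting
solutions stand for the two tensor factors. -/
theorem YangianRelations.comul (hn : 1 < n) {φ₁ φ₂ φ : Usl n →ₐ[ℂ] A} {ξ₁ ξ₂ h₁ h₂ : A}
    (H₁ : YangianRelations η φ₁ ξ₁ h₁) (H₂ : YangianRelations η φ₂ ξ₂ h₂)
    (hφ : ∀ x, φ (UniversalEnvelopingAlgebra.ι ℂ x) =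
      φ₁ (UniversalEnvelopingAlgebra.ι ℂ x) + φ₂ (UniversalEnvelopingAlgebra.ι ℂ x))
    (hφφ : ∀ x y, ⁅φ₁ x, φ₂ y⁆ = 0) (hφξ : ∀ x, ⁅φ₁ x, ξ₂⁆ = 0) (hφh : ∀ x, ⁅φ₁ x, h₂⁆ = 0)
    (hξφ : ∀ x, ⁅ξ₁, φ₂ x⁆ = 0) (hξξ : ⁅ξ₁, ξ₂⁆ = 0) (hξh : ⁅ξ₁, h₂⁆ = 0)
    (hhφ : ∀ x, ⁅h₁, φ₂ x⁆ = 0) (hhξ : ⁅h₁, ξ₂⁆ = 0) (hhh : ⁅h₁, h₂⁆ = 0) :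
    YangianRelations η φ (ξ₁ + ξ₂ + η • (((2 : ℂ)⁻¹ • h₁) * unitImage φ₂ (Fin.last n) 0 +
      ∑ i, unitImage φ₁ (Fin.last n) i * unitImage φ₂ i 0)) (h₁ + h₂) := by
  have hE : unitImage φ = fun i j => unitImage φ₁ i j + unitImage φ₂ i j := by
    funext i j; exact hφ _
  set c : A := (2 : ℂ)⁻¹ • h₁ with hc
  set E₁ := unitImage φ₁
  set E₂ := unitImage φ₂
  have hE₁ : GlRel E₁ := glRel_unitImage φ₁
  have hE₂ : GlRel E₂ := glRel_unitImage φ₂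
  have hEE : ∀ i j k l, ⁅E₁ i j, E₂ k l⁆ = 0 := fun i j k l => hφφ _ _
  have hcE₁ : ∀ i j, ⁅c, E₁ i j⁆ = 0 := fun i j => by
    rw [hc, smul_lie, show ⁅h₁, E₁ i j⁆ = 0 from H₁.hdelta_U _, smul_zero]
  have hcE₂ : ∀ i j, ⁅c, E₂ i j⁆ = 0 := fun i j => by
    rw [hc, smul_lie, show ⁅h₁, E₂ i j⁆ = 0 from hhφ _, smul_zero]
  have hcξ₁ : ⁅c, ξ₁⁆ = 0 := by rw [hc, smul_lie, H₁.hdelta_xi, smul_zero]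
  have hcξ₂ : ⁅c, ξ₂⁆ = 0 := by rw [hc, smul_lie, hhξ, smul_zero]
  -- a central shift of the diagonal of `E₁` absorbs the term with `h_δ`
  have hF₁ : GlRel (shiftDiag E₁ c) := hE₁.shiftDiag hcE₁
  have hFE : ∀ i j k l, ⁅shiftDiag E₁ c i j, E₂ k l⁆ = 0 := fun i j k l => by
    rw [shiftDiag_lie (hcE₂ _ _), hEE]
  have hFξ₂ : ∀ i j, ⁅shiftDiag E₁ c i j, ξ₂⁆ = 0 := fun i j => by
    rw [shiftDiag_lie hcξ₂]; exact hφξ _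
  have hEξ₁ : ∀ i j, ⁅E₂ i j, ξ₁⁆ = 0 := fun i j => lie_eq_zero_symm (hξφ _)
  have hξ : ((2 : ℂ)⁻¹ • h₁) * E₂ (Fin.last n) 0 + ∑ i, E₁ (Fin.last n) i * E₂ i 0 =
      matMul (shiftDiag E₁ c) E₂ (Fin.last n) 0 := by rw [matMul_shiftDiag]; rfl
  rw [hξ]
  have hQ : ∀ k l a b, ⁅unitImage φ k l, matMul (shiftDiag E₁ c) E₂ a b⁆ =
      (if l = a then matMul (shiftDiag E₁ c) E₂ k b else 0) -
        (if k = b then matMul (shiftDiag E₁ c) E₂ a l else 0) := by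
    intro k l a b
    refine lie_matMul _ k l (fun a i => ?_) (fun i b => ?_) a b
    · have h := hF₁ k l a i
      rw [shiftDiag_lie (x := shiftDiag E₁ c a i) (by
        rw [lie_shiftDiag (lie_self c), hcE₁])] at h
      rw [hE, add_lie, lie_eq_zero_symm (hFE _ _ _ _), add_zero, h]
    · rw [hE, add_lie, hEE, zero_add, hE₂]
  refine yangianRelations_of_quadRel hn ?_ ?_ ?_ ?_ ?_
  · refine lie_usl_hom_eq_zero φ fun x => ?_
    rw [hφ, add_lie, lie_add, lie_add, H₁.hdelta_U, H₂.hdelta_U, hhφ, lie_eq_zero_symm (hφh _)]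
    simp
  · have hhE : ∀ i j, ⁅h₁ + h₂, E₂ i j⁆ = 0 := fun i j => by
      rw [add_lie, show ⁅h₁, E₂ i j⁆ = 0 from hhφ _, show ⁅h₂, E₂ i j⁆ = 0 from H₂.hdelta_U _,
        add_zero]
    have hhF : ∀ i j, ⁅h₁ + h₂, shiftDiag E₁ c i j⁆ = 0 := fun i j => by
      rw [lie_shiftDiag, add_lie, show ⁅h₁, E₁ i j⁆ = 0 from H₁.hdelta_U _,
        show ⁅h₂, E₁ i j⁆ = 0 from lie_eq_zero_symm (hφh _), add_zero]
      rw [hc, lie_smul, add_lie, lie_self, lie_eq_zero_symm hhh, add_zero, smul_zero]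
    rw [lie_add, lie_add, ring_lie_smul, add_lie, add_lie, H₁.hdelta_xi, H₂.hdelta_xi, hhξ,
      lie_eq_zero_symm hξh, matMul, lie_sum]
    simp [lie_mul_leibniz, hhE, hhF]
  · refine ((?_ : IsLowest _ ξ₁).add ?_).add
      ((isLowest_of_equivariant hn (Q := matMul (shiftDiag E₁ c) E₂) hQ).smul η)
    · rw [hE]
      exact H₁.isLowest.add_family hEξ₁ hEE
    · rw [hE]
      simp only [add_comm (E₁ _ _)]
      exact H₂.isLowest.add_family (fun i j => hφξ _) fun i j k l => lie_eq_zero_symm (hEE _ _ _ _)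
  · intro k hk
    refine QuadRel.congr hk (fun i j hij => ?_) (QuadRel.comul hF₁ hE₂ hFE
      ((H₁.isLowerDiag (by omega)).shiftDiag hcξ₁) (H₂.isLowerDiag (by omega)) hEξ₁ hFξ₂ hξξ hk
      ((H₁.quadRel hn k hk).congr hk fun i j hij => (shiftDiag_of_ne hij).symm)
      (H₂.quadRel hn k hk))
    rw [hE, shiftDiag_of_ne hij]
  · intro k hk
    -- the diagram automorphism exchanges the two tensor factors
    have h1 : matMul (shiftDiag E₁ c) E₂ (Fin.last n) 0 =
        matMul (revFamily E₂) (revFamily (shiftDiag E₁ c)) (Fin.last n) 0 := by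
      unfold matMul revFamily
      rw [← Equiv.sum_comp Fin.revPerm]
      refine Finset.sum_congr rfl fun i _ => ?_
      simp only [Fin.revPerm_apply, Fin.rev_last, Fin.rev_zero, neg_mul, mul_neg, neg_neg]
      exact mul_comm_of_lie (hFE _ _ _ _)
    rw [h1, add_comm ξ₁ ξ₂]
    refine QuadRel.congr hk (fun i j hij => ?_) (QuadRel.comul hE₂.revFamily hF₁.revFamily ?_
      (H₂.isLowerDiag (by omega)).revFamily
      ((H₁.isLowerDiag (by omega)).shiftDiag hcξ₁).revFamily ?_ ?_ (lie_eq_zero_symm hξξ) hk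
      (H₂.quadRel_rev hn k hk)
      ((H₁.quadRel_rev hn k hk).congr hk fun i j hij => ?_))
    · simp only [revFamily, hE, shiftDiag_of_ne (Fin.rev_injective.ne hij.symm), neg_add, add_comm]
    · intro i j k l
      simp only [revFamily, neg_lie, lie_neg, neg_neg, lie_eq_zero_symm (hFE _ _ _ _)]
    · intro i j
      simp only [revFamily, neg_lie, hFξ₂, neg_zero]
    · intro i j
      simp only [revFamily, neg_lie, hEξ₁, neg_zero]
    · simp only [revFamily, shiftDiag_of_ne (Fin.rev_injective.ne hij.symm)]
      rfl

end Comul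

section Antipode

attribute [local instance] LieRing.ofAssociativeRing

open MulOpposite

variable {K : Type*} [CommRing K] {n : ℕ} {η : K} {A : Type*} [Ring A] [Algebra K A]

theorem op_lie_op (a b : A) : ⁅op a, op b⁆ = op ⁅b, a⁆ := by
  simp [Ring.lie_def]

/-- The family `-E` in the opposite algebra, which satisfies the relations of matrix units
if `E` does. -/
def opFamily (E : Fin n → Fin n → A) (i j : Fin n) : Aᵐᵒᵖ := op (-E i j)

theorem IsLowest.opFamily {E : Fin (n + 1) → Fin (n + 1) → A} {x : A} (hx : IsLowest E x) :
    IsLowest (opFamily E) (op (-x)) := by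
  have h : ∀ i j, ⁅DrinfeldYangian.opFamily E i j, op (-x)⁆ = op (-⁅E i j, x⁆) := fun i j => by
    rw [DrinfeldYangian.opFamily, op_lie_op, neg_lie, lie_neg, neg_neg, lie_skew]
  have h' : ∀ i j, ⁅op (-x), DrinfeldYangian.opFamily E i j⁆ = op (-⁅x, E i j⁆) := fun i j => by
    rw [DrinfeldYangian.opFamily, op_lie_op, neg_lie, lie_neg, neg_neg, lie_skew]
  refine ⟨?_, ?_, ?_, ?_, ?_, ?_, ?_⟩
  · rw [h, hx.first, op_neg]
  · rw [h, hx.last]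
  · intro i h0 h1; rw [h, hx.mid i h0 h1]; simp
  · intro i; rw [h', hx.x_f]; simp
  · intro i h0 h1; rw [h, hx.e_x i h0 h1]; simp
  · intro i h0
    rw [h, DrinfeldYangian.opFamily, op_lie_op, neg_lie, lie_neg, neg_neg, ← lie_skew,
      hx.e_e_x i h0]
    simp
  · intro i h0
    rw [h', DrinfeldYangian.opFamily, op_lie_op, neg_lie, lie_neg, neg_neg, ← lie_skew,
      hx.x_e_e i h0]
    simp

theorem quadRel_opFamily {E : Fin (n + 1) → Fin (n + 1) → A} {X : A} {k : Fin (n + 1)}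
    (h : ⁅X, ⁅X, E 0 k⁆⁆ = η • (X * E (Fin.last n) k - ⁅X, E 0 k⁆ * E (Fin.last n) 0)) :
    QuadRel η (opFamily E) (op (-X)) k := by
  have h1 : ⁅op (-X), opFamily E 0 k⁆ = op (-⁅X, E 0 k⁆) := by
    rw [opFamily, op_lie_op, neg_lie, lie_neg, neg_neg, lie_skew]
  have h2 : ⁅op (-⁅X, E 0 k⁆), op (-X)⁆ = op ⁅X, ⁅X, E 0 k⁆⁆ := by
    rw [op_lie_op, neg_lie, lie_neg, neg_neg]
  rw [QuadRel, h1, h2, h]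
  simp only [opFamily, ← op_mul, ← op_sub, ← op_smul, neg_mul_neg]

variable [Algebra ℂ A]

/-- The contragredient of a representation of `sl(n+1)`. -/
theorem exists_usl_hom_op (φ : Usl n →ₐ[ℂ] A) :
    ∃ φ' : Usl n →ₐ[ℂ] Aᵐᵒᵖ, ∀ x, φ' (UniversalEnvelopingAlgebra.ι ℂ x) =
      op (-φ (UniversalEnvelopingAlgebra.ι ℂ x)) := by
  let f : LieAlgebra.SpecialLinear.sl (Fin (n + 1)) ℂ →ₗ⁅ℂ⁆ Aᵐᵒᵖ :=
    { toFun := fun x => op (-φ (UniversalEnvelopingAlgebra.ι ℂ x))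
      map_add' := fun x y => by simp only [map_add, neg_add, op_add]
      map_smul' := fun c x => by simp
      map_lie' := fun {x y} => by
        simp only [LieHom.map_lie, map_ring_lie, op_lie_op, neg_lie, lie_neg, lie_skew] }
  exact ⟨UniversalEnvelopingAlgebra.lift ℂ f,
    fun x => UniversalEnvelopingAlgebra.lift_ι_apply ℂ f x⟩

/-- The defining relations hold for the elements that define the antipode. -/
theorem YangianRelations.antipode (hn : 1 < n) {φ : Usl n →ₐ[ℂ] A} {ξ hδ : A}
    (H : YangianRelations η φ ξ hδ) {φ' : Usl n →ₐ[ℂ] Aᵐᵒᵖ}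
    (hφ' : ∀ x, φ' (UniversalEnvelopingAlgebra.ι ℂ x) =
      op (-φ (UniversalEnvelopingAlgebra.ι ℂ x))) :
    YangianRelations η φ' (op (-ξ + η • (((2 : ℂ)⁻¹ • hδ) * unitImage φ (Fin.last n) 0 +
      ∑ i, unitImage φ (Fin.last n) i * unitImage φ i 0))) (op (-hδ)) := by
  have hE' : unitImage φ' = opFamily (unitImage φ) := by
    funext i j; exact hφ' _
  set c : A := (2 : ℂ)⁻¹ • hδ with hc
  set E := unitImage φ
  have hE : GlRel E := glRel_unitImage φ
  have hhE : ∀ i j, ⁅hδ, E i j⁆ = 0 := fun i j => H.hdelta_U _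
  have hcE : ∀ i j, ⁅c, E i j⁆ = 0 := fun i j => by rw [hc, smul_lie, hhE, smul_zero]
  have hcξ : ⁅c, ξ⁆ = 0 := by rw [hc, smul_lie, H.hdelta_xi, smul_zero]
  let Q : Fin (n + 1) → Fin (n + 1) → A := fun a b => c * E a b + matMul E E a b
  have hEQ : ∀ k l a b, ⁅E k l, Q a b⁆ =
      (if l = a then Q k b else 0) - (if k = b then Q a l else 0) := by
    intro k l a b
    simp only [Q]
    rw [lie_add, lie_mul_leibniz, lie_eq_zero_symm (hcE _ _), zero_mul, zero_add, hE,
      lie_matMul _ k l (fun a i => hE _ _ _ _) (fun i b => hE _ _ _ _)]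
    split_ifs <;> noncomm_ring
  obtain ⟨X, hX⟩ : ∃ X, X = ξ - η • Q (Fin.last n) 0 := ⟨_, rfl⟩
  have hS : -ξ + η • (c * E (Fin.last n) 0 + ∑ i, E (Fin.last n) i * E i 0) = -X := by
    rw [hX, neg_sub, neg_add_eq_sub]; rfl
  rw [hS]
  have hhX : ⁅hδ, X⁆ = 0 := by
    rw [hX, lie_sub, H.hdelta_xi, ring_lie_smul]
    simp only [Q]
    rw [lie_add, lie_mul_leibniz, hc, lie_smul, matMul, lie_sum]
    simp [lie_mul_leibniz, hhE]
  refine yangianRelations_of_quadRel hn ?_ ?_ ?_ ?_ ?_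
  · refine lie_usl_hom_eq_zero φ' fun x => ?_
    rw [hφ', op_lie_op, neg_lie, lie_neg, neg_neg, lie_eq_zero_symm (H.hdelta_U _), op_zero]
  · rw [op_lie_op, neg_lie, lie_neg, neg_neg, lie_eq_zero_symm hhX, op_zero]
  · rw [hE']
    refine IsLowest.opFamily ?_
    rw [hX, sub_eq_add_neg, ← neg_smul]
    exact H.isLowest.add ((isLowest_of_equivariant hn hEQ).smul _)
  · intro k hk
    rw [hE']
    exact quadRel_opFamily (QuadRel.antipode hE hcE hcξ (H.isLowerDiag (by omega)) hk
      (H.quadRel hn k hk) Q (fun _ _ => rfl) X hX)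
  · intro k hk
    -- reversing the factors of the products `E_{n+1,i} E_{i,1}` changes the sum by a multiple of
    -- `E_{n+1,1}`, which is absorbed by another choice of the central element
    have h1 : revFamily (opFamily E) = opFamily (revFamily E) := rfl
    rw [hE', h1]
    have h2 : matMul (revFamily E) (revFamily E) (Fin.last n) 0 =
        matMul E E (Fin.last n) 0 - ((n : A) + 1) * E (Fin.last n) 0 := by
      unfold matMul revFamily
      rw [← Equiv.sum_comp Fin.revPerm]
      have : ∀ i, E i 0 * E (Fin.last n) i = E (Fin.last n) i * E i 0 - E (Fin.last n) 0 := by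
        intro i
        have h := hE i 0 (Fin.last n) i
        rw [if_neg hk.zero_ne_last, if_pos rfl, Ring.lie_def, sub_eq_iff_eq_add] at h
        rw [h]; abel
      simp [this, add_mul]
    have hcE' : ∀ i j, ⁅-c - ((n : A) + 1), revFamily E i j⁆ = 0 := fun i j => by
      have h3 : ⁅(n : A) + 1, E j.rev i.rev⁆ = 0 := by
        rw [Ring.lie_def, sub_eq_zero]
        exact ((Nat.cast_commute n _).add_left (Commute.one_left _))
      rw [revFamily, lie_neg, sub_lie, neg_lie, hcE, h3]
      simp
    have hcξ' : ⁅-c - ((n : A) + 1), ξ⁆ = 0 := by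
      have h3 : ⁅(n : A) + 1, ξ⁆ = 0 := by
        rw [Ring.lie_def, sub_eq_zero]
        exact ((Nat.cast_commute n _).add_left (Commute.one_left _))
      rw [sub_lie, neg_lie, hcξ, h3]
      simp
    refine quadRel_opFamily (QuadRel.antipode hE.revFamily hcE' hcξ'
      (H.isLowerDiag (by omega)).revFamily hk (H.quadRel_rev hn k hk) _ (fun _ _ => rfl) X ?_)
    rw [h2, hX]
    congr 2
    simp only [Q, revFamily, Fin.rev_last, Fin.rev_zero]
    noncomm_ring

/-- Elements that commute with the image of `U(sl(n+1))` give solutions of the defining relations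
with `ξ_{δ-θ} = 0`. -/
theorem yangianRelations_zero {φ : Usl n →ₐ[ℂ] A} {hδ : A} (h : ∀ u, ⁅hδ, φ u⁆ = 0) :
    YangianRelations η φ 0 hδ := by
  refine ⟨h, ?_, ?_, ?_, ?_, ?_, ?_, ?_, ?_, ?_, ?_⟩ <;> simp

end Antipode

/-! ### Antipodes on generators -/

section AntipodeOfGenerators

open MulOpposite

variable {K : Type*} [CommRing K] {A : Type*} [Ring A] [Algebra K A]

/-- The linear map underlying a homomorphism to the opposite algebra. -/
def unopLinear (S : A →ₐ[K] Aᵐᵒᵖ) : A →ₗ[K] A :=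
  (opLinearEquiv K).symm.toLinearMap ∘ₗ S.toLinearMap

@[simp] theorem unopLinear_apply (S : A →ₐ[K] Aᵐᵒᵖ) (a : A) : unopLinear S a = unop (S a) := rfl

theorem mul_rTensor_mul (S : A →ₐ[K] Aᵐᵒᵖ) {t : A ⊗[K] A} {r : K}
    (ht : LinearMap.mul' K A ((unopLinear S).rTensor A t) = algebraMap K A r) (s : A ⊗[K] A) :
    LinearMap.mul' K A ((unopLinear S).rTensor A (t * s)) =
      algebraMap K A r * LinearMap.mul' K A ((unopLinear S).rTensor A s) := by
  have key : ∀ (c d : A) (t : A ⊗[K] A),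
      LinearMap.mul' K A ((unopLinear S).rTensor A (t * c ⊗ₜ[K] d)) =
        unop (S c) * LinearMap.mul' K A ((unopLinear S).rTensor A t) * d := by
    intro c d t
    induction t using TensorProduct.induction_on with
    | zero => simp
    | tmul a b => simp [mul_assoc]
    | add x y hx hy => rw [add_mul, map_add, map_add, hx, hy, map_add, map_add, mul_add, add_mul]
  induction s using TensorProduct.induction_on with
  | zero => simp
  | tmul c d =>
    rw [key, ht, ← Algebra.commutes, mul_assoc]
    simp
  | add x y hx hy => rw [mul_add, map_add, map_add, hx, hy, map_add, map_add, mul_add]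

theorem mul_lTensor_mul (S : A →ₐ[K] Aᵐᵒᵖ) {s : A ⊗[K] A} {r : K}
    (hs : LinearMap.mul' K A ((unopLinear S).lTensor A s) = algebraMap K A r) (t : A ⊗[K] A) :
    LinearMap.mul' K A ((unopLinear S).lTensor A (t * s)) =
      algebraMap K A r * LinearMap.mul' K A ((unopLinear S).lTensor A t) := by
  have key : ∀ (a b : A) (s : A ⊗[K] A),
      LinearMap.mul' K A ((unopLinear S).lTensor A (a ⊗ₜ[K] b * s)) =
        a * LinearMap.mul' K A ((unopLinear S).lTensor A s) * unop (S b) := by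
    intro c d t
    induction t using TensorProduct.induction_on with
    | zero => simp
    | tmul a b => simp [mul_assoc]
    | add x y hx hy => rw [mul_add, map_add, map_add, hx, hy, map_add, map_add, mul_add, add_mul]
  induction t using TensorProduct.induction_on with
  | zero => simp
  | tmul a b =>
    rw [key, hs, ← Algebra.commutes, mul_assoc]
    simp
  | add x y hx hy => rw [add_mul, map_add, map_add, hx, hy, map_add, map_add, mul_add]

variable (Δ : A →ₐ[K] A ⊗[K] A) (ε : A →ₐ[K] K) (S : A →ₐ[K] Aᵐᵒᵖ)

/-- The elements at which both antipode identities hold, for an algebra homomorphism `S` to the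
opposite algebra. -/
def antipodeSubalgebra : Subalgebra K A where
  carrier := {a | LinearMap.mul' K A ((unopLinear S).rTensor A (Δ a)) = algebraMap K A (ε a) ∧
    LinearMap.mul' K A ((unopLinear S).lTensor A (Δ a)) = algebraMap K A (ε a)}
  mul_mem' {a b} ha hb := by
    refine ⟨?_, ?_⟩
    · rw [map_mul, mul_rTensor_mul S ha.1, hb.1, map_mul, map_mul]
    · rw [map_mul, mul_lTensor_mul S hb.2, ha.2, map_mul, map_mul, Algebra.commutes]
  add_mem' {a b} ha hb := by
    refine ⟨?_, ?_⟩
    · rw [map_add, map_add, map_add, ha.1, hb.1, map_add, map_add]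
    · rw [map_add, map_add, map_add, ha.2, hb.2, map_add, map_add]
  algebraMap_mem' r := by
    simp [Algebra.TensorProduct.algebraMap_apply]

end AntipodeOfGenerators

/-! ### Uniqueness of Hopf structures -/

section Unique

variable {K : Type*} [CommRing K] {A : Type*} [Ring A] [Algebra K A]

/-- A Hopf structure is determined by its comultiplication. -/
theorem HopfStructure.ext_of_comul {H H' : HopfStructure K A} (h : H.comul = H'.comul) :
    H = H' := by
  have hε : H.counit = H'.counit := by
    have h1 : (Algebra.TensorProduct.lift H.counit H'.counit fun _ _ => Commute.all _ _) =
        H'.counit.comp ((Algebra.TensorProduct.lid K A).toAlgHom.comp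
          (Algebra.TensorProduct.map H.counit (.id K A))) := by
      ext <;> simp
    have h2 : (Algebra.TensorProduct.lift H.counit H'.counit fun _ _ => Commute.all _ _) =
        H.counit.comp ((Algebra.TensorProduct.rid K K A).toAlgHom.comp
          (Algebra.TensorProduct.map (.id K A) H'.counit)) := by
      ext <;> simp
    ext a
    have e1 := DFunLike.congr_fun H.counit_comul a
    have e2 := DFunLike.congr_fun H'.comul_counit a
    have e3 := DFunLike.congr_fun h1 (H.comul a)
    have e4 := DFunLike.congr_fun h2 (H.comul a)
    rw [← h] at e2
    simp only [AlgHom.comp_apply] at e1 e2 e3 e4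
    rw [e1] at e3
    rw [e2] at e4
    rw [e3] at e4
    simpa using e4.symm
  have hS : H.antipode = H'.antipode := by
    let _ := H.toHopfAlgebra
    have h1 : WithConv.toConv H.antipode * WithConv.toConv (LinearMap.id : A →ₗ[K] A) = 1 := by
      apply WithConv.ext
      exact H.antipode_left
    have h2 : WithConv.toConv (LinearMap.id : A →ₗ[K] A) * WithConv.toConv H'.antipode = 1 := by
      apply WithConv.ext
      have := H'.antipode_right
      rw [← h, ← hε] at this
      exact this
    exact congrArg WithConv.ofConv (left_inv_eq_right_inv h1 h2)
  cases H; cases H'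
  simp only at h hε hS
  subst h hε hS
  rfl

end Unique

/-! ### The Hopf structure of an algebra with the universal property -/

section Hopf

attribute [local instance] LieRing.ofAssociativeRing

open MulOpposite

variable {K : Type*} [CommRing K] [Algebra ℂ K] {n : ℕ} {η : K} {Y : Type*} [Ring Y]
  [Algebra K Y] [Algebra ℂ Y] [IsScalarTower ℂ K Y] {ι : Usl n →ₐ[ℂ] Y} {ξ hδ : Y}

/-- A subalgebra that contains the image of `sl(n+1)` and the two additional generators is the
whole algebra. -/
theorem eq_top_of_generators (hgen : Algebra.adjoin K (Set.range ι ∪ {ξ, hδ}) = ⊤)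
    (S : Subalgebra K Y) (hι : ∀ x, ι (UniversalEnvelopingAlgebra.ι ℂ x) ∈ S) (hξ : ξ ∈ S)
    (hh : hδ ∈ S) : S = ⊤ := by
  rw [eq_top_iff, ← hgen, Algebra.adjoin_le_iff]
  rintro y (⟨u, rfl⟩ | rfl | rfl)
  · exact usl_hom_mem ι (S.restrictScalars ℂ) hι u
  · exact hξ
  · exact hh

theorem hom_ext_of_generators (hgen : Algebra.adjoin K (Set.range ι ∪ {ξ, hδ}) = ⊤)
    {A : Type*} [Ring A] [Algebra K A] {p q : Y →ₐ[K] A}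
    (hι : ∀ x, p (ι (UniversalEnvelopingAlgebra.ι ℂ x)) = q (ι (UniversalEnvelopingAlgebra.ι ℂ x)))
    (hξ : p ξ = q ξ) (hh : p hδ = q hδ) : p = q := by
  have h := eq_top_of_generators hgen (AlgHom.equalizer p q) hι hξ hh
  ext y
  have : y ∈ AlgHom.equalizer p q := h ▸ Algebra.mem_top
  exact this

theorem YangianRelations.map (H : YangianRelations η ι ξ hδ) {A : Type*} [Ring A] [Algebra K A]
    [Algebra ℂ A] [IsScalarTower ℂ K A] (p : Y →ₐ[K] A) :
    YangianRelations η ((p.restrictScalars ℂ).comp ι) (p ξ) (p hδ) := by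
  have hE : ∀ a b, unitImage ((p.restrictScalars ℂ).comp ι) a b = p (unitImage ι a b) :=
    fun _ _ => rfl
  constructor
  · intro u
    change ⁅p hδ, p (ι u)⁆ = 0
    rw [← map_ring_lie, H.hdelta_U, map_zero]
  · rw [← map_ring_lie, H.hdelta_xi, map_zero]
  · rw [hE, ← map_ring_lie, H.first_xi, map_neg]
  · rw [hE, ← map_ring_lie, H.last_xi]
  · intro a h0 h1; rw [hE, ← map_ring_lie, H.mid_xi a h0 h1, map_zero]
  · intro a; rw [hE, ← map_ring_lie, H.xi_f, map_zero]
  · intro a h0 h1; rw [hE, ← map_ring_lie, H.e_xi a h0 h1, map_zero]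
  · intro a h0; rw [hE, ← map_ring_lie, ← map_ring_lie, H.e_e_xi a h0, map_zero]
  · intro a h0; rw [hE, ← map_ring_lie, ← map_ring_lie, H.xi_e_e a h0, map_zero]
  · intro a h0
    simp only [hE, ← map_ring_lie, ← map_mul, ← map_sub, ← map_smul, H.e_xi_xi a h0]
  · intro a h0
    simp only [hE, ← map_ring_lie, ← map_mul, ← map_sub, ← map_smul, H.xi_xi_e a h0]

/-- The prescribed values of the comultiplication on generators solve the defining relations. -/
theorem exists_relations_tensor (hn : 1 < n) (H : YangianRelations η ι ξ hδ) :
    ∃ φ : Usl n →ₐ[ℂ] Y ⊗[K] Y,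
      (∀ x, φ (UniversalEnvelopingAlgebra.ι ℂ x) =
        ι (UniversalEnvelopingAlgebra.ι ℂ x) ⊗ₜ[K] 1 +
          1 ⊗ₜ[K] ι (UniversalEnvelopingAlgebra.ι ℂ x)) ∧
      YangianRelations η φ (ξ ⊗ₜ[K] 1 + 1 ⊗ₜ[K] ξ +
        η • (((2 : ℂ)⁻¹ • hδ) ⊗ₜ[K] unitImage ι (Fin.last n) 0 +
          ∑ i : Fin (n + 1), unitImage ι (Fin.last n) i ⊗ₜ[K] unitImage ι i 0))
        (hδ ⊗ₜ[K] 1 + 1 ⊗ₜ[K] hδ) := by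
  let iL : Y →ₐ[K] Y ⊗[K] Y := Algebra.TensorProduct.includeLeft
  let iR : Y →ₐ[K] Y ⊗[K] Y := Algebra.TensorProduct.includeRight
  have hLR : ∀ a b, ⁅iL a, iR b⁆ = 0 := by
    intro a b
    simp [iL, iR, Ring.lie_def]
  obtain ⟨φ, hφ⟩ := exists_usl_hom_add ((iL.restrictScalars ℂ).comp ι)
    ((iR.restrictScalars ℂ).comp ι) (fun x y => hLR _ _)
  refine ⟨φ, hφ, ?_⟩
  have h := (H.map iL).comul hn (H.map iR) hφ (fun _ _ => hLR _ _) (fun _ => hLR _ _)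
    (fun _ => hLR _ _) (fun _ => hLR _ _) (hLR _ _) (hLR _ _) (fun _ => hLR _ _) (hLR _ _) (hLR _ _)
  have hmul : ∀ a b, iL a * iR b = a ⊗ₜ[K] b := fun a b => by simp [iL, iR]
  have hE₁ : ∀ a b, unitImage ((iL.restrictScalars ℂ).comp ι) a b = iL (unitImage ι a b) :=
    fun _ _ => rfl
  have hE₂ : ∀ a b, unitImage ((iR.restrictScalars ℂ).comp ι) a b = iR (unitImage ι a b) :=
    fun _ _ => rfl
  have hc : (2 : ℂ)⁻¹ • iL hδ = iL ((2 : ℂ)⁻¹ • hδ) :=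
    (map_smul (iL.restrictScalars ℂ) (2 : ℂ)⁻¹ hδ).symm
  simp only [hE₁, hE₂, hc, hmul] at h
  exact h

/-- An algebra that is presented by the defining relations of the Yangian has a Hopf structure with
the prescribed values on generators. -/
theorem exists_isYangianHopf {K Y : Type u} [CommRing K] [Algebra ℂ K] {η : K} [Ring Y]
    [Algebra K Y] [Algebra ℂ Y] [IsScalarTower ℂ K Y] {ι : Usl n →ₐ[ℂ] Y} {ξ hδ : Y} (hn : 1 < n)
    (H : YangianRelations η ι ξ hδ)
    (hgen : Algebra.adjoin K (Set.range ι ∪ {ξ, hδ}) = ⊤)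
    (hlift : ∀ (A : Type u) [Ring A] [Algebra ℂ A] [Algebra K A] [IsScalarTower ℂ K A]
      (φ : Usl n →ₐ[ℂ] A) (ξ' hδ' : A), YangianRelations η φ ξ' hδ' →
        ∃ p : Y →ₐ[K] A, (∀ u, p (ι u) = φ u) ∧ p ξ = ξ' ∧ p hδ = hδ') :
    ∃ HS : HopfStructure K Y, IsYangianHopf η ι ξ hδ HS := by
  obtain ⟨φΔ, hφΔ, HΔ⟩ := exists_relations_tensor hn H
  obtain ⟨Δ, hΔι, hΔξ, hΔh⟩ := hlift _ _ _ _ HΔ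
  obtain ⟨φS, hφS⟩ := exists_usl_hom_op ι
  obtain ⟨S, hSι, hSξ, hSh⟩ := hlift _ _ _ _ (H.antipode hn hφS)
  let φε : Usl n →ₐ[ℂ] K := UniversalEnvelopingAlgebra.lift ℂ 0
  have hφε : ∀ x, φε (UniversalEnvelopingAlgebra.ι ℂ x) = 0 := fun x =>
    UniversalEnvelopingAlgebra.lift_ι_apply ℂ _ x
  obtain ⟨ε, hει, hεξ, hεh⟩ := hlift _ φε 0 0 (yangianRelations_zero fun u => by simp)
  have hΔ : ∀ x, Δ (ι (UniversalEnvelopingAlgebra.ι ℂ x)) =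
      ι (UniversalEnvelopingAlgebra.ι ℂ x) ⊗ₜ[K] 1 +
        1 ⊗ₜ[K] ι (UniversalEnvelopingAlgebra.ι ℂ x) := fun x => by rw [hΔι, hφΔ]
  have hΔE : ∀ i j, Δ (unitImage ι i j) = unitImage ι i j ⊗ₜ[K] 1 + 1 ⊗ₜ[K] unitImage ι i j :=
    fun i j => hΔ _
  have hS : ∀ x, S (ι (UniversalEnvelopingAlgebra.ι ℂ x)) =
      op (-ι (UniversalEnvelopingAlgebra.ι ℂ x)) := fun x => by rw [hSι, hφS]
  have hSE : ∀ i j, S (unitImage ι i j) = op (-unitImage ι i j) := fun i j => hS _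
  have hε : ∀ x, ε (ι (UniversalEnvelopingAlgebra.ι ℂ x)) = 0 := fun x => by rw [hει, hφε]
  have hεE : ∀ i j, ε (unitImage ι i j) = 0 := fun i j => hε _
  have hΔc : ∀ c : ℂ, Δ (c • hδ) = (c • hδ) ⊗ₜ[K] 1 + 1 ⊗ₜ[K] (c • hδ) := fun c => by
    rw [show Δ (c • hδ) = c • Δ hδ from map_smul (Δ.restrictScalars ℂ) c hδ, hΔh, smul_add,
      TensorProduct.smul_tmul', TensorProduct.tmul_smul]
  have hSc : ∀ c : ℂ, S (c • hδ) = op (-(c • hδ)) := fun c => by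
    rw [show S (c • hδ) = c • S hδ from map_smul (S.restrictScalars ℂ) c hδ, hSh, ← op_smul,
      smul_neg]
  have hεc : ∀ c : ℂ, ε (c • hδ) = 0 := fun c => by
    rw [show ε (c • hδ) = c • ε hδ from map_smul (ε.restrictScalars ℂ) c hδ, hεh, smul_zero]
  -- `½ h_δ` is made opaque, so that `simp` does not move the scalar out of the tensor products
  obtain ⟨c, hc⟩ : ∃ c, c = (2 : ℂ)⁻¹ • hδ := ⟨_, rfl⟩
  have hΔ2 := hΔc (2 : ℂ)⁻¹
  have hS2 := hSc (2 : ℂ)⁻¹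
  have hε2 := hεc (2 : ℂ)⁻¹
  have hΔξc := hΔξ
  have hSξc := hSξ
  rw [← hc] at hΔ2 hS2 hε2 hΔξc hSξc
  have htop : antipodeSubalgebra Δ ε S = ⊤ := by
    refine eq_top_of_generators hgen _ (fun x => ?_) ?_ ?_
    · constructor <;> simp [hΔ, hS, hε, -UniversalEnvelopingAlgebra.ι_apply]
    · constructor
      · simp [hΔξc, hSξc, hεξ, hS2, hSE]
        abel
      · simp [hΔξc, hSξc, hεξ, hSE]
        abel
    · constructor <;> simp [hΔh, hSh, hεh]
  have hanti : ∀ y, y ∈ antipodeSubalgebra Δ ε S := fun y => htop ▸ Algebra.mem_top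
  refine ⟨⟨Δ, ε, unopLinear S, ?_, ?_, ?_, ?_, ?_⟩, ?_, ?_, hΔξ, congrArg unop hSξ⟩
  · refine hom_ext_of_generators hgen (fun x => ?_) ?_ ?_
    · simp [hΔ, TensorProduct.add_tmul, TensorProduct.tmul_add, add_assoc,
        Algebra.TensorProduct.one_def, -UniversalEnvelopingAlgebra.ι_apply]
    · simp [hΔξc, hΔ2, hΔE, TensorProduct.add_tmul, TensorProduct.tmul_add,
        TensorProduct.sum_tmul, TensorProduct.tmul_sum, Finset.sum_add_distrib,
        Algebra.TensorProduct.one_def, TensorProduct.tmul_smul, ← TensorProduct.smul_tmul']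
      abel
    · simp [hΔh, TensorProduct.add_tmul, TensorProduct.tmul_add, add_assoc,
        Algebra.TensorProduct.one_def]
  · refine hom_ext_of_generators hgen (fun x => ?_) ?_ ?_
    · simp [hΔ, hε, -UniversalEnvelopingAlgebra.ι_apply]
    · simp [hΔξc, hε2, hεE, hεξ]
    · simp [hΔh, hεh]
  · refine hom_ext_of_generators hgen (fun x => ?_) ?_ ?_
    · simp [hΔ, hε, -UniversalEnvelopingAlgebra.ι_apply]
    · simp [hΔξc, hεE, hεξ]
    · simp [hΔh, hεh]
  · ext y
    exact (hanti y).1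
  · ext y
    exact (hanti y).2
  · intro x c
    simp only [map_add, hΔ, hΔc, TensorProduct.add_tmul, TensorProduct.tmul_add]
    abel
  · intro x c
    rw [unopLinear_apply, map_add, hS, hSc, ← op_add, unop_op, neg_add]

/-- The formulas determine the Hopf structure. -/
theorem IsYangianHopf.unique (hgen : Algebra.adjoin K (Set.range ι ∪ {ξ, hδ}) = ⊤)
    {H H' : HopfStructure K Y} (h : IsYangianHopf η ι ξ hδ H) (h' : IsYangianHopf η ι ξ hδ H') :
    H' = H := by
  refine HopfStructure.ext_of_comul (hom_ext_of_generators hgen (fun x => ?_) ?_ ?_)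
  · have h1 := h.comul_prim x 0
    have h2 := h'.comul_prim x 0
    rw [zero_smul, add_zero] at h1 h2
    rw [h1, h2]
  · rw [h.comul_xi, h'.comul_xi]
  · have h1 := h.comul_prim 0 1
    have h2 := h'.comul_prim 0 1
    rw [map_zero, map_zero, one_smul, zero_add] at h1 h2
    rw [h1, h2]

end Hopf

/-! ### Comparison with the formulas of the Drinfeldian -/

section Specialization

open PowerSeries (constantCoeff)

attribute [local instance] LieRing.ofAssociativeRing

theorem sum_univ_eq_ends_add_sum_Ioo {M : Type*} [AddCommMonoid M] {n : ℕ} (hn : 0 < n)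
    (F : Fin (n + 1) → M) (f : ℕ → M) (hf : ∀ i : Fin (n + 1), 0 < i.val → i.val < n → f i = F i) :
    ∑ i, F i = F 0 + F (Fin.last n) + ∑ i ∈ Finset.Ioo 0 n, f i := by
  let f' : ℕ → M := fun i => if i = 0 then F 0 else if i = n then F (Fin.last n) else f i
  have h1 : ∀ i : Fin (n + 1), F i = f' i := by
    intro i
    simp only [f']
    split_ifs with h0 h1
    · exact congrArg F (Fin.ext h0)
    · exact congrArg F (Fin.ext h1)
    · exact (hf i (by omega) (by omega)).symm
  rw [Finset.sum_congr rfl fun i _ => h1 i, Fin.sum_univ_eq_sum_range, Finset.sum_range_succ,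
    Finset.range_eq_Ico, Finset.sum_eq_sum_Ico_succ_bot hn]
  have h2 : Finset.Ico (0 + 1) n = Finset.Ioo 0 n := by ext; simp; omega
  have h3 : ∑ i ∈ Finset.Ioo 0 n, f' i = ∑ i ∈ Finset.Ioo 0 n, f i := by
    refine Finset.sum_congr rfl fun i hi => ?_
    rw [Finset.mem_Ioo] at hi
    simp [f', hi.1.ne', hi.2.ne]
  rw [h2, h3]
  simp only [f', if_true, if_neg hn.ne']
  abel

variable {K : Type*} [CommRing K] [Algebra ℂ K] {n : ℕ} {η : K} {Y : Type*} [Ring Y]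
  [Algebra K Y] [Algebra ℂ Y] [IsScalarTower ℂ K Y] {ι : Usl n →ₐ[ℂ] Y} {g : Free K n →ₐ[K] Y}

theorem constantCoeff_drinfeldianComul_xi : constantCoeff (drinfeldianComul K n η Gen.xi) =
    gen K Gen.xi ⊗ₜ[K] 1 + 1 ⊗ₜ[K] gen K Gen.xi +
      η • (constantCoeff (lowRoot K n 0 n) ⊗ₜ[K] diagElt K n 0 +
        ((2 : ℂ)⁻¹ • gen K Gen.hdelta + diagElt K n n) ⊗ₜ[K] constantCoeff (lowRoot K n 0 n) +
        ∑ i ∈ Finset.Ioo 0 n,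
          constantCoeff (lowRoot K n i n) ⊗ₜ[K] constantCoeff (lowRoot K n 0 i)) := by
  simp only [drinfeldianComul, map_add, constantCoeff_tmulSeries, constantCoeff_smul', map_mul,
    map_sum, constantCoeff_qpow, constantCoeff_qnum, PowerSeries.constantCoeff_C, map_one, mul_one,
    ← Algebra.TensorProduct.one_def]

/-- At `q = 1` only the terms with `k = 1` survive in the last sum of the antipode, because of the
factor `(q - q⁻¹) ^ (k - 1)`. -/
theorem constantCoeff_drinfeldianAntipode_xi (hn : 0 < n) :
    constantCoeff (drinfeldianAntipode K n η Gen.xi) =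
      -gen K Gen.xi + η • (((2 : ℂ)⁻¹ • gen K Gen.hdelta + diagElt K n 0 + diagElt K n n + 1) *
        constantCoeff (lowRoot K n 0 n)) + η • ∑ i ∈ Finset.Ioo 0 n,
          constantCoeff (lowRoot K n i n) * constantCoeff (lowRoot K n 0 i) := by
  simp only [drinfeldianAntipode, map_add, map_neg, constantCoeff_smul', map_mul, map_sub, map_pow,
    map_sum, constantCoeff_qpow, constantCoeff_qnum, PowerSeries.constantCoeff_C, one_mul, mul_one,
    sub_self]
  rw [Finset.sum_eq_single 1]
  · simp [Finset.powersetCard_one, chainProd]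
  · intro k hk hk1
    rw [Finset.mem_Icc] at hk
    rw [zero_pow (by omega), zero_mul]
  · intro h
    exact absurd (Finset.mem_Icc.2 ⟨le_rfl, hn⟩) h

theorem IsYangianHopf.specialization (hn : 0 < n) (hι : MatchesChevalley g ι)
    {H : HopfStructure K Y}
    (h : IsYangianHopf η ι (g (gen K Gen.xi)) (g (gen K Gen.hdelta)) H) (x : Gen n) :
    H.comul (g (gen K x)) =
        Algebra.TensorProduct.map g g (constantCoeff (drinfeldianComul K n η x)) ∧
      H.antipode (g (gen K x)) = g (constantCoeff (drinfeldianAntipode K n η x)) := by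
  have hprim : ∀ x, H.comul (ι (UniversalEnvelopingAlgebra.ι ℂ x)) =
      ι (UniversalEnvelopingAlgebra.ι ℂ x) ⊗ₜ[K] 1 +
        1 ⊗ₜ[K] ι (UniversalEnvelopingAlgebra.ι ℂ x) := fun x => by
    simpa only [zero_smul, add_zero] using h.comul_prim x 0
  have hanti : ∀ x, H.antipode (ι (UniversalEnvelopingAlgebra.ι ℂ x)) =
      -ι (UniversalEnvelopingAlgebra.ι ℂ x) := fun x => by
    simpa only [zero_smul, add_zero] using h.antipode_prim x 0
  have hE : ∀ i j, H.comul (unitImage ι i j) = unitImage ι i j ⊗ₜ[K] 1 + 1 ⊗ₜ[K] unitImage ι i j :=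
    fun i j => hprim _
  have hS : ∀ i j, H.antipode (unitImage ι i j) = -unitImage ι i j := fun i j => hanti _
  have hlast : (0 : Fin (n + 1)) < Fin.last n := Fin.lt_def.2 (by simpa using hn)
  have hd := map_diagElt (fun i => (hι i).1.symm)
  have hd0 : g (diagElt K n 0) = unitImage ι 0 0 := by simpa using hd 0
  have hdn : g (diagElt K n n) = unitImage ι (Fin.last n) (Fin.last n) := by
    simpa using hd (Fin.last n)
  have hl := map_lowRoot (fun i => (hι i).2.2.symm)
  have hlr : g (constantCoeff (lowRoot K n 0 n)) = unitImage ι (Fin.last n) 0 := by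
    simpa using hl 0 (Fin.last n) hlast
  have hl0 : ∀ i : Fin (n + 1), 0 < i.val →
      g (constantCoeff (lowRoot K n 0 i)) = unitImage ι i 0 := fun i h0 => by
    simpa using hl 0 i (Fin.lt_def.2 h0)
  have hln : ∀ i : Fin (n + 1), i.val < n →
      g (constantCoeff (lowRoot K n i n)) = unitImage ι (Fin.last n) i := fun i h1 => by
    simpa using hl i (Fin.last n) (Fin.lt_def.2 h1)
  have hhd : g ((2 : ℂ)⁻¹ • gen K Gen.hdelta) = (2 : ℂ)⁻¹ • g (gen K Gen.hdelta) :=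
    map_smul (g.restrictScalars ℂ) _ _
  cases x with
  | h i =>
    rw [← (hι i).1]
    constructor
    · simp only [drinfeldianComul, map_add, map_sub, constantCoeff_tmulSeries, map_one,
        PowerSeries.constantCoeff_C, Algebra.TensorProduct.map_tmul, hE, ← (hι i).1,
        TensorProduct.sub_tmul, TensorProduct.tmul_sub]
      abel
    · simp only [drinfeldianAntipode, map_sub, map_neg, PowerSeries.constantCoeff_C, hS, ← (hι i).1]
      abel
  | e i =>
    rw [← (hι i).2.1]
    constructor
    · simp only [drinfeldianComul, map_add, constantCoeff_tmulSeries, map_one,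
        PowerSeries.constantCoeff_C, constantCoeff_qpow, Algebra.TensorProduct.map_tmul, hE,
        ← (hι i).2.1]
    · simp only [drinfeldianAntipode, map_neg, map_mul, PowerSeries.constantCoeff_C,
        constantCoeff_qpow, one_mul, hS, ← (hι i).2.1]
  | f i =>
    rw [← (hι i).2.2]
    constructor
    · simp only [drinfeldianComul, map_add, constantCoeff_tmulSeries, map_one,
        PowerSeries.constantCoeff_C, constantCoeff_qpow, Algebra.TensorProduct.map_tmul, hE,
        ← (hι i).2.2]
    · simp only [drinfeldianAntipode, map_neg, map_mul, PowerSeries.constantCoeff_C,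
        constantCoeff_qpow, mul_one, hS, ← (hι i).2.2]
  | hdelta =>
    have h1 := h.comul_prim 0 1
    have h2 := h.antipode_prim 0 1
    rw [map_zero, map_zero, one_smul, zero_add] at h1 h2
    constructor
    · rw [h1]
      simp [drinfeldianComul]
    · rw [h2]
      simp [drinfeldianAntipode]
  | xi =>
    constructor
    · rw [h.comul_xi, constantCoeff_drinfeldianComul_xi, sum_univ_eq_ends_add_sum_Ioo hn _
        (fun i => g (constantCoeff (lowRoot K n i n)) ⊗ₜ[K] g (constantCoeff (lowRoot K n 0 i)))
        fun i h0 h1 => by rw [hl0 i h0, hln i h1]]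
      simp only [map_add, map_smul, map_sum, map_one, Algebra.TensorProduct.map_tmul, hhd, hd0, hdn,
        hlr, TensorProduct.add_tmul]
      congr 2
      abel
    · rw [h.antipode_xi, constantCoeff_drinfeldianAntipode_xi hn,
        sum_univ_eq_ends_add_sum_Ioo hn _
        (fun i => g (constantCoeff (lowRoot K n i n)) * g (constantCoeff (lowRoot K n 0 i)))
        fun i h0 h1 => by rw [hl0 i h0, hln i h1]]
      have h1 : unitImage ι (Fin.last n) 0 * unitImage ι 0 0 =
          unitImage ι 0 0 * unitImage ι (Fin.last n) 0 + unitImage ι (Fin.last n) 0 := by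
        have := glRel_unitImage ι 0 0 (Fin.last n) 0
        rw [if_neg hlast.ne, if_pos rfl, Ring.lie_def, zero_sub, sub_eq_iff_eq_add] at this
        rw [this]; abel
      simp only [map_add, map_neg, map_smul, map_sum, map_mul, hhd, hd0, hdn, hlr, h1,
        add_mul, one_mul]
      rw [add_assoc (-g (gen K Gen.xi)), ← smul_add]
      congr 2
      abel

end Specialization

/-! ### The presentation of the Yangian -/

section YangianPresentation

attribute [local instance] LieRing.ofAssociativeRing

variable {K : Type*} [CommRing K] {n : ℕ} {η : K}

theorem adjoin_generators {Y : Type*} [Ring Y] [Algebra K Y] [Algebra ℂ Y] {ι : Usl n →ₐ[ℂ] Y}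
    {g : Free K n →ₐ[K] Y} (hι : MatchesChevalley g ι) (hg : Function.Surjective g) :
    Algebra.adjoin K (Set.range ι ∪ {g (gen K Gen.xi), g (gen K Gen.hdelta)}) = ⊤ := by
  rw [eq_top_iff]
  rintro y -
  obtain ⟨x, rfl⟩ := hg y
  have hmem : ∀ i j, unitImage ι i j ∈
      Algebra.adjoin K (Set.range ι ∪ {g (gen K Gen.xi), g (gen K Gen.hdelta)}) :=
    fun i j => Algebra.subset_adjoin (Or.inl ⟨_, rfl⟩)
  induction x using FreeAlgebra.induction with
  | grade0 r => rw [AlgHom.commutes]; exact Subalgebra.algebraMap_mem _ r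
  | grade1 x =>
    cases x with
    | h i => exact (hι i).1 ▸ sub_mem (hmem _ _) (hmem _ _)
    | e i => exact (hι i).2.1 ▸ hmem _ _
    | f i => exact (hι i).2.2 ▸ hmem _ _
    | xi => exact Algebra.subset_adjoin (by simp)
    | hdelta => exact Algebra.subset_adjoin (by simp)
  | mul a b ha hb => rw [map_mul]; exact mul_mem ha hb
  | add a b ha hb => rw [map_add]; exact add_mem ha hb

/-- A homomorphism that extends the evaluation at a solution of the defining relations restricts to
the given homomorphism on `U(sl(n+1))`. -/
theorem apply_of_eq_freeEval {Y A : Type*} [Ring Y] [Algebra K Y] [Algebra ℂ Y] [Ring A]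
    [Algebra ℂ A] [Algebra K A] [Algebra ℂ K] [IsScalarTower ℂ K Y] [IsScalarTower ℂ K A]
    {ι : Usl n →ₐ[ℂ] Y} {g : Free K n →ₐ[K] Y} (hι : MatchesChevalley g ι) {φ : Usl n →ₐ[ℂ] A}
    {ξ hδ : A} {p : Y →ₐ[K] A} (hp : ∀ x, p (g x) = freeEval K φ ξ hδ x) :
    (∀ u, p (ι u) = φ u) ∧ p (g (gen K Gen.xi)) = ξ ∧ p (g (gen K Gen.hdelta)) = hδ := by
  refine ⟨?_, (hp _).trans (freeEval_xi φ ξ hδ), (hp _).trans (freeEval_hdelta φ ξ hδ)⟩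
  have h : (p.restrictScalars ℂ).comp ι = φ := by
    refine usl_hom_ext (fun i => ?_) (fun i => ?_)
    · exact (congrArg p (hι i).2.1).trans ((hp _).trans (freeEval_e φ ξ hδ i))
    · exact (congrArg p (hι i).2.2).trans ((hp _).trans (freeEval_f φ ξ hδ i))
  exact DFunLike.congr_fun h

/-- The universal property of the Yangian as an algebra over `U(sl(n+1))`. -/
theorem exists_lift_of_relations [Algebra ℂ K] (hn : 0 < n) {ι : Usl n →ₐ[ℂ] Yangian K n η}
    (hι : MatchesChevalley (A := Yangian K n η) (toYangian K n η) ι) {A : Type*} [Ring A]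
    [Algebra ℂ A] [Algebra K A] [IsScalarTower ℂ K A] {φ : Usl n →ₐ[ℂ] A} {ξ hδ : A}
    (H : YangianRelations η φ ξ hδ) :
    ∃ p : Yangian K n η →ₐ[K] A,
      (∀ u, p (ι u) = φ u) ∧ p (yangianXi K n η) = ξ ∧ p (yangianHdelta K n η) = hδ := by
  obtain ⟨p, hp⟩ := exists_yangian_lift η _ (specializedRel_freeEval hn H)
  exact ⟨p, apply_of_eq_freeEval (Y := Yangian K n η) hι hp⟩

/-- The sum `U(sl(n+1)) + ℂ h_δ` is direct in every algebra with the universal property: `h_δ` may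
be sent to `0` or `1`, and `K ⊗ U(sl(n+1))` contains `U(sl(n+1))`. -/
theorem eq_zero_of_add_smul_eq_zero {K Y : Type u} [CommRing K] [Nontrivial K] [Algebra ℂ K] {η : K}
    [Ring Y] [Algebra K Y] [Algebra ℂ Y] [IsScalarTower ℂ K Y] {ι : Usl n →ₐ[ℂ] Y} {ξ hδ : Y}
    (hlift : ∀ (A : Type u) [Ring A] [Algebra ℂ A] [Algebra K A] [IsScalarTower ℂ K A]
      (φ : Usl n →ₐ[ℂ] A) (ξ' hδ' : A), YangianRelations η φ ξ' hδ' →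
        ∃ p : Y →ₐ[K] A, (∀ u, p (ι u) = φ u) ∧ p ξ = ξ' ∧ p hδ = hδ')
    {u : Usl n} {c : ℂ} (h : ι u + c • hδ = 0) : u = 0 ∧ c = 0 := by
  have hsmul : ∀ {A : Type u} [Ring A] [Algebra ℂ A] [Algebra K A] [IsScalarTower ℂ K A]
      (p : Y →ₐ[K] A), p (c • hδ) = c • p hδ := fun p => map_smul (p.restrictScalars ℂ) c hδ
  have hu : u = 0 := by
    obtain ⟨p, hp, -, hpδ⟩ := hlift (K ⊗[ℂ] Usl n)
      (Algebra.TensorProduct.includeRight : Usl n →ₐ[ℂ] K ⊗[ℂ] Usl n) 0 0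
      (yangianRelations_zero fun u => by simp [Ring.lie_def])
    have h1 := congrArg p h
    rw [map_add, hsmul, hp, hpδ, smul_zero, add_zero, map_zero] at h1
    refine Algebra.TensorProduct.includeRight_injective
      (FaithfulSMul.algebraMap_injective ℂ K) (h1.trans (map_zero _).symm)
  refine ⟨hu, ?_⟩
  let φ : Usl n →ₐ[ℂ] K := UniversalEnvelopingAlgebra.lift ℂ 0
  obtain ⟨p, hp, -, hpδ⟩ := hlift K φ 0 1
    (yangianRelations_zero fun u => by simp [Ring.lie_def])
  have h1 := congrArg p h
  rw [hu, map_zero, zero_add, hsmul, hpδ, map_zero, smul_eq_zero] at h1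
  exact h1.resolve_right one_ne_zero

end YangianPresentation

end DrinfeldYangian

open DrinfeldYangian in
theorem proposition3 {K : Type*} [CommRing K] [Nontrivial K] [Algebra ℂ K] (η : K)
    (n : ℕ) (hn : 1 < n) :
    ∃ ι : Usl n →ₐ[ℂ] Yangian K n η,
      -- `ι` matches the Chevalley generators of `U(sl(n+1))` with those of the Drinfeldian at `q = 1`
      (∀ i : Fin n,
        unitImage ι i.castSucc i.castSucc - unitImage ι i.succ i.succ =
            toYangian K n η (gen K (Gen.h i)) ∧
          unitImage ι i.castSucc i.succ = toYangian K n η (gen K (Gen.e i)) ∧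
          unitImage ι i.succ i.castSucc = toYangian K n η (gen K (Gen.f i))) ∧
      -- `U(sl(n+1)) ⊕ ℂ h_δ` is contained in the Yangian
      (∀ (u : Usl n) (c : ℂ), ι u + c • yangianHdelta K n η = 0 → u = 0 ∧ c = 0) ∧
      -- the Yangian is generated by `U(sl(n+1))`, `ξ_{δ-θ}` and `h_δ`
      Algebra.adjoin K (Set.range ι ∪ {yangianXi K n η, yangianHdelta K n η}) = ⊤ ∧
      -- the relations hold
      (∀ y : Yangian K n η, ⁅yangianHdelta K n η, y⁆ = 0) ∧
      YangianRelations η ι (yangianXi K n η) (yangianHdelta K n η) ∧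
      -- and they are defining relations
      (∀ (A : Type*) [Ring A] [Algebra ℂ A] [Algebra K A] [IsScalarTower ℂ K A]
          (φ : Usl n →ₐ[ℂ] A) (ξ hδ : A), YangianRelations η φ ξ hδ →
        ∃! p : Yangian K n η →ₐ[K] A,
          (∀ u, p (ι u) = φ u) ∧ p (yangianXi K n η) = ξ ∧ p (yangianHdelta K n η) = hδ) ∧
      -- the Hopf structure: it exists, is the `q = 1` value of the one of the Drinfeldian, and is
      -- determined by the explicit formulas
      ∃ H : HopfStructure K (Yangian K n η),
        IsYangianHopf η ι (yangianXi K n η) (yangianHdelta K n η) H ∧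
          IsSpecialization η H ∧
          ∀ H' : HopfStructure K (Yangian K n η),
            IsYangianHopf η ι (yangianXi K n η) (yangianHdelta K n η) H' → H' = H := by
  have hsurj := toYangian_surjective (n := n) η
  have hrel : SpecializedRel (A := Yangian K n η) η (toYangian K n η) :=
    fun a b h => toYangian_eq_of_rel η h
  obtain ⟨ι, hι⟩ := exists_matchesChevalley hrel
  have hgen := adjoin_generators hι hsurj
  have H := yangianRelations_of_specializedRel (by omega) hrel hsurj hι
  refine ⟨ι, hι, fun u c h => ?_, hgen, lie_hdelta_eq_zero hrel hsurj, H, ?_, ?_⟩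
  · exact eq_zero_of_add_smul_eq_zero (Y := Yangian K n η)
      (fun A _ _ _ _ φ ξ hδ Hφ => exists_lift_of_relations (by omega) hι Hφ) h
  · intro A _ _ _ _ φ ξ hδ Hφ
    obtain ⟨p, hp, hpξ, hph⟩ := exists_lift_of_relations (by omega) hι Hφ
    refine ⟨p, ⟨hp, hpξ, hph⟩, fun q hq => ?_⟩
    exact hom_ext_of_generators (Y := Yangian K n η) hgen (fun x => (hq.1 _).trans (hp _).symm)
      (hq.2.1.trans hpξ.symm) (hq.2.2.trans hph.symm)
  · obtain ⟨HS, hHS⟩ := exists_isYangianHopf hn H hgen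
      fun A _ _ _ _ φ ξ hδ Hφ => exists_lift_of_relations (by omega) hι Hφ
    exact ⟨HS, hHS, hHS.specialization (by omega) hι, fun H' hH' => hHS.unique hgen hH'⟩
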